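/- Let $(X,d)$ be a complete metric space with a Borel measure $\mu$ such that $0<\mu(B(x,2r))\le C_d\,\mu(B(x,r))<\infty$ for all $x\in X$, $r>0$, and suppose that $X$ supports a $(1,1)$-Poincaré inequality: there are $C_P>0$, $\lambda\ge 1$ such that for every ball $B(x,r)$, every $u\in L^1_{\mathrm{loc}}(X)$ and every upper gradient $g$ of $u$, $$\frac1{\mu(B(x,r))}\int_{B(x,r)}|u-u_{B(x,r)}|\,d\mu\le \frac{C_P\, r}{\mu(B(x,\lambda r))}\int_{B(x,\lambda r)}g\,d\mu ,$$ where $u_B$ denotes the $\mu$-average of $u$ over $B$. Let $\Omega\subset X$ be a uniform domain, i.e. a nonempty connected open set for which there is $c_U\in(0,1]$ such that all distinct $x,y\in\Omega$ are joined by a curve $\gamma:[0,\ell]\to\Omega$ parametrized by arc length with $\ell\le c_U^{-1}d(x,y)$ and $\operatorname{dist}(\gamma(t),X\setminus\Omega)\ge c_U\min\{t,\ell-t\}$ for all $t\in[0,\ell]$ (with $\operatorname{dist}(\cdot,\emptyset)=\infty$). Suppose that $\mu|_\Omega$ is doubling: there is $c_d>0$ with $0<\mu(B(x,2r)\cap\Omega)\le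 c_d\,\mu(B(x,r)\cap\Omega)<\infty$ for all $x\in\overline\Omega$, $r>0$. Let $N^{1,1}(\Omega)$ be the space of functions $u:\Omega\to[-\infty,\infty]$ with $\|u\|_{N^{1,1}(\Omega)}=\|u\|_{L^1(\Omega)}+\inf_g\|g\|_{L^1(\Omega)}<\infty$, the infimum being over all $1$-weak upper gradients $g$ of $u$ in $\Omega$, and let $M^{1,1}(\Omega)$ be the Hajłasz–Sobolev space of functions $u:\Omega\to[-\infty,\infty]$ with $\|u\|_{M^{1,1}(\Omega)}=\|u\|_{L^1(\Omega)}+\inf_g\|g\|_{L^1(\Omega)}<\infty$, the infimum being over all measurable $g\ge 0$ such that $|u(x)-u(y)|\le d(x,y)(g(x)+g(y))$ for all $x,y\in\Omega$ outside a $\mu$-null set. In both spaces functions that agree $\mu$-a.e. are identified. A real number $Tu(x)$ is the trace of $u$ at $x\in\partial\Omega$ if $$\lim_{r\to0^+}\frac1{\mu(B(x,r)\cap\Omega)}\int_{B(x,r)\cap\Omega}|u-Tu(x)|\,d\mu=0 .$$ Given a Borel measure $\widetilde{\mathcal H}$ on $\partial\Omega$, a Banach space $\mathbb Y$ of ($\widetilde{\mathcal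 H}$-a.e. classes of) real functions on $\partial\Omega$ is called the trace space of $\mathbb X(\Omega)$ with respect to $\widetilde{\mathcal H}$ if every $u\in\mathbb X(\Omega)$ has a trace $Tu(x)$ at $\widetilde{\mathcal H}$-a.e. $x\in\partial\Omega$ and $u\mapsto Tu$ is a bounded linear surjective operator from $\mathbb X(\Omega)$ to $\mathbb Y$. Then for every Borel measure $\widetilde{\mathcal H}$ on $\partial\Omega$, the trace spaces of $N^{1,1}(\Omega)$ and $M^{1,1}(\Omega)$ with respect to $\widetilde{\mathcal H}$ are the same: a Banach space $\mathbb Y$ of functions on $\partial\Omega$ as above is the trace space of $N^{1,1}(\Omega)$ with respect to $\widetilde{\mathcal H}$ if and only if it is the trace space of $M^{1,1}(\Omega)$ with respect to $\widetilde{\mathcal H}$. -/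

import Mathlib

open MeasureTheory Set Filter Topology
open scoped ENNReal NNReal

namespace BoundaryTrace

/-- On `[-∞, ∞]`, `EReal.abs (a - b)` is `∞` as soon as one of `a`, `b` is infinite, also when
`a = b = ∞`.  This is the usual convention for `|u x - u y|` in the definition of upper
gradients. -/
theorem abs_sub_eq_top {a b : EReal} (h : a = ⊤ ∨ a = ⊥ ∨ b = ⊤ ∨ b = ⊥) :
    (a - b).abs = ⊤ := by
  induction a <;> induction b <;> simp_all [sub_eq_add_neg]

/-- On finite values `EReal.abs (a - b)` is the usual `|a - b|`. -/
theorem abs_coe_sub_coe (a b : ℝ) : ((a : EReal) - (b : EReal)).abs = ENNReal.ofReal |a - b| := by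
  rw [← EReal.coe_sub, EReal.abs_def]

section Curves

variable (X : Type*) [MetricSpace X]

/-- A nonconstant compact rectifiable curve, parametrized by arc length: for
`0 ≤ s ≤ t ≤ len`, the length of the curve between the parameters `s` and `t` is `t - s` (so that
it is in particular `1`-Lipschitz on `[0, len]`).  Only the values on `[0, len]` matter.  Every
nonconstant rectifiable curve has such a parametrization, and its length and curve integrals are
defined by means of it. -/
structure Curve where
  /-- the length of the curve -/
  len : ℝ
  len_pos : 0 < len
  /-- the arc length parametrization -/
  toFun : ℝ → X
  unitSpeed : HasUnitSpeedOn toFun (Icc 0 len)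

variable {X}

/-- The curve lies in the set `A`. -/
def Curve.LiesIn (γ : Curve X) (A : Set X) : Prop :=
  ∀ t ∈ Icc 0 γ.len, γ.toFun t ∈ A

/-- The curve integral `∫_γ g ds` of a nonnegative function. -/
noncomputable def Curve.integral (γ : Curve X) (g : X → ℝ≥0∞) : ℝ≥0∞ :=
  ∫⁻ t in Icc 0 γ.len, g (γ.toFun t)

/-- The upper gradient inequality for the pair `(u, g)` along the curve `γ`. -/
def Curve.UpperGradientIneq (γ : Curve X) (u : X → EReal) (g : X → ℝ≥0∞) : Prop :=
  (u (γ.toFun 0) - u (γ.toFun γ.len)).abs ≤ γ.integral g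

/-- `Ω` is a uniform domain.  The distance to an empty complement is `∞`. -/
def IsUniformDomain (Ω : Set X) : Prop :=
  IsOpen Ω ∧ IsConnected Ω ∧
    ∃ c : ℝ, 0 < c ∧ c ≤ 1 ∧ ∀ x ∈ Ω, ∀ y ∈ Ω, x ≠ y →
      ∃ γ : Curve X, γ.LiesIn Ω ∧ γ.toFun 0 = x ∧ γ.toFun γ.len = y ∧
        γ.len ≤ c⁻¹ * dist x y ∧
        ∀ t ∈ Icc 0 γ.len,
          ENNReal.ofReal (c * min t (γ.len - t)) ≤ Metric.infEDist (γ.toFun t) Ωᶜ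

end Curves

section Spaces

variable {X : Type*} [MetricSpace X] [MeasurableSpace X]

/-- The measure `μ` on the whole space is doubling. -/
def IsDoubling (μ : Measure X) : Prop :=
  ∃ C : ℝ≥0, 1 ≤ C ∧ ∀ (x : X) (r : ℝ), 0 < r →
    0 < μ (Metric.ball x (2 * r)) ∧
    μ (Metric.ball x (2 * r)) ≤ C * μ (Metric.ball x r) ∧
    μ (Metric.ball x r) < ⊤

/-- The measure doubling condition for `Ω`: the restriction of `μ` to `Ω` is doubling, with
balls centred in the closure of `Ω`. -/
def IsDoublingOn (μ : Measure X) (Ω : Set X) : Prop :=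
  ∃ C : ℝ≥0, 0 < C ∧ ∀ x ∈ closure Ω, ∀ r : ℝ, 0 < r →
    0 < μ (Metric.ball x (2 * r) ∩ Ω) ∧
    μ (Metric.ball x (2 * r) ∩ Ω) ≤ C * μ (Metric.ball x r ∩ Ω) ∧
    μ (Metric.ball x r ∩ Ω) < ⊤

/-- `g` is an upper gradient of `u` on the whole space. -/
def IsUpperGradient (u : X → EReal) (g : X → ℝ≥0∞) : Prop :=
  Measurable g ∧ ∀ γ : Curve X, γ.UpperGradientIneq u g

/-- The `(1,1)`-Poincaré inequality. -/
def SupportsPoincare (μ : Measure X) : Prop :=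
  ∃ C : ℝ, 0 < C ∧ ∃ lam : ℝ, 1 ≤ lam ∧
    ∀ (x : X) (r : ℝ), 0 < r → ∀ u : X → ℝ, LocallyIntegrable u μ →
      ∀ g : X → ℝ≥0∞, IsUpperGradient (fun y => (u y : EReal)) g →
        ⨍⁻ y in Metric.ball x r, ENNReal.ofReal |u y - ⨍ z in Metric.ball x r, u z ∂μ| ∂μ
          ≤ ENNReal.ofReal (C * r) * ⨍⁻ y in Metric.ball x (lam * r), g y ∂μ

/-- `g` is a `1`-weak upper gradient of `u` in `A`: the upper gradient inequality holds for all
curves in `A` outside a family of zero `1`-modulus, i.e. outside a family on which the curve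
integral of some integrable Borel function `ρ ≥ 0` is infinite. -/
def IsWeakUpperGradientIn (μ : Measure X) (A : Set X) (u : X → EReal) (g : X → ℝ≥0∞) : Prop :=
  AEMeasurable g (μ.restrict A) ∧
    ∃ ρ : X → ℝ≥0∞, Measurable ρ ∧ ∫⁻ x, ρ x ∂μ < ⊤ ∧
      ∀ γ : Curve X, γ.LiesIn A → ¬ γ.UpperGradientIneq u g → γ.integral ρ = ⊤

/- Functions on `A ⊆ X` with values in `[-∞, ∞]` are represented by functions on `X` of which only
the values on `A` are used. -/

/-- The norm of `N^{1,1}(A)`, which is `∞` if there is no integrable `1`-weak upper gradient. -/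
noncomputable def newtonNorm (μ : Measure X) (A : Set X) (u : X → EReal) : ℝ≥0∞ :=
  ∫⁻ x in A, (u x).abs ∂μ +
    ⨅ (g : X → ℝ≥0∞) (_ : IsWeakUpperGradientIn μ A u g), ∫⁻ x in A, g x ∂μ

/-- The Newton-Sobolev space `N^{1,1}(A)`. -/
def newtonSpace (μ : Measure X) (A : Set X) : Set (X → EReal) :=
  {u | AEMeasurable u (μ.restrict A) ∧ newtonNorm μ A u < ⊤}

/-- `g` is admissible for `u` in the definition of the Hajłasz-Sobolev space on `A`. -/
def IsHajlaszGradientIn (μ : Measure X) (A : Set X) (u : X → EReal) (g : X → ℝ≥0∞) : Prop :=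
  AEMeasurable g (μ.restrict A) ∧
    ∃ N ⊆ A, μ N = 0 ∧ ∀ x ∈ A \ N, ∀ y ∈ A \ N, (u x - u y).abs ≤ edist x y * (g x + g y)

/-- The norm of `M^{1,1}(A)`, which is `∞` if there is no integrable admissible function. -/
noncomputable def hajlaszNorm (μ : Measure X) (A : Set X) (u : X → EReal) : ℝ≥0∞ :=
  ∫⁻ x in A, (u x).abs ∂μ +
    ⨅ (g : X → ℝ≥0∞) (_ : IsHajlaszGradientIn μ A u g), ∫⁻ x in A, g x ∂μ

/-- The Hajłasz-Sobolev space `M^{1,1}(A)`. -/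
def hajlaszSpace (μ : Measure X) (A : Set X) : Set (X → EReal) :=
  {u | AEMeasurable u (μ.restrict A) ∧ hajlaszNorm μ A u < ⊤}

/-- The real number `a` is the trace of `u` at the point `x`. -/
def HasTraceAt (μ : Measure X) (Ω : Set X) (u : X → EReal) (x : X) (a : ℝ) : Prop :=
  Tendsto (fun r : ℝ => ⨍⁻ y in Metric.ball x r ∩ Ω, (u y - (a : EReal)).abs ∂μ) (𝓝[>] 0) (𝓝 0)

/-- A Banach space `Y` of (`ν`-a.e. classes of) real functions on `∂Ω`, the class of `f : Y` being
`ι f`, is the trace space with respect to the boundary measure `ν` of the function space `S` on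
`Ω` with norm `N`: there is a trace operator `T : S → Y`, i.e. `T u` is the trace of `u` at
`ν`-almost every boundary point for all `u` in `S`, and it is linear, bounded and surjective.
The functions in `S` are finite a.e. in `Ω` and stand for their a.e. classes, so a linear
combination of two of them is given by its values a.e. in `Ω`. -/
def IsTraceSpace (μ : Measure X) (Ω : Set X) (ν : Measure (frontier Ω))
    (S : Set (X → EReal)) (N : (X → EReal) → ℝ≥0∞)
    {Y : Type*} [NormedAddCommGroup Y] [NormedSpace ℝ Y]
    (ι : Y →ₗ[ℝ] (frontier Ω →ₘ[ν] ℝ)) : Prop :=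
  ∃ T : S → Y,
    (∀ u : S, ∀ᵐ x : frontier Ω ∂ν, HasTraceAt μ Ω u.1 (x : X) (ι (T u) x)) ∧
    (∀ (a b : ℝ) (u v w : S),
      (∀ᵐ x ∂(μ.restrict Ω), w.1 x = (a : EReal) * u.1 x + (b : EReal) * v.1 x) →
        T w = a • T u + b • T v) ∧
    (∃ C : ℝ≥0, ∀ u : S, ENNReal.ofReal ‖T u‖ ≤ C * N u.1) ∧
    Function.Surjective T

end Spaces

end BoundaryTrace

/-! Each function in one of the two spaces is replaced by a regularization that lies in both spaces
and has the same trace at almost every boundary point; a trace operator on one space then induces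
one on the other.

Let `u` belong to either space with gradient `g`. A Hajłasz gradient directly, and a weak upper
gradient through the Poincaré inequality of `X`, give a `(1,1)`-Poincaré inequality on balls well
inside `Ω` (the two `exists_poincareInside`). Average `u` around `z` at a scale proportional to the
distance from `z` to the complement, and call the result `v`. It is locally Lipschitz with constant
controlled by averages of `g` at that scale, so it has an integrable upper gradient. For a Hajłasz
gradient, join `x` and `y` by a uniform curve: each of its points is nontangential to `x` or to `y`,
so the averages of `g` along it are bounded by `(M √h)²` at `x` or at `y`, where `h` is an average
of `g` and `M` a maximal function. Since `M` is bounded on `L²`, and not on `L¹`, the square root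
makes this bound integrable (`exists_hajlasz_gradient`). Hence both norms of `v` are bounded by the
norm of `u` (`exists_regularization`).

Near a boundary point, the integral of `|u - v|` over `B(x,r) ∩ Ω` is at most a constant times `r`
times the integral of `g` over `B(x,4r) ∩ Ω`. So `u` and `v` have the same trace at `x` unless the
codimension one density of `g` at `x` is positive. The set of such points is small in the sense of
codimension one Hausdorff measure, but the boundary measure `ν` is arbitrary and might charge it. It
cannot if a trace space exists: good covers of a density set yield a function in both spaces that
tends to infinity at each of its points, hence has no trace there (`exists_forall_not_hasTraceAt`),
while every function of the space has a trace `ν`-a.e.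

`IsTraceSpace.transfer` then defines the new operator as the old one applied to the regularization.
Linearity follows from uniqueness of traces and injectivity of `ι`, boundedness from the norm
estimate, and surjectivity from regularizing in the opposite direction. -/

namespace BoundaryTrace

/-! ### Doubling measures: comparison of balls, σ-finiteness, separability. -/

section Doubling

variable {X : Type*} [MetricSpace X] [MeasurableSpace X] {μ : Measure X} {Ω : Set X}

theorem IsDoublingOn.measure_ball_inter_pos (h : IsDoublingOn μ Ω) {x : X} (hx : x ∈ closure Ω)
    {r : ℝ} (hr : 0 < r) : 0 < μ (Metric.ball x r ∩ Ω) := by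
  obtain ⟨C, -, hC⟩ := h
  have := (hC x hx (r / 2) (by positivity)).1
  rwa [mul_div_cancel₀ r two_ne_zero] at this

theorem IsDoublingOn.measure_ball_inter_lt_top (h : IsDoublingOn μ Ω) {x : X}
    (hx : x ∈ closure Ω) {r : ℝ} (hr : 0 < r) : μ (Metric.ball x r ∩ Ω) < ⊤ := by
  obtain ⟨C, -, hC⟩ := h
  exact (hC x hx r hr).2.2

/-- Iterated doubling. -/
theorem IsDoublingOn.exists_measure_ball_inter_le (h : IsDoublingOn μ Ω) (K : ℝ) :
    ∃ D : ℝ≥0, 1 ≤ D ∧ ∀ x ∈ closure Ω, ∀ r : ℝ, 0 < r →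
      μ (Metric.ball x (K * r) ∩ Ω) ≤ D * μ (Metric.ball x r ∩ Ω) := by
  obtain ⟨C, -, hC⟩ := h
  obtain ⟨n, hn⟩ := pow_unbounded_of_one_lt K one_lt_two
  refine ⟨(max C 1) ^ n, one_le_pow₀ (le_max_right _ _), fun x hx r hr => ?_⟩
  have key : ∀ m : ℕ, μ (Metric.ball x (2 ^ m * r) ∩ Ω) ≤
      ((max C 1) ^ m : ℝ≥0) * μ (Metric.ball x r ∩ Ω) := by
    intro m
    induction m with
    | zero => simp
    | succ m ih =>
      have h1 := (hC x hx (2 ^ m * r) (by positivity)).2.1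
      rw [← mul_assoc, ← pow_succ'] at h1
      calc _ ≤ _ := h1
        _ ≤ (max C 1 : ℝ≥0) * (((max C 1) ^ m : ℝ≥0) * μ (Metric.ball x r ∩ Ω)) := by
          gcongr
          exact le_max_left _ _
        _ = _ := by rw [← mul_assoc, ← ENNReal.coe_mul, ← pow_succ']
  refine (measure_mono ?_).trans (key n)
  gcongr

theorem IsDoubling.isDoublingOn_univ (h : IsDoubling μ) : IsDoublingOn μ univ := by
  obtain ⟨C, h1, hC⟩ := h
  exact ⟨C, zero_lt_one.trans_le h1, fun x _ r hr => by simpa using hC x r hr⟩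

theorem IsDoubling.measure_ball_pos (h : IsDoubling μ) (x : X) {r : ℝ} (hr : 0 < r) :
    0 < μ (Metric.ball x r) := by
  simpa using h.isDoublingOn_univ.measure_ball_inter_pos (x := x) (by simp) hr

theorem IsDoubling.measure_ball_lt_top (h : IsDoubling μ) (x : X) (r : ℝ) :
    μ (Metric.ball x r) < ⊤ := by
  have h1 := h.isDoublingOn_univ.measure_ball_inter_lt_top (x := x) (r := max r 1) (by simp)
    (by positivity)
  refine (measure_mono ?_).trans_lt h1
  simpa using Metric.ball_subset_ball (le_max_left r 1)

/-- Comparison of the measures of nearby balls. -/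
theorem IsDoubling.exists_measure_ball_le (h : IsDoubling μ) (K : ℝ) :
    ∃ D : ℝ≥0, 1 ≤ D ∧ ∀ (x y : X) (r R : ℝ), 0 < r → dist x y + R ≤ K * r →
      μ (Metric.ball y R) ≤ D * μ (Metric.ball x r) := by
  obtain ⟨D, h1, hD⟩ := h.isDoublingOn_univ.exists_measure_ball_inter_le K
  refine ⟨D, h1, fun x y r R hr hK => ?_⟩
  have := hD x (by simp) r hr
  simp only [inter_univ] at this
  refine (measure_mono (Metric.ball_subset_ball' ?_)).trans this
  rw [dist_comm]
  linarith

theorem IsDoubling.sigmaFinite (h : IsDoubling μ) : SigmaFinite μ := by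
  cases isEmpty_or_nonempty X with
  | inl hX =>
    rw [Measure.eq_zero_of_isEmpty μ]
    infer_instance
  | inr hX =>
    obtain ⟨x⟩ := hX
    refine ⟨⟨⟨fun n => Metric.ball x n, fun _ => trivial, fun n => h.measure_ball_lt_top x n, ?_⟩⟩⟩
    exact Metric.iUnion_ball_nat x

/-- A space with a doubling measure is separable. -/
theorem IsDoubling.secondCountableTopology [OpensMeasurableSpace X] (h : IsDoubling μ) :
    SecondCountableTopology X := by
  have := h.sigmaFinite
  refine Metric.secondCountable_of_almost_dense_set fun ε hε => ?_
  obtain ⟨u, -, hd, hu⟩ := Vitali.exists_disjoint_subfamily_covering_enlargement_ball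
    (univ : Set X) id (fun _ => ε / 5) (ε / 5) (fun _ _ => le_rfl) 5 (by norm_num)
  refine ⟨u, ?_, fun x => ?_⟩
  -- Disjoint balls of positive measure in a σ-finite space are countably many, so the centres form
  -- a countable `ε`-net.
  · have := Measure.countable_meas_pos_of_disjoint_iUnion (μ := μ)
      (As := fun a : u => Metric.ball (a : X) (ε / 5)) (fun _ => measurableSet_ball)
      (fun a b hab => hd a.2 b.2 (fun e => hab (Subtype.ext e)))
    have h2 : {i : u | 0 < μ (Metric.ball (i : X) (ε / 5))} = univ :=
      eq_univ_of_forall fun i => h.measure_ball_pos _ (by positivity)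
    rw [h2, countable_univ_iff] at this
    exact this
  · obtain ⟨b, hb, hsub⟩ := hu x (mem_univ x)
    have : x ∈ Metric.ball b (5 * (ε / 5)) := hsub (Metric.mem_ball_self (by positivity))
    refine ⟨b, hb, ?_⟩
    rw [Metric.mem_ball] at this
    linarith

end Doubling

/-! ### Functions along rectifiable curves. -/

section CurveLemmas

variable {X : Type*} [MetricSpace X]

theorem Curve.edist_le (γ : Curve X) {s t : ℝ} (hs : s ∈ Icc 0 γ.len) (ht : t ∈ Icc 0 γ.len)
    (hst : s ≤ t) : edist (γ.toFun s) (γ.toFun t) ≤ ENNReal.ofReal (t - s) := by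
  have h := γ.unitSpeed hs ht
  rw [NNReal.coe_one, one_mul] at h
  rw [← h]
  exact eVariationOn.edist_le _ ⟨hs, left_mem_Icc.2 hst⟩ ⟨ht, right_mem_Icc.2 hst⟩

theorem Curve.lipschitzOnWith (γ : Curve X) : LipschitzOnWith 1 γ.toFun (Icc 0 γ.len) := by
  intro s hs t ht
  rw [ENNReal.coe_one, one_mul]
  rcases le_total s t with h | h
  · refine (γ.edist_le hs ht h).trans ?_
    rw [edist_dist, Real.dist_eq, abs_sub_comm]
    exact ENNReal.ofReal_le_ofReal (le_abs_self _)
  · rw [edist_comm]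
    refine (γ.edist_le ht hs h).trans ?_
    rw [edist_dist, Real.dist_eq]
    exact ENNReal.ofReal_le_ofReal (le_abs_self _)

/-- A locally Lipschitz function whose pointwise Lipschitz constant is at most `h` has `h` as an
upper gradient. -/
theorem Curve.ofReal_abs_sub_le_integral (γ : Curve X) {Ω : Set X} (hγ : γ.LiesIn Ω) {v : X → ℝ}
    {h : X → ℝ≥0∞} (hloc : LocallyLipschitzOn Ω v)
    (hv : ∀ z ∈ Ω, ∀ᶠ w in 𝓝 z, ENNReal.ofReal |v w - v z| ≤ h z * edist w z) :
    ENNReal.ofReal |v (γ.toFun γ.len) - v (γ.toFun 0)| ≤ γ.integral h := by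
  set f : ℝ → ℝ := fun t => v (γ.toFun t) with hf
  have hlip : LocallyLipschitzOn (Icc 0 γ.len) f := by
    intro t ht
    obtain ⟨K, U, hU, hK⟩ := hloc (hγ t ht)
    have hcont := γ.lipschitzOnWith.continuousOn t ht
    have hmaps : Tendsto γ.toFun (𝓝[Icc 0 γ.len] t) (𝓝[Ω] (γ.toFun t)) :=
      tendsto_nhdsWithin_iff.2 ⟨hcont, eventually_nhdsWithin_of_forall hγ⟩
    refine ⟨K * 1, Icc 0 γ.len ∩ γ.toFun ⁻¹' U, inter_mem self_mem_nhdsWithin (hmaps hU), ?_⟩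
    exact hK.comp (γ.lipschitzOnWith.mono inter_subset_left) (fun s hs => hs.2)
  obtain ⟨K, hK⟩ := hlip.exists_lipschitzOnWith_of_compact isCompact_Icc
  -- Local Lipschitz continuity becomes global on the compact parameter interval, so `f` is the
  -- integral of its derivative, and only a pointwise bound for the derivative remains to be shown.
  have hac : AbsolutelyContinuousOnInterval f 0 γ.len :=
    LipschitzOnWith.absolutelyContinuousOnInterval (K := K) (by rwa [uIcc_of_le γ.len_pos.le])
  have hftc := hac.integral_deriv_eq_sub
  change ENNReal.ofReal |f γ.len - f 0| ≤ _
  rw [← hftc, intervalIntegral.integral_of_le γ.len_pos.le, ← Real.norm_eq_abs,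
    ofReal_norm]
  refine (enorm_integral_le_lintegral_enorm _).trans ?_
  rw [← restrict_Ioo_eq_restrict_Ioc]
  refine le_trans ?_ (lintegral_mono_set Ioo_subset_Icc_self)
  refine setLIntegral_mono' measurableSet_Ioo fun t ht => ?_
  have htI := Ioo_subset_Icc_self ht
  rcases eq_or_ne (h (γ.toFun t)) ⊤ with htop | hfin
  · rw [htop]
    exact le_top
  have hct : Tendsto γ.toFun (𝓝 t) (𝓝 (γ.toFun t)) :=
    γ.lipschitzOnWith.continuousOn.continuousAt (Icc_mem_nhds ht.1 ht.2)
  have hle : ‖deriv f t‖ ≤ (h (γ.toFun t)).toReal := by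
    refine norm_deriv_le_of_lip' ENNReal.toReal_nonneg ?_
    filter_upwards [hct.eventually (hv _ (hγ t htI)), Icc_mem_nhds ht.1 ht.2] with s hs hsI
    have h1 : ENNReal.ofReal |f s - f t| ≤
        ENNReal.ofReal ((h (γ.toFun t)).toReal * ‖s - t‖) := by
      refine hs.trans ?_
      rw [ENNReal.ofReal_mul ENNReal.toReal_nonneg, ENNReal.ofReal_toReal hfin]
      gcongr
      have := γ.lipschitzOnWith hsI htI
      rwa [ENNReal.coe_one, one_mul, edist_dist s t, Real.dist_eq] at this
    exact (ENNReal.ofReal_le_ofReal_iff (by positivity)).1 h1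
  rw [← ofReal_norm]
  exact ENNReal.ofReal_le_of_le_toReal hle

end CurveLemmas

/-! ### The dyadic maximal function: weak type `(1,1)` and boundedness on `L²`. -/

section Maximal

/-- A lossy layer cake formula: for finite `c ≤ a` the levels `t ∈ (c/2, c)` alone contribute at
least `(c/2)²`, whence the factor `4`. Letting `c` vary covers `a = ∞`. -/
theorem sq_le_lintegral_of_lt (a : ℝ≥0∞) :
    a ^ 2 ≤ 4 * ∫⁻ t in Ioi (0 : ℝ), if ENNReal.ofReal t < a then ENNReal.ofReal t else 0 := by
  have key : ∀ c : ℝ≥0, (c : ℝ≥0∞) ≤ a → (c : ℝ≥0∞) ^ 2 ≤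
      4 * ∫⁻ t in Ioi (0 : ℝ), if ENNReal.ofReal t < a then ENNReal.ofReal t else 0 := by
    intro c hc
    have h1 : ∫⁻ _ in Ioo ((c : ℝ) / 2) c, ENNReal.ofReal (c / 2) ≤
        ∫⁻ t in Ioi (0 : ℝ), if ENNReal.ofReal t < a then ENNReal.ofReal t else 0 := by
      refine le_trans (setLIntegral_mono' measurableSet_Ioo fun t ht => ?_)
        (lintegral_mono_set fun t ht => (by positivity : (0 : ℝ) ≤ c / 2).trans_lt ht.1)
      have ht0 : 0 < t := (by positivity : (0 : ℝ) ≤ c / 2).trans_lt ht.1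
      have : ENNReal.ofReal t < a := by
        refine lt_of_lt_of_le ?_ hc
        rw [← ENNReal.ofReal_coe_nnreal]
        exact (ENNReal.ofReal_lt_ofReal_iff (ht0.trans ht.2)).2 ht.2
      rw [if_pos this]
      exact ENNReal.ofReal_le_ofReal ht.1.le
    calc (c : ℝ≥0∞) ^ 2 = 4 * ∫⁻ _ in Ioo ((c : ℝ) / 2) c, ENNReal.ofReal (c / 2) := by
          rw [setLIntegral_const, Real.volume_Ioo, ← ENNReal.ofReal_mul (by positivity),
            ← ENNReal.ofReal_coe_nnreal, ← ENNReal.ofReal_pow (by positivity),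
            show (4 : ℝ≥0∞) = ENNReal.ofReal 4 by simp, ← ENNReal.ofReal_mul (by norm_num)]
          congr 1
          ring
      _ ≤ _ := by gcongr
  rcases eq_or_ne a ⊤ with rfl | ha
  · refine le_of_le_of_eq le_top (ENNReal.eq_top_of_forall_nnreal_le fun r => ?_).symm
    refine le_trans ?_ (key (max r 1) le_top)
    rw [← ENNReal.coe_pow, ENNReal.coe_le_coe]
    calc r ≤ max r 1 := le_max_left _ _
      _ ≤ max r 1 ^ 2 := le_self_pow₀ (le_max_right _ _) two_ne_zero
  · simpa [ENNReal.coe_toNNReal ha] using key a.toNNReal (by rw [ENNReal.coe_toNNReal ha])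

theorem lintegral_indicator_ofReal_lt (a : ℝ≥0∞) :
    ∫⁻ t in Ioi (0 : ℝ), (if ENNReal.ofReal (t / 2) < a then 1 else 0 : ℝ≥0∞) ≤ 2 * a := by
  rcases eq_or_ne a ⊤ with rfl | ha
  · simp
  · calc _ ≤ ∫⁻ t, (Ioo 0 (2 * a.toReal)).indicator (fun _ => (1 : ℝ≥0∞)) t := by
          rw [← lintegral_indicator measurableSet_Ioi]
          refine lintegral_mono fun t => ?_
          by_cases ht : 0 < t
          · rw [indicator_of_mem (mem_Ioi.2 ht)]
            split_ifs with h
            · rw [indicator_of_mem]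
              refine ⟨ht, ?_⟩
              rw [ENNReal.ofReal_lt_iff_lt_toReal (by positivity) ha] at h
              linarith
            · exact zero_le
          · rw [indicator_of_notMem (by simpa using ht)]
            exact zero_le
      _ = 2 * a := by
          rw [lintegral_indicator measurableSet_Ioo, setLIntegral_one, Real.volume_Ioo, sub_zero,
            ENNReal.ofReal_mul (by norm_num), ENNReal.ofReal_toReal ha]
          simp

variable {X : Type*} [MetricSpace X] [MeasurableSpace X] {μ : Measure X}

/-- A countable version of the Vitali covering theorem. -/
theorem IsDoubling.exists_countable_disjoint_balls [OpensMeasurableSpace X] (hμ : IsDoubling μ)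
    (S : Set X) (r : X → ℝ) (R : ℝ) (hr : ∀ x ∈ S, 0 < r x) (hR : ∀ x ∈ S, r x ≤ R) :
    ∃ u ⊆ S, u.Countable ∧ (u.PairwiseDisjoint fun a => Metric.ball a (r a)) ∧
      ∀ x ∈ S, ∃ b ∈ u, Metric.ball x (r x) ⊆ Metric.ball b (5 * r b) := by
  have := hμ.sigmaFinite
  obtain ⟨u, huS, hd, hu⟩ := Vitali.exists_disjoint_subfamily_covering_enlargement_ball
    S id r R hR 5 (by norm_num)
  refine ⟨u, huS, ?_, hd, hu⟩
  have := Measure.countable_meas_pos_of_disjoint_iUnion (μ := μ)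
    (As := fun a : u => Metric.ball (a : X) (r a)) (fun _ => measurableSet_ball)
    (fun a b hab => hd a.2 b.2 (fun e => hab (Subtype.ext e)))
  have h2 : {i : u | 0 < μ (Metric.ball (i : X) (r i))} = univ :=
    eq_univ_of_forall fun i => hμ.measure_ball_pos _ (hr _ (huS i.2))
  rwa [h2, countable_univ_iff] at this

/-- The centred maximal function over balls of dyadic radii. -/
noncomputable def dyadicMaximal (μ : Measure X) (f : X → ℝ≥0∞) (x : X) : ℝ≥0∞ :=
  ⨆ k : ℤ, (∫⁻ w in Metric.ball x ((2 : ℝ) ^ k), f w ∂μ) / μ (Metric.ball x ((2 : ℝ) ^ k))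

theorem measurable_lintegral_ball [OpensMeasurableSpace X] [SecondCountableTopology X] [SFinite μ]
    {f : X → X → ℝ≥0∞} (hf : Measurable (Function.uncurry f)) {r : X → ℝ} (hr : Continuous r) :
    Measurable fun x => ∫⁻ w in Metric.ball x (r x), f x w ∂μ := by
  have hS : MeasurableSet {p : X × X | dist p.2 p.1 < r p.1} :=
    (isOpen_lt (by fun_prop) (by fun_prop)).measurableSet
  have := (hf.indicator hS).lintegral_prod_right' (ν := μ)
  convert this using 2 with x
  rw [← lintegral_indicator measurableSet_ball]
  rfl

theorem measurable_measure_ball [OpensMeasurableSpace X] [SecondCountableTopology X] [SFinite μ]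
    {r : X → ℝ} (hr : Continuous r) : Measurable fun x => μ (Metric.ball x (r x)) := by
  simpa using measurable_lintegral_ball (μ := μ) (f := fun _ _ => 1) measurable_const hr

theorem measurable_dyadicMaximal [OpensMeasurableSpace X] [SecondCountableTopology X] [SFinite μ]
    {f : X → ℝ≥0∞} (hf : Measurable f) : Measurable (dyadicMaximal μ f) :=
  Measurable.iSup fun _ => (measurable_lintegral_ball (f := fun _ w => f w)
    (hf.comp measurable_snd) continuous_const).div (measurable_measure_ball continuous_const)

/-- The weak type `(1,1)` estimate for the maximal function. -/
theorem IsDoubling.exists_weak_type [OpensMeasurableSpace X] (hμ : IsDoubling μ) :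
    ∃ D : ℝ≥0, ∀ (f : X → ℝ≥0∞) (t : ℝ≥0∞),
      t * μ {x | t < dyadicMaximal μ f x} ≤ D * ∫⁻ x, f x ∂μ := by
  obtain ⟨D, -, hD⟩ := hμ.exists_measure_ball_le 5
  refine ⟨D, fun f t => ?_⟩
  -- The Vitali covering theorem needs bounded radii, so the level set is exhausted by the sets on
  -- which a radius at most `2 ^ N` already witnesses the inequality.
  set S : ℕ → Set X := fun N => {x | ∃ k : ℤ, k ≤ N ∧
    t * μ (Metric.ball x ((2 : ℝ) ^ k)) < ∫⁻ w in Metric.ball x ((2 : ℝ) ^ k), f w ∂μ} with hS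
  have hU : {x | t < dyadicMaximal μ f x} = ⋃ N, S N := by
    ext x
    simp only [mem_ofPred_eq, dyadicMaximal, lt_iSup_iff, hS, mem_iUnion]
    have e : ∀ k : ℤ, t < (∫⁻ w in Metric.ball x ((2 : ℝ) ^ k), f w ∂μ) /
        μ (Metric.ball x ((2 : ℝ) ^ k)) ↔
        t * μ (Metric.ball x ((2 : ℝ) ^ k)) < ∫⁻ w in Metric.ball x ((2 : ℝ) ^ k), f w ∂μ :=
      fun k => ENNReal.lt_div_iff_mul_lt (.inl (hμ.measure_ball_pos x (by positivity)).ne')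
        (.inl (hμ.measure_ball_lt_top x _).ne)
    constructor
    · rintro ⟨k, hk⟩
      exact ⟨k.toNat, k, Int.self_le_toNat k, (e k).1 hk⟩
    · rintro ⟨_, k, -, hk⟩
      exact ⟨k, (e k).2 hk⟩
  have hmono : Monotone S := by
    rintro m n hmn x ⟨k, hk, h⟩
    exact ⟨k, hk.trans (by exact_mod_cast hmn), h⟩
  rw [hU, hmono.measure_iUnion, ENNReal.mul_iSup]
  refine iSup_le fun N => ?_
  have hch : ∀ x : X, ∃ k : ℤ, x ∈ S N → k ≤ N ∧
      t * μ (Metric.ball x ((2 : ℝ) ^ k)) < ∫⁻ w in Metric.ball x ((2 : ℝ) ^ k), f w ∂μ := by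
    intro x
    by_cases hx : x ∈ S N
    · obtain ⟨k, hk⟩ := hx
      exact ⟨k, fun _ => hk⟩
    · exact ⟨0, fun h => absurd h hx⟩
  choose k hk using hch
  obtain ⟨u, huS, hc, hd, hu⟩ := hμ.exists_countable_disjoint_balls (S N)
    (fun x => (2 : ℝ) ^ k x) ((2 : ℝ) ^ (N : ℤ)) (fun x _ => by positivity)
    (fun x hx => zpow_le_zpow_right₀ one_le_two (hk x hx).1)
  have hcov : S N ⊆ ⋃ b ∈ u, Metric.ball b (5 * (2 : ℝ) ^ k b) := by
    intro x hx
    obtain ⟨b, hb, hsub⟩ := hu x hx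
    exact mem_biUnion hb (hsub (Metric.mem_ball_self (by positivity)))
  have := hc.to_subtype
  calc t * μ (S N) ≤ t * ∑' b : u, μ (Metric.ball (b : X) (5 * (2 : ℝ) ^ k b)) := by
        gcongr
        exact (measure_mono hcov).trans (measure_biUnion_le μ hc _)
    _ ≤ t * ∑' b : u, D * μ (Metric.ball (b : X) ((2 : ℝ) ^ k b)) := by
        gcongr with b
        exact hD _ _ _ _ (by positivity) (by simp)
    _ = D * ∑' b : u, t * μ (Metric.ball (b : X) ((2 : ℝ) ^ k b)) := by
        rw [ENNReal.tsum_mul_left, ENNReal.tsum_mul_left, mul_left_comm]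
    _ ≤ D * ∑' b : u, ∫⁻ w in Metric.ball (b : X) ((2 : ℝ) ^ k b), f w ∂μ := by
        gcongr with b
        exact (hk _ (huS b.2)).2.le
    _ = D * ∫⁻ w in ⋃ b ∈ u, Metric.ball b ((2 : ℝ) ^ k b), f w ∂μ := by
        rw [lintegral_biUnion hc (fun _ _ => measurableSet_ball) hd]
    _ ≤ D * ∫⁻ w, f w ∂μ := by
        gcongr
        exact Measure.restrict_le_self

/-- A constant summand contributes exactly itself to each average. This is what makes the truncation
in the `L²` estimate work. -/
theorem IsDoubling.dyadicMaximal_le (hμ : IsDoubling μ) {f g : X → ℝ≥0∞} (hg : Measurable g)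
    {c : ℝ≥0∞} (h : ∀ x, f x ≤ g x + c) (x : X) :
    dyadicMaximal μ f x ≤ dyadicMaximal μ g x + c := by
  refine iSup_le fun k => ?_
  have h1 := (hμ.measure_ball_pos x (r := (2 : ℝ) ^ k) (by positivity)).ne'
  have h2 := (hμ.measure_ball_lt_top x ((2 : ℝ) ^ k)).ne
  calc _ ≤ (∫⁻ w in Metric.ball x ((2 : ℝ) ^ k), (g w + c) ∂μ) /
        μ (Metric.ball x ((2 : ℝ) ^ k)) := by
        gcongr with w
        exact h w
    _ = (∫⁻ w in Metric.ball x ((2 : ℝ) ^ k), g w ∂μ) / μ (Metric.ball x ((2 : ℝ) ^ k)) + c := by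
        rw [lintegral_add_left hg, setLIntegral_const, ENNReal.add_div,
          ENNReal.mul_div_cancel_right h1 h2]
    _ ≤ _ := by
        gcongr
        exact le_iSup (fun k : ℤ => (∫⁻ w in Metric.ball x ((2 : ℝ) ^ k), g w ∂μ) /
          μ (Metric.ball x ((2 : ℝ) ^ k))) k

/-- The maximal function is bounded in `L²`. -/
theorem IsDoubling.exists_lintegral_dyadicMaximal_sq_le [BorelSpace X] (hμ : IsDoubling μ) :
    ∃ D : ℝ≥0, ∀ f : X → ℝ≥0∞, Measurable f →
      ∫⁻ x, dyadicMaximal μ f x ^ 2 ∂μ ≤ D * ∫⁻ x, f x ^ 2 ∂μ := by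
  have := hμ.sigmaFinite
  have := hμ.secondCountableTopology
  obtain ⟨D, hD⟩ := hμ.exists_weak_type
  refine ⟨4 * (2 * D * 2), fun f hf => ?_⟩
  set M := dyadicMaximal μ f with hM
  have hMm : Measurable M := measurable_dyadicMaximal hf
  have hlevel : ∀ t : ℝ, 0 < t → ENNReal.ofReal t * μ {x | ENNReal.ofReal t < M x} ≤
      2 * D * ∫⁻ x, f x * (if ENNReal.ofReal (t / 2) < f x then 1 else 0) ∂μ := by
    intro t ht
    -- Marcinkiewicz truncation: the part of `f` below `t / 2` raises the maximal function by at
    -- most `t / 2`, so the weak type bound at level `t` only sees the values of `f` above `t / 2`.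
    set ft : X → ℝ≥0∞ := fun x => f x * (if ENNReal.ofReal (t / 2) < f x then 1 else 0) with hft
    have hftm : Measurable ft :=
      hf.mul (Measurable.ite (measurableSet_lt measurable_const hf) measurable_const
        measurable_const)
    have h1 : ∀ x, f x ≤ ft x + ENNReal.ofReal (t / 2) := by
      intro x
      by_cases hx : ENNReal.ofReal (t / 2) < f x
      · simp [hft, hx]
      · exact (not_lt.1 hx).trans le_add_self
    have h2 : {x | ENNReal.ofReal t < M x} ⊆
        {x | ENNReal.ofReal (t / 2) < dyadicMaximal μ ft x} := by
      intro x hx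
      have h3 := lt_of_lt_of_le hx (hμ.dyadicMaximal_le hftm h1 x)
      have h4 : ENNReal.ofReal t = ENNReal.ofReal (t / 2) + ENNReal.ofReal (t / 2) := by
        rw [← ENNReal.ofReal_add (by positivity) (by positivity), add_halves]
      rw [h4] at h3
      exact lt_of_add_lt_add_right h3
    calc _ ≤ 2 * (ENNReal.ofReal (t / 2) *
          μ {x | ENNReal.ofReal (t / 2) < dyadicMaximal μ ft x}) := by
          rw [← mul_assoc]
          gcongr
          rw [show (2 : ℝ≥0∞) = ENNReal.ofReal 2 by simp, ← ENNReal.ofReal_mul (by norm_num)]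
          apply ENNReal.ofReal_le_ofReal
          linarith
      _ ≤ 2 * (D * ∫⁻ x, ft x ∂μ) := by
          exact mul_le_mul_right (hD ft _) 2
      _ = _ := by rw [mul_assoc]
  have hm1 : Measurable (Function.uncurry fun (x : X) (t : ℝ) =>
      (if ENNReal.ofReal t < M x then ENNReal.ofReal t else 0 : ℝ≥0∞)) :=
    Measurable.ite (measurableSet_lt (by fun_prop) (by fun_prop)) (by fun_prop) measurable_const
  have hm2 : Measurable (Function.uncurry fun (x : X) (t : ℝ) =>
      f x * (if ENNReal.ofReal (t / 2) < f x then 1 else 0 : ℝ≥0∞)) :=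
    (hf.comp measurable_fst).mul (Measurable.ite (measurableSet_lt (by fun_prop) (by fun_prop))
      measurable_const measurable_const)
  calc ∫⁻ x, M x ^ 2 ∂μ ≤ ∫⁻ x, (4 * ∫⁻ t in Ioi (0 : ℝ),
        (if ENNReal.ofReal t < M x then ENNReal.ofReal t else 0 : ℝ≥0∞)) ∂μ :=
        lintegral_mono fun x => sq_le_lintegral_of_lt (M x)
    _ = 4 * ∫⁻ t in Ioi (0 : ℝ), ∫⁻ x,
        (if ENNReal.ofReal t < M x then ENNReal.ofReal t else 0 : ℝ≥0∞) ∂μ := by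
        rw [lintegral_const_mul' _ _ (by simp), lintegral_lintegral_swap hm1.aemeasurable]
    _ ≤ 4 * ∫⁻ t in Ioi (0 : ℝ), 2 * D *
        ∫⁻ x, f x * (if ENNReal.ofReal (t / 2) < f x then 1 else 0) ∂μ := by
        gcongr 4 * ?_
        refine setLIntegral_mono' measurableSet_Ioi fun t ht => le_trans (le_of_eq ?_) (hlevel t ht)
        rw [← setLIntegral_const, ← lintegral_indicator (measurableSet_lt measurable_const hMm)]
        refine lintegral_congr fun x => ?_
        simp [indicator_apply]
    _ = 4 * (2 * D * ∫⁻ x, (∫⁻ t in Ioi (0 : ℝ),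
        f x * (if ENNReal.ofReal (t / 2) < f x then 1 else 0)) ∂μ) := by
        rw [lintegral_const_mul' _ _ (by finiteness), lintegral_lintegral_swap hm2.aemeasurable]
    _ ≤ 4 * (2 * D * ∫⁻ x, f x * (2 * f x) ∂μ) := by
        gcongr with x
        rw [lintegral_const_mul _ (Measurable.ite
          (measurableSet_lt (by fun_prop) measurable_const) measurable_const measurable_const)]
        gcongr
        exact lintegral_indicator_ofReal_lt (f x)
    _ = _ := by
        have : ∀ x, f x * (2 * f x) = 2 * f x ^ 2 := fun x => by ring
        simp_rw [this]
        rw [lintegral_const_mul' _ _ (by simp)]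
        push_cast
        ring

end Maximal

/-! ### Averaging at a variable scale. -/

section Mollifier

theorem abs_integral_mul_le_of_support_subset {X : Type*} [MeasurableSpace X] {μ : Measure X}
    {B : Set X} {φ f : X → ℝ} {M : ℝ} (hφ : ∀ w, |φ w| ≤ M)
    (hφ0 : ∀ w, w ∉ B → φ w = 0) (hf : IntegrableOn f B μ) :
    |∫ w, φ w * f w ∂μ| ≤ M * ∫ w in B, |f w| ∂μ := by
  rw [← setIntegral_eq_integral_of_forall_compl_eq_zero (s := B)
    (fun w hw => by rw [hφ0 w hw, zero_mul]), ← integral_const_mul, ← Real.norm_eq_abs]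
  refine norm_integral_le_of_norm_le (hf.abs.const_mul M) (Eventually.of_forall fun w => ?_)
  rw [Real.norm_eq_abs, abs_mul]
  exact mul_le_mul_of_nonneg_right (hφ w) (abs_nonneg _)

variable {X : Type*} [MetricSpace X] {ρ : X → ℝ}

/-- A Lipschitz bump at `z` of radius `ρ z`. -/
noncomputable def bump (ρ : X → ℝ) (z w : X) : ℝ := max 0 (ρ z - dist z w)

theorem bump_nonneg (ρ : X → ℝ) (z w : X) : 0 ≤ bump ρ z w := le_max_left _ _

theorem abs_bump_le {z : X} (hz : 0 ≤ ρ z) (w : X) : |bump ρ z w| ≤ ρ z := by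
  rw [abs_of_nonneg (bump_nonneg ρ z w)]
  exact max_le hz (by linarith [dist_nonneg (x := z) (y := w)])

theorem bump_eq_zero {z w : X} (h : w ∉ Metric.ball z (ρ z)) : bump ρ z w = 0 := by
  rw [Metric.mem_ball, not_lt, dist_comm] at h
  exact max_eq_left (by linarith)

theorem abs_bump_sub_bump_le (hρ : ∀ z z', |ρ z - ρ z'| ≤ dist z z' / 4) (z z' w : X) :
    |bump ρ z w - bump ρ z' w| ≤ 2 * dist z z' := by
  have h1 : |bump ρ z w - bump ρ z' w| ≤ |(ρ z - dist z w) - (ρ z' - dist z' w)| := by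
    simpa [bump] using abs_max_sub_max_le_max 0 (ρ z - dist z w) 0 (ρ z' - dist z' w)
  have h2 : |(ρ z - dist z w) - (ρ z' - dist z' w)| ≤ |ρ z - ρ z'| + |dist z w - dist z' w| := by
    rw [show (ρ z - dist z w) - (ρ z' - dist z' w) = (ρ z - ρ z') - (dist z w - dist z' w) by ring]
    exact abs_sub _ _
  linarith [hρ z z', abs_dist_sub_le z z' w, dist_nonneg (x := z) (y := z')]

variable [MeasurableSpace X] {μ : Measure X}

/-- The average of `u` around `z` at the variable scale `ρ z`. -/
noncomputable def mollify (μ : Measure X) (ρ : X → ℝ) (u : X → ℝ) (z : X) : ℝ :=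
  (∫ w, bump ρ z w * u w ∂μ) / ∫ w, bump ρ z w ∂μ

theorem IsDoubling.integrableOn_ball_sub (hμ : IsDoubling μ) {u : X → ℝ} (hu : Integrable u μ)
    (c : ℝ) (z : X) (r : ℝ) : IntegrableOn (fun w => u w - c) (Metric.ball z r) μ :=
  hu.integrableOn.sub (integrableOn_const (hμ.measure_ball_lt_top z r).ne)

variable [OpensMeasurableSpace X]

theorem aestronglyMeasurable_bump (z : X) : AEStronglyMeasurable (bump ρ z) μ :=
  (Continuous.aestronglyMeasurable (by unfold bump; fun_prop))

theorem integrable_bump_mul {z : X} (hz : 0 ≤ ρ z) {u : X → ℝ} (hu : Integrable u μ) :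
    Integrable (fun w => bump ρ z w * u w) μ :=
  hu.bdd_mul (aestronglyMeasurable_bump z) (Eventually.of_forall fun w => abs_bump_le hz w)

theorem IsDoubling.integrable_bump (hμ : IsDoubling μ) {z : X} (hz : 0 ≤ ρ z) :
    Integrable (bump ρ z) μ := by
  rw [← integrableOn_iff_integrable_of_support_subset (s := Metric.ball z (ρ z))
    (fun w hw => by_contra fun h => hw (bump_eq_zero h))]
  exact Measure.integrableOn_of_bounded (hμ.measure_ball_lt_top z _).ne
    (aestronglyMeasurable_bump z) (Eventually.of_forall fun w => abs_bump_le hz w)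

theorem IsDoubling.mul_le_integral_bump (hμ : IsDoubling μ) {z : X} (hz : 0 ≤ ρ z) :
    ρ z / 2 * μ.real (Metric.ball z (ρ z / 2)) ≤ ∫ w, bump ρ z w ∂μ := by
  calc ρ z / 2 * μ.real (Metric.ball z (ρ z / 2))
      = ∫ _ in Metric.ball z (ρ z / 2), ρ z / 2 ∂μ := by
        rw [setIntegral_const, smul_eq_mul, mul_comm]
    _ ≤ ∫ w in Metric.ball z (ρ z / 2), bump ρ z w ∂μ := by
        refine setIntegral_mono_on (integrableOn_const (hμ.measure_ball_lt_top z _).ne)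
          (hμ.integrable_bump hz).integrableOn measurableSet_ball fun w hw => ?_
        rw [Metric.mem_ball, dist_comm] at hw
        exact le_max_of_le_right (by linarith)
    _ ≤ _ := setIntegral_le_integral (hμ.integrable_bump hz)
        (Eventually.of_forall fun w => bump_nonneg ρ z w)

/-- The oscillation of `u` controls the distance of its mollification to constants and the local
Lipschitz constant of the mollification. -/
theorem IsDoubling.exists_abs_mollify_sub_le (hμ : IsDoubling μ) :
    ∃ D : ℝ, 0 ≤ D ∧ ∀ (ρ : X → ℝ), (∀ z z', |ρ z - ρ z'| ≤ dist z z' / 4) →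
      ∀ u : X → ℝ, Integrable u μ → ∀ (z : X) (c : ℝ), 0 < ρ z →
      |mollify μ ρ u z - c| ≤ D * ((∫ w in Metric.ball z (2 * ρ z), |u w - c| ∂μ) /
        μ.real (Metric.ball z (2 * ρ z))) ∧
      ∀ z', dist z z' < ρ z / 2 → |mollify μ ρ u z - mollify μ ρ u z'| ≤
        D * (dist z z' / ρ z * ((∫ w in Metric.ball z (2 * ρ z), |u w - c| ∂μ) /
        μ.real (Metric.ball z (2 * ρ z)))) := by
  -- The factor `8` compares `B(z, 2ρ(z))` with `B(x, ρ(x)/2)`, on which the bump at `x` is at least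
  -- `ρ(x)/2`; this bounds the normalizing integral `I x` from below in `hIlow`.
  obtain ⟨D, hD1, hD⟩ := hμ.exists_measure_ball_le 8
  have hD1' : (1 : ℝ) ≤ D := hD1
  refine ⟨4 * D + 8 * D ^ 2, by positivity, fun ρ hρ u hu z c hz => ?_⟩
  set A := ∫ w in Metric.ball z (2 * ρ z), |u w - c| ∂μ with hA
  set m := μ.real (Metric.ball z (2 * ρ z)) with hm
  have hA0 : 0 ≤ A := integral_nonneg fun w => abs_nonneg _
  have hm0 : 0 < m := ENNReal.toReal_pos (hμ.measure_ball_pos z (by positivity)).ne'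
    (hμ.measure_ball_lt_top z _).ne
  set J : X → ℝ := fun x => ∫ w, bump ρ x w * (u w - c) ∂μ with hJ
  set I : X → ℝ := fun x => ∫ w, bump ρ x w ∂μ with hI
  have hint : ∀ x, 0 ≤ ρ x → Integrable (fun w => bump ρ x w * (u w - c)) μ := by
    intro x hx
    simp_rw [mul_sub]
    exact (integrable_bump_mul hx hu).sub ((hμ.integrable_bump hx).mul_const c)
  have hIlow : ∀ x, 0 < ρ x → dist x z + 2 * ρ z ≤ 4 * ρ x → ρ x * m ≤ 2 * D * I x := by
    intro x hx h
    have h1 := hμ.mul_le_integral_bump hx.le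
    have h2 : m ≤ D * μ.real (Metric.ball x (ρ x / 2)) := by
      have h3 := hD x z (ρ x / 2) (2 * ρ z) (by positivity) (by linarith)
      have h4 := ENNReal.toReal_mono (ENNReal.mul_ne_top ENNReal.coe_ne_top
        (hμ.measure_ball_lt_top x _).ne) h3
      rwa [ENNReal.toReal_mul, ENNReal.coe_toReal] at h4
    calc ρ x * m ≤ ρ x * (D * μ.real (Metric.ball x (ρ x / 2))) := by gcongr
      _ = 2 * D * (ρ x / 2 * μ.real (Metric.ball x (ρ x / 2))) := by ring
      _ ≤ 2 * D * I x := by gcongr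
  have hIz := hIlow z hz (by simp; linarith)
  have hIz0 : 0 < I z := by
    have : 0 < 2 * D * I z := lt_of_lt_of_le (by positivity) hIz
    exact pos_of_mul_pos_right this (by positivity)
  have hv : ∀ x, 0 < ρ x → 0 < I x → mollify μ ρ u x - c = J x / I x := by
    intro x hx hx0
    have : J x = (∫ w, bump ρ x w * u w ∂μ) - c * I x := by
      simp only [hJ, mul_sub]
      rw [integral_sub (integrable_bump_mul hx.le hu) ((hμ.integrable_bump hx.le).mul_const c),
        integral_mul_const, mul_comm]
    rw [this, mollify, sub_div, mul_div_cancel_right₀ _ hx0.ne']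
  have hrange : ∀ x, ρ x ≤ 2 * ρ z - dist x z → 0 ≤ ρ x → |J x| ≤ ρ x * A := by
    intro x hx hx0
    refine abs_integral_mul_le_of_support_subset (abs_bump_le hx0) (fun w hw => bump_eq_zero ?_)
      (hμ.integrableOn_ball_sub hu c z _)
    exact fun h => hw (Metric.ball_subset_ball' (by linarith) h)
  constructor
  · rw [hv z hz hIz0, abs_div, abs_of_pos hIz0, div_le_iff₀ hIz0]
    refine (hrange z (by simp; linarith) hz.le).trans ?_
    calc ρ z * A = (ρ z * m) * (A / m) := by field_simp
      _ ≤ (2 * D * I z) * (A / m) := by gcongr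
      _ ≤ (4 * D + 8 * D ^ 2) * (A / m) * I z := by
        have : 0 ≤ (2 * D + 8 * D ^ 2) * ((A / m) * I z) := by positivity
        linarith
  · intro z' hz'
    have hd : dist z' z = dist z z' := dist_comm _ _
    have h1 := abs_le.1 (hρ z z')
    have hz'0 : 0 < ρ z' := by linarith
    have hIz' := hIlow z' hz'0 (by rw [hd]; linarith)
    have hIz'0 : 0 < I z' := by
      have : 0 < 2 * D * I z' := lt_of_lt_of_le (by positivity) hIz'
      exact pos_of_mul_pos_right this (by positivity)
    have hoff : ∀ w, w ∉ Metric.ball z (2 * ρ z) → bump ρ z w - bump ρ z' w = 0 := by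
      intro w hw
      rw [bump_eq_zero (fun h => hw (Metric.ball_subset_ball (by linarith) h)),
        bump_eq_zero (fun h => hw (Metric.ball_subset_ball' (by rw [hd]; linarith) h)), sub_zero]
    have hJd : |J z - J z'| ≤ 2 * dist z z' * A := by
      simp only [hJ]
      rw [← integral_sub (hint z hz.le) (hint z' hz'0.le)]
      simp_rw [← sub_mul]
      exact abs_integral_mul_le_of_support_subset (abs_bump_sub_bump_le hρ z z') hoff
        (hμ.integrableOn_ball_sub hu c z _)
    have hId : |I z' - I z| ≤ 2 * dist z z' * m := by
      rw [abs_sub_comm]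
      simp only [hI]
      rw [← integral_sub (hμ.integrable_bump hz.le) (hμ.integrable_bump hz'0.le)]
      have := abs_integral_mul_le_of_support_subset (abs_bump_sub_bump_le hρ z z') hoff
        (integrableOn_const (C := (1 : ℝ)) (hμ.measure_ball_lt_top z _).ne)
      simpa using this
    have hJz' := hrange z' (by rw [hd]; linarith) hz'0.le
    -- Subtracting `c` first makes both terms small: the numerators and the normalizations each
    -- change by a multiple of `dist z z'`. The two terms account for the `4 * D` and the `8 * D ^
    -- 2` in the constant.
    have e : mollify μ ρ u z - mollify μ ρ u z' =
        (J z - J z') / I z + J z' * (I z' - I z) / (I z * I z') := by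
      rw [show mollify μ ρ u z - mollify μ ρ u z' =
        (mollify μ ρ u z - c) - (mollify μ ρ u z' - c) by ring, hv z hz hIz0, hv z' hz'0 hIz'0]
      field_simp
      ring
    have b1 : |(J z - J z') / I z| ≤ 4 * D * (dist z z' / ρ z * (A / m)) := by
      rw [abs_div, abs_of_pos hIz0, div_le_iff₀ hIz0]
      calc _ ≤ 2 * dist z z' * A := hJd
        _ = 2 * (dist z z' / ρ z * (A / m)) * (ρ z * m) := by field_simp
        _ ≤ 2 * (dist z z' / ρ z * (A / m)) * (2 * D * I z) := by gcongr
        _ = _ := by ring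
    have b2 : |J z' * (I z' - I z) / (I z * I z')| ≤ 8 * D ^ 2 * (dist z z' / ρ z * (A / m)) := by
      rw [abs_div, abs_of_pos (mul_pos hIz0 hIz'0), div_le_iff₀ (mul_pos hIz0 hIz'0), abs_mul]
      calc _ ≤ (ρ z' * A) * (2 * dist z z' * m) := by gcongr
        _ = 2 * (dist z z' / ρ z * (A / m)) * ((ρ z * m) * (ρ z' * m)) := by field_simp
        _ ≤ 2 * (dist z z' / ρ z * (A / m)) * ((2 * D * I z) * (2 * D * I z')) := by gcongr
        _ = _ := by ring
    rw [e, add_mul]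
    exact (abs_add_le _ _).trans (add_le_add b1 b2)

end Mollifier

/-! ### Averages at the scale of the distance to the complement. -/

section BoundaryDistance

variable {X : Type*} [MetricSpace X] {Ω : Set X}

/-- The distance to the complement of `Ω`. -/
noncomputable def bdist (Ω : Set X) (z : X) : ℝ := Metric.infDist z Ωᶜ

theorem continuous_bdist : Continuous (bdist Ω) := Metric.continuous_infDist_pt _

theorem abs_bdist_sub_le (z w : X) : |bdist Ω z - bdist Ω w| ≤ dist z w := by
  simpa [bdist, Real.dist_eq] using (Metric.lipschitz_infDist_pt Ωᶜ).dist_le_mul z w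

theorem bdist_le_add (z w : X) : bdist Ω z ≤ bdist Ω w + dist z w := by
  linarith [(abs_le.1 (abs_bdist_sub_le (Ω := Ω) z w)).2]

theorem bdist_le_dist {x : X} (hx : x ∉ Ω) (z : X) : bdist Ω z ≤ dist z x :=
  Metric.infDist_le_dist_of_mem hx

theorem bdist_pos (hΩ : IsOpen Ω) (hne : Ωᶜ.Nonempty) {z : X} (hz : z ∈ Ω) : 0 < bdist Ω z :=
  (hΩ.isClosed_compl.notMem_iff_infDist_pos hne).1 (fun h => h hz)

theorem mem_of_dist_lt_bdist {z w : X} (h : dist z w < bdist Ω z) : w ∈ Ω := by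
  by_contra hw
  exact absurd (bdist_le_dist hw z) (not_le.2 h)

variable [MeasurableSpace X] {μ : Measure X}

/-- The average of `g` over the ball at `z` whose radius is `a` times the distance to the
complement of `Ω`. -/
noncomputable def scaledAvg (μ : Measure X) (Ω : Set X) (a : ℝ) (g : X → ℝ≥0∞) (z : X) : ℝ≥0∞ :=
  (∫⁻ w in Metric.ball z (a * bdist Ω z), g w ∂μ) / μ (Metric.ball z (a * bdist Ω z))

theorem measurable_scaledAvg [OpensMeasurableSpace X] [SecondCountableTopology X] [SFinite μ]
    (a : ℝ) {g : X → ℝ≥0∞} (hg : Measurable g) : Measurable (scaledAvg μ Ω a g) :=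
  (measurable_lintegral_ball (f := fun _ w => g w) (hg.comp measurable_snd)
    (continuous_bdist.const_mul a)).div (measurable_measure_ball (continuous_bdist.const_mul a))

/-- Averages of `g` over comparable balls inside `Ω` are comparable. -/
theorem IsDoubling.exists_lintegral_div_le (hμ : IsDoubling μ) (K : ℝ) :
    ∃ D : ℝ≥0, ∀ (g : X → ℝ≥0∞) (z w : X) (r R : ℝ), 0 < r → 0 < R → dist z w + r ≤ R →
      dist z w + R ≤ K * r → (∫⁻ x in Metric.ball z r, g x ∂μ) / μ (Metric.ball z r) ≤
        D * ((∫⁻ x in Metric.ball w R, g x ∂μ) / μ (Metric.ball w R)) := by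
  obtain ⟨D, hD1, hD⟩ := hμ.exists_measure_ball_le K
  refine ⟨D, fun g z w r R hr hR h1 h2 => ?_⟩
  have hsub : Metric.ball z r ⊆ Metric.ball w R := Metric.ball_subset_ball' (by linarith)
  have hm := hD z w r R hr h2
  have p1 := (hμ.measure_ball_pos z hr).ne'
  have p2 := (hμ.measure_ball_lt_top z r).ne
  have q1 := (hμ.measure_ball_pos w hR).ne'
  have q2 := (hμ.measure_ball_lt_top w R).ne
  rw [ENNReal.div_le_iff p1 p2]
  calc _ ≤ ∫⁻ x in Metric.ball w R, g x ∂μ := lintegral_mono_set hsub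
    _ = ((∫⁻ x in Metric.ball w R, g x ∂μ) / μ (Metric.ball w R)) * μ (Metric.ball w R) :=
      (ENNReal.div_mul_cancel q1 q2).symm
    _ ≤ ((∫⁻ x in Metric.ball w R, g x ∂μ) / μ (Metric.ball w R)) *
        (D * μ (Metric.ball z r)) := by gcongr
    _ = _ := by ring

/-- Tonelli's theorem for averages over balls at the scale of the distance to the complement. -/
theorem IsDoubling.exists_lintegral_swap_le [OpensMeasurableSpace X] [SecondCountableTopology X]
    (hμ : IsDoubling μ) (hΩ : IsOpen Ω) (hne : Ωᶜ.Nonempty) {a : ℝ} (ha0 : 0 < a)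
    (ha : a ≤ 1 / 2) :
    ∃ D : ℝ≥0, ∀ (f : X → X → ℝ≥0∞), Measurable (Function.uncurry f) → ∀ A ⊆ Ω, ∀ A' : Set X,
      MeasurableSet A → MeasurableSet A' → (∀ z ∈ A, Metric.ball z (a * bdist Ω z) ⊆ A') →
      ∫⁻ z in A, (∫⁻ w in Metric.ball z (a * bdist Ω z), f z w ∂μ) /
          μ (Metric.ball z (a * bdist Ω z)) ∂μ ≤
        D * ∫⁻ w in A', (∫⁻ z in Metric.ball w (2 * a * bdist Ω w), f z w ∂μ) /
          μ (Metric.ball w (2 * a * bdist Ω w)) ∂μ := by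
  have := hμ.sigmaFinite
  -- Since `a ≤ 1/2`, a point `w` of `B(z, a d(z))`, where `d` is `bdist Ω`, satisfies `d(z)/2 ≤
  -- d(w) ≤ 3d(z)/2`. So `z` lies in `B(w, 2a d(w))`, and this ball is contained in `B(z, 4a d(z))`.
  obtain ⟨D, hD1, hD⟩ := hμ.exists_measure_ball_le 4
  refine ⟨D, fun f hf A hA A' hAm hA'm hAA' => ?_⟩
  have hD0 : (D : ℝ≥0∞) ≠ 0 := by
    have := zero_lt_one.trans_le hD1
    exact_mod_cast this.ne'
  set m1 : X → ℝ≥0∞ := fun z => μ (Metric.ball z (a * bdist Ω z)) with hm1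
  set m2 : X → ℝ≥0∞ := fun w => μ (Metric.ball w (2 * a * bdist Ω w)) with hm2
  have hm1m : Measurable m1 := measurable_measure_ball (continuous_bdist.const_mul a)
  have hm2m : Measurable m2 := measurable_measure_ball (continuous_bdist.const_mul (2 * a))
  have hS1 : MeasurableSet {p : X × X | dist p.2 p.1 < a * bdist Ω p.1} :=
    (isOpen_lt (by fun_prop) ((continuous_bdist.comp continuous_fst).const_mul a)).measurableSet
  have hS2 : MeasurableSet {p : X × X | dist p.1 p.2 < 2 * a * bdist Ω p.2} :=
    (isOpen_lt (by fun_prop)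
      ((continuous_bdist.comp continuous_snd).const_mul (2 * a))).measurableSet
  set k1 : X → X → ℝ≥0∞ := fun z w => A.indicator (fun _ => (1 : ℝ≥0∞)) z *
    ((Metric.ball z (a * bdist Ω z)).indicator (fun w => f z w) w / m1 z) with hk1
  set k2 : X → X → ℝ≥0∞ := fun z w => A'.indicator (fun _ => (1 : ℝ≥0∞)) w *
    ((Metric.ball w (2 * a * bdist Ω w)).indicator (fun z => f z w) z / m2 w) with hk2
  have hk1m : Measurable (Function.uncurry k1) :=
    ((measurable_const.indicator hAm).comp measurable_fst).mul
      ((hf.indicator hS1).div (hm1m.comp measurable_fst))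
  have hk2m : Measurable (Function.uncurry k2) :=
    ((measurable_const.indicator hA'm).comp measurable_snd).mul
      ((hf.indicator hS2).div (hm2m.comp measurable_snd))
  -- With the kernels on the two sides compared pointwise, the claim is Tonelli's theorem for `k2`.
  have hkk : ∀ z w, k1 z w ≤ D * k2 z w := by
    intro z w
    by_cases hz : z ∈ A
    swap
    · simp [hk1, hz]
    by_cases hw : w ∈ Metric.ball z (a * bdist Ω z)
    swap
    · simp [hk1, hw]
    have hwd : dist z w < a * bdist Ω z := by rwa [Metric.mem_ball, dist_comm] at hw
    have hzp := bdist_pos hΩ hne (hA hz)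
    have b1 := bdist_le_add (Ω := Ω) z w
    have b2 := bdist_le_add (Ω := Ω) w z
    rw [dist_comm] at b2
    have b3 : a * bdist Ω z ≤ bdist Ω z / 2 := by nlinarith
    have hz2 : z ∈ Metric.ball w (2 * a * bdist Ω w) := by
      rw [Metric.mem_ball]
      have : a * bdist Ω z ≤ 2 * a * bdist Ω w := by nlinarith
      linarith
    have hmm : m2 w ≤ D * m1 z := by
      refine hD _ _ _ _ (by positivity) ?_
      have : 2 * a * bdist Ω w ≤ 3 * (a * bdist Ω z) := by nlinarith
      linarith
    simp only [hk1, hk2, indicator_of_mem hz, indicator_of_mem hw, indicator_of_mem hz2,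
      indicator_of_mem (hAA' z hz hw), one_mul]
    have p1 : m1 z ≠ 0 := (hμ.measure_ball_pos z (by positivity)).ne'
    have p2 : m1 z ≠ ⊤ := (hμ.measure_ball_lt_top z _).ne
    have hwp : 0 < 2 * a * bdist Ω w := dist_nonneg.trans_lt (Metric.mem_ball.1 hz2)
    have q1 : m2 w ≠ 0 := (hμ.measure_ball_pos w hwp).ne'
    have q2 : m2 w ≠ ⊤ := (hμ.measure_ball_lt_top w _).ne
    rw [ENNReal.div_le_iff p1 p2]
    calc f z w = f z w / m2 w * m2 w := (ENNReal.div_mul_cancel q1 q2).symm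
      _ ≤ f z w / m2 w * (D * m1 z) := by gcongr
      _ = _ := by ring
  have e1 : ∀ z ∈ A, (∫⁻ w in Metric.ball z (a * bdist Ω z), f z w ∂μ) / m1 z =
      ∫⁻ w, k1 z w ∂μ := by
    intro z hz
    simp only [hk1, indicator_of_mem hz, one_mul]
    simp_rw [div_eq_mul_inv]
    rw [lintegral_mul_const, lintegral_indicator measurableSet_ball]
    exact (hf.comp measurable_prodMk_left).indicator measurableSet_ball
  have e2 : ∀ w ∈ A', (∫⁻ z in Metric.ball w (2 * a * bdist Ω w), f z w ∂μ) / m2 w =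
      ∫⁻ z, k2 z w ∂μ := by
    intro w hw
    simp only [hk2, indicator_of_mem hw, one_mul]
    simp_rw [div_eq_mul_inv]
    rw [lintegral_mul_const, lintegral_indicator measurableSet_ball]
    exact (hf.comp measurable_prodMk_right).indicator measurableSet_ball
  calc _ = ∫⁻ z in A, ∫⁻ w, k1 z w ∂μ ∂μ := setLIntegral_congr_fun hAm e1
    _ ≤ ∫⁻ z, ∫⁻ w, D * k2 z w ∂μ ∂μ :=
      (setLIntegral_le_lintegral _ _).trans
        (lintegral_mono fun z => lintegral_mono fun w => hkk z w)
    _ = ∫⁻ w, ∫⁻ z, D * k2 z w ∂μ ∂μ := by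
      rw [lintegral_lintegral_swap]
      exact (measurable_const.mul hk2m).aemeasurable
    _ = D * ∫⁻ w, ∫⁻ z, k2 z w ∂μ ∂μ := by
      simp_rw [lintegral_const_mul' _ _ (ENNReal.coe_ne_top (r := D))]
    _ = D * ∫⁻ w in A', ∫⁻ z, k2 z w ∂μ ∂μ := by
      congr 1
      rw [← lintegral_indicator hA'm]
      refine lintegral_congr fun w => ?_
      by_cases hw : w ∈ A'
      · rw [indicator_of_mem hw]
      · simp [hk2, hw]
    _ = _ := by
      congr 1
      exact (setLIntegral_congr_fun hA'm e2).symm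

/-- The operator `scaledAvg` is bounded in `L¹`. -/
theorem IsDoubling.exists_lintegral_scaledAvg_le [OpensMeasurableSpace X]
    [SecondCountableTopology X] (hμ : IsDoubling μ) (hΩ : IsOpen Ω) (hne : Ωᶜ.Nonempty) {a : ℝ}
    (ha0 : 0 < a) (ha : a ≤ 1 / 2) :
    ∃ D : ℝ≥0, ∀ g : X → ℝ≥0∞, Measurable g → ∀ A ⊆ Ω, ∀ A' : Set X,
      MeasurableSet A → MeasurableSet A' → (∀ z ∈ A, Metric.ball z (a * bdist Ω z) ⊆ A') →
      ∫⁻ z in A, scaledAvg μ Ω a g z ∂μ ≤ D * ∫⁻ w in A', g w ∂μ := by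
  obtain ⟨D, hD⟩ := hμ.exists_lintegral_swap_le hΩ hne ha0 ha
  refine ⟨D, fun g hg A hA A' hAm hA'm hAA' => ?_⟩
  refine (hD (fun _ w => g w) (hg.comp measurable_snd) A hA A' hAm hA'm hAA').trans ?_
  gcongr with w
  rw [setLIntegral_const, mul_div_assoc]
  exact mul_le_of_le_one_right' ENNReal.div_self_le_one

/-- The scale used for the mollification. -/
noncomputable def mollifyScale (Ω : Set X) (lam : ℝ) (z : X) : ℝ := bdist Ω z / (16 * lam)

/-- A `(1,1)`-Poincaré inequality for one pair of functions on the balls well inside `Ω`. -/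
def PoincareInside (μ : Measure X) (Ω : Set X) (lam : ℝ) (C : ℝ≥0) (u : X → ℝ)
    (g : X → ℝ≥0∞) : Prop :=
  ∀ z ∈ Ω, ∀ r : ℝ, 0 < r → Metric.closedBall z (lam * r) ⊆ Ω → ∃ c : ℝ,
    ∫⁻ w in Metric.ball z r, ENNReal.ofReal |u w - c| ∂μ ≤
      C * ENNReal.ofReal r * ∫⁻ w in Metric.ball z (lam * r), g w ∂μ

/-- The scale is chosen so that dilating `B(z, 2ρ(z))` by `lam` gives exactly the ball of radius
`bdist Ω z / 8`, which is well inside `Ω`. The Poincaré inequality there bounds the mean oscillation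
of `u` by `ρ(z)` times an average of `g`; in the Lipschitz estimate this factor cancels the `1/ρ(z)`
from differentiating the bump. -/
theorem IsDoubling.exists_mollify_estimates [OpensMeasurableSpace X] (hμ : IsDoubling μ)
    (hΩ : IsOpen Ω) (hne : Ωᶜ.Nonempty) {lam : ℝ} (hlam : 1 ≤ lam) (C : ℝ≥0) :
    ∃ D : ℝ≥0, ∀ u : X → ℝ, Integrable u μ → ∀ g : X → ℝ≥0∞, PoincareInside μ Ω lam C u g →
      ∀ z ∈ Ω,
      (∀ w, dist z w < 1 / (32 * lam) * bdist Ω z →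
        ENNReal.ofReal |mollify μ (mollifyScale Ω lam) u z - mollify μ (mollifyScale Ω lam) u w| ≤
          D * edist z w * scaledAvg μ Ω (1 / 8) g z) ∧
      (∫⁻ w in Metric.ball z (1 / (16 * lam) * bdist Ω z),
          ENNReal.ofReal |u w - mollify μ (mollifyScale Ω lam) u z| ∂μ) /
          μ (Metric.ball z (1 / (16 * lam) * bdist Ω z)) ≤
        D * ENNReal.ofReal (bdist Ω z) * scaledAvg μ Ω (1 / 8) g z ∧
      ENNReal.ofReal |mollify μ (mollifyScale Ω lam) u z| ≤
        D * scaledAvg μ Ω (1 / (8 * lam)) (fun w => ENNReal.ofReal |u w|) z := by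
  obtain ⟨D, hD0, hD⟩ := hμ.exists_abs_mollify_sub_le
  lift D to ℝ≥0 using hD0
  obtain ⟨E, hE1, hE⟩ := hμ.exists_measure_ball_le (2 * lam)
  refine ⟨2 * D * C * E + (1 + D) * C * E * E + D, fun u hu g hug z hz => ?_⟩
  have hzp := bdist_pos hΩ hne hz
  set ρ := mollifyScale Ω lam with hρ
  set v := mollify μ ρ u with hv
  have hρz : ρ z = bdist Ω z / (16 * lam) := rfl
  have hρp : 0 < ρ z := by rw [hρz]; positivity
  have hlip : ∀ z z', |ρ z - ρ z'| ≤ dist z z' / 4 := by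
    intro x y
    simp only [hρ, mollifyScale]
    rw [← sub_div, abs_div, abs_of_pos (by positivity : 0 < 16 * lam)]
    exact div_le_div₀ dist_nonneg (abs_bdist_sub_le x y) (by norm_num) (by linarith)
  have r1 : 1 / (16 * lam) * bdist Ω z = ρ z := by rw [hρz]; ring
  have r2 : 1 / (8 * lam) * bdist Ω z = 2 * ρ z := by rw [hρz]; field_simp; norm_num
  have r3 : 1 / 8 * bdist Ω z = lam * (2 * ρ z) := by rw [hρz]; field_simp; norm_num
  have r4 : 1 / (32 * lam) * bdist Ω z = ρ z / 2 := by rw [hρz]; field_simp; norm_num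
  have r5 : ρ z ≤ bdist Ω z := by
    rw [hρz]
    exact div_le_self hzp.le (by linarith)
  obtain ⟨c, hc⟩ := hug z hz (2 * ρ z) (by positivity) (fun w hw => by
    refine mem_of_dist_lt_bdist (z := z) ?_
    rw [Metric.mem_closedBall, ← r3, dist_comm] at hw
    linarith)
  have hDc := hD ρ hlip u hu z c hρp
  -- Comparing with the constant `0` gives the bound for the size of the mollification.
  have hD0 := (hD ρ hlip u hu z 0 hρp).1
  rw [r1, r4, scaledAvg, scaledAvg, r2, r3]
  set B := Metric.ball z (2 * ρ z) with hB
  set G := ∫⁻ w in Metric.ball z (lam * (2 * ρ z)), g w ∂μ with hG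
  have hBp : μ B ≠ 0 := (hμ.measure_ball_pos z (by positivity)).ne'
  have hBt : μ B ≠ ⊤ := (hμ.measure_ball_lt_top z _).ne
  have conv : ∀ c : ℝ, ENNReal.ofReal ((∫ w in B, |u w - c| ∂μ) / μ.real B) =
      (∫⁻ w in B, ENNReal.ofReal |u w - c| ∂μ) / μ B := by
    intro c
    rw [Measure.real, ENNReal.ofReal_div_of_pos (ENNReal.toReal_pos hBp hBt),
      ENNReal.ofReal_toReal hBt, ofReal_integral_eq_lintegral_ofReal
        (hμ.integrableOn_ball_sub hu c z _).abs (Eventually.of_forall fun _ => abs_nonneg _)]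
  set L := ∫⁻ w in B, ENNReal.ofReal |u w - c| ∂μ with hL
  set H := G / μ (Metric.ball z (lam * (2 * ρ z))) with hH
  have hLH : L / μ B ≤ C * ENNReal.ofReal (2 * ρ z) * (E * H) := by
    rw [ENNReal.div_le_iff hBp hBt]
    refine hc.trans ?_
    have h1 : G ≤ E * H * μ B := by
      have q1 := (hμ.measure_ball_pos z (r := lam * (2 * ρ z)) (by positivity)).ne'
      have q2 := (hμ.measure_ball_lt_top z (lam * (2 * ρ z))).ne
      calc G = H * μ (Metric.ball z (lam * (2 * ρ z))) := (ENNReal.div_mul_cancel q1 q2).symm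
        _ ≤ H * (E * μ B) := by
          gcongr
          refine hE _ _ _ _ (by positivity) ?_
          rw [dist_self]
          nlinarith
        _ = _ := by ring
    calc _ ≤ C * ENNReal.ofReal (2 * ρ z) * (E * H * μ B) := by gcongr
      _ = _ := by ring
  have hvc : ENNReal.ofReal |v z - c| ≤ D * (L / μ B) := by
    refine (ENNReal.ofReal_le_ofReal hDc.1).trans (le_of_eq ?_)
    rw [ENNReal.ofReal_mul D.coe_nonneg, conv, ENNReal.ofReal_coe_nnreal]
  refine ⟨fun w hw => ?_, ?_, ?_⟩
  · calc ENNReal.ofReal |v z - v w| ≤ D * (edist z w / ENNReal.ofReal (ρ z) * (L / μ B)) := by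
          refine (ENNReal.ofReal_le_ofReal (hDc.2 w hw)).trans (le_of_eq ?_)
          rw [ENNReal.ofReal_mul D.coe_nonneg, ENNReal.ofReal_mul (by positivity), conv,
            ENNReal.ofReal_div_of_pos hρp, ENNReal.ofReal_coe_nnreal, edist_dist]
      _ ≤ D * (edist z w / ENNReal.ofReal (ρ z) * (C * ENNReal.ofReal (2 * ρ z) * (E * H))) := by
          gcongr
      _ = 2 * D * C * E * edist z w * H *
          (ENNReal.ofReal (ρ z) * (ENNReal.ofReal (ρ z))⁻¹) := by
          rw [ENNReal.ofReal_mul zero_le_two, ENNReal.ofReal_ofNat, div_eq_mul_inv]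
          ring
      _ = ((2 * D * C * E : ℝ≥0) : ℝ≥0∞) * edist z w * H := by
          rw [ENNReal.mul_inv_cancel (ENNReal.ofReal_pos.2 hρp).ne' ENNReal.ofReal_ne_top]
          push_cast
          ring
      _ ≤ _ := by
          gcongr
          rw [add_assoc]
          exact le_self_add
  · have s1 : ∫⁻ w in Metric.ball z (ρ z), ENNReal.ofReal |u w - v z| ∂μ ≤
        (1 + D) * L := by
      calc _ ≤ ∫⁻ w in B, ENNReal.ofReal |u w - v z| ∂μ :=
            lintegral_mono_set (Metric.ball_subset_ball (by linarith))
        _ ≤ ∫⁻ w in B, (ENNReal.ofReal |u w - c| + ENNReal.ofReal |v z - c|) ∂μ := by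
            refine lintegral_mono fun w => ?_
            rw [← ENNReal.ofReal_add (abs_nonneg _) (abs_nonneg _), abs_sub_comm (v z) c]
            exact ENNReal.ofReal_le_ofReal (abs_sub_le _ _ _)
        _ = L + ENNReal.ofReal |v z - c| * μ B := by
            rw [lintegral_add_right _ measurable_const, setLIntegral_const]
        _ ≤ L + D * (L / μ B) * μ B := by gcongr
        _ = _ := by
            rw [mul_assoc, ENNReal.div_mul_cancel hBp hBt]
            ring
    have p1 := (hμ.measure_ball_pos z hρp).ne'
    have p2 := (hμ.measure_ball_lt_top z (ρ z)).ne
    calc _ ≤ (1 + D) * L / μ (Metric.ball z (ρ z)) := by gcongr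
      _ ≤ ((1 + D) * C * E * E : ℝ≥0) * ENNReal.ofReal (bdist Ω z) * H := by
        rw [ENNReal.div_le_iff p1 p2]
        calc (1 + D) * L = (1 + D) * (L / μ B * μ B) := by rw [ENNReal.div_mul_cancel hBp hBt]
          _ ≤ (1 + D) * (C * ENNReal.ofReal (bdist Ω z) * (E * H) *
              (E * μ (Metric.ball z (ρ z)))) := by
            gcongr
            · refine hLH.trans ?_
              gcongr
              rw [← r2]
              refine mul_le_of_le_one_left hzp.le ?_
              rw [div_le_one (by positivity)]
              linarith
            · refine hE _ _ _ _ hρp ?_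
              rw [dist_self]
              nlinarith
          _ = _ := by
            push_cast
            ring
      _ ≤ _ := by
        gcongr
        exact le_add_right le_add_self
  · rw [show |v z| = |v z - 0| by rw [sub_zero]]
    refine (ENNReal.ofReal_le_ofReal hD0).trans ?_
    rw [ENNReal.ofReal_mul D.coe_nonneg, conv, ENNReal.ofReal_coe_nnreal]
    simp only [sub_zero]
    gcongr
    exact le_add_self

end BoundaryDistance

/-! ### Gradients of the regularized function. -/

section Regularization

variable {X : Type*} [MetricSpace X] [MeasurableSpace X] {μ : Measure X} {Ω : Set X}

/-- At every point `z` of `Ω` the function `v` varies at most like `D` times the average of `g`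
over the ball at `z` of an eighth of the distance to the complement. -/
def VariesLike (μ : Measure X) (Ω : Set X) (b : ℝ) (D : ℝ≥0) (v : X → ℝ) (g : X → ℝ≥0∞) : Prop :=
  ∀ z ∈ Ω, ∀ w, dist z w < b * bdist Ω z →
    ENNReal.ofReal |v z - v w| ≤ D * edist z w * scaledAvg μ Ω (1 / 8) g z

/-- A Harnack type comparison of averages at nearby points. -/
theorem IsDoubling.exists_scaledAvg_le (hμ : IsDoubling μ) (hΩ : IsOpen Ω) (hne : Ωᶜ.Nonempty) :
    ∃ D : ℝ≥0, ∀ (g : X → ℝ≥0∞), ∀ z ∈ Ω, ∀ w ∈ Ω, dist z w ≤ bdist Ω z / 16 →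
      scaledAvg μ Ω (1 / 8) g z ≤ D * scaledAvg μ Ω (1 / 4) g w := by
  obtain ⟨D, hD⟩ := hμ.exists_lintegral_div_le 4
  refine ⟨D, fun g z hz w hw h => ?_⟩
  have hzp := bdist_pos hΩ hne hz
  have hwp := bdist_pos hΩ hne hw
  have b1 := bdist_le_add (Ω := Ω) z w
  have b2 := bdist_le_add (Ω := Ω) w z
  rw [dist_comm] at b2
  exact hD g z w _ _ (by positivity) (by positivity) (by linarith) (by linarith)

theorem IsDoubling.scaledAvg_lt_top (hμ : IsDoubling μ) (hΩ : IsOpen Ω) (hne : Ωᶜ.Nonempty)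
    {a : ℝ} (ha0 : 0 < a) (ha : a ≤ 1) {g : X → ℝ≥0∞} (hg : ∫⁻ x in Ω, g x ∂μ < ⊤) {z : X}
    (hz : z ∈ Ω) : scaledAvg μ Ω a g z < ⊤ := by
  have hzp := bdist_pos hΩ hne hz
  refine ENNReal.div_lt_top (ne_top_of_le_ne_top hg.ne (lintegral_mono_set fun w hw => ?_))
    (hμ.measure_ball_pos z (by positivity)).ne'
  refine mem_of_dist_lt_bdist (z := z) ?_
  rw [Metric.mem_ball, dist_comm] at hw
  nlinarith

/-- The constant in `VariesLike` depends on the base point; the Harnack comparison bounds it near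
`z` by one finite multiple of `scaledAvg μ Ω (1 / 4) g z`. -/
theorem IsDoubling.locallyLipschitzOn_of_variesLike (hμ : IsDoubling μ) (hΩ : IsOpen Ω)
    (hne : Ωᶜ.Nonempty) {b : ℝ} (hb : 0 < b) {D : ℝ≥0} {v : X → ℝ} {g : X → ℝ≥0∞}
    (hv : VariesLike μ Ω b D v g) (hg : ∫⁻ x in Ω, g x ∂μ < ⊤) : LocallyLipschitzOn Ω v := by
  intro z hz
  have hzp := bdist_pos hΩ hne hz
  obtain ⟨E, hE⟩ := hμ.exists_scaledAvg_le hΩ hne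
  have hfin := (hμ.scaledAvg_lt_top hΩ hne (a := 1 / 4) (by norm_num) (by norm_num) hg hz).ne
  set K := D * (E * (scaledAvg μ Ω (1 / 4) g z).toNNReal) with hK
  -- The bound `b / 4` lets `VariesLike` be applied between any two points of the ball, and `1 / 32`
  -- keeps them within the range of the Harnack comparison with `z`.
  set ε := min (b / 4) (1 / 32) with hε
  have hε0 : 0 < ε := lt_min (by positivity) (by norm_num)
  have hε1 : ε ≤ b / 4 := min_le_left _ _
  have hε2 : ε ≤ 1 / 32 := min_le_right _ _
  refine ⟨K, Metric.ball z (ε * bdist Ω z),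
    mem_nhdsWithin_of_mem_nhds (Metric.ball_mem_nhds z (by positivity)), ?_⟩
  intro w hw w' hw'
  rw [Metric.mem_ball] at hw hw'
  have e1 : ε * bdist Ω z ≤ 1 / 32 * bdist Ω z := by gcongr
  have e2 : ε * bdist Ω z ≤ b / 4 * bdist Ω z := by gcongr
  have hwz : bdist Ω z ≤ bdist Ω w + dist z w := bdist_le_add z w
  rw [dist_comm] at hwz
  have hwΩ : w ∈ Ω := by
    refine mem_of_dist_lt_bdist (z := z) ?_
    rw [dist_comm]
    linarith
  have hww : dist w w' < b * bdist Ω w := by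
    have h1 := dist_triangle_right w w' z
    have h2 : b * (31 / 32 * bdist Ω z) ≤ b * bdist Ω w := by
      gcongr
      linarith
    have h3 : 0 < b * bdist Ω z := by positivity
    linarith
  rw [edist_dist, Real.dist_eq]
  calc _ ≤ D * edist w w' * scaledAvg μ Ω (1 / 8) g w := hv w hwΩ w' hww
    _ ≤ D * edist w w' * (E * scaledAvg μ Ω (1 / 4) g z) := by
      gcongr
      exact hE g w hwΩ z hz (by linarith)
    _ = K * edist w w' := by
      simp only [hK, ENNReal.coe_mul, ENNReal.coe_toNNReal hfin]
      ring

theorem IsDoubling.ofReal_abs_sub_le_integral_of_variesLike (hμ : IsDoubling μ) (hΩ : IsOpen Ω)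
    (hne : Ωᶜ.Nonempty) {b : ℝ} (hb : 0 < b) {D : ℝ≥0} {v : X → ℝ} {g : X → ℝ≥0∞}
    (hv : VariesLike μ Ω b D v g) (hg : ∫⁻ x in Ω, g x ∂μ < ⊤) {γ : Curve X}
    (hγ : γ.LiesIn Ω) :
    ENNReal.ofReal |v (γ.toFun γ.len) - v (γ.toFun 0)| ≤
      γ.integral fun z => D * scaledAvg μ Ω (1 / 8) g z := by
  refine γ.ofReal_abs_sub_le_integral hγ (hμ.locallyLipschitzOn_of_variesLike hΩ hne hb hv hg)
    fun z hz => ?_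
  have hzp := bdist_pos hΩ hne hz
  filter_upwards [Metric.ball_mem_nhds z (by positivity : 0 < b * bdist Ω z)] with w hw
  rw [Metric.mem_ball, dist_comm] at hw
  rw [abs_sub_comm, edist_comm]
  refine (hv z hz w hw).trans (le_of_eq ?_)
  ring

theorem newtonNorm_coe_le {v : X → ℝ} {h : X → ℝ≥0∞} (hh : AEMeasurable h (μ.restrict Ω))
    (hv : ∀ γ : Curve X, γ.LiesIn Ω →
      ENNReal.ofReal |v (γ.toFun γ.len) - v (γ.toFun 0)| ≤ γ.integral h) :
    newtonNorm μ Ω (fun x => (v x : EReal)) ≤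
      ∫⁻ x in Ω, ENNReal.ofReal |v x| ∂μ + ∫⁻ x in Ω, h x ∂μ := by
  have hw : IsWeakUpperGradientIn μ Ω (fun x => (v x : EReal)) h := by
    refine ⟨hh, 0, measurable_const, by simp, fun γ hγ hn => absurd ?_ hn⟩
    rw [Curve.UpperGradientIneq, abs_coe_sub_coe, abs_sub_comm]
    exact hv γ hγ
  exact add_le_add (le_of_eq (by simp_rw [EReal.abs_def])) (iInf₂_le h hw)

theorem hajlaszNorm_coe_le {v : X → ℝ} {h : X → ℝ≥0∞} (hh : AEMeasurable h (μ.restrict Ω))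
    (hv : ∀ x ∈ Ω, ∀ y ∈ Ω, ENNReal.ofReal |v x - v y| ≤ edist x y * (h x + h y)) :
    hajlaszNorm μ Ω (fun x => (v x : EReal)) ≤
      ∫⁻ x in Ω, ENNReal.ofReal |v x| ∂μ + ∫⁻ x in Ω, h x ∂μ := by
  have hw : IsHajlaszGradientIn μ Ω (fun x => (v x : EReal)) h := by
    refine ⟨hh, ∅, empty_subset _, measure_empty, fun x hx y hy => ?_⟩
    rw [abs_coe_sub_coe]
    exact hv x hx.1 y hy.1
  exact add_le_add (le_of_eq (by simp_rw [EReal.abs_def])) (iInf₂_le h hw)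

/-- On nontangential approach regions at `x`, the averages of `g` at the scale of the boundary
distance are controlled by a maximal function at `x` of power less than one. -/
theorem IsDoubling.exists_scaledAvg_le_dyadicMaximal [OpensMeasurableSpace X]
    (hμ : IsDoubling μ) (hΩ : IsOpen Ω) (hne : Ωᶜ.Nonempty) {c : ℝ} (hc0 : 0 < c) (hc1 : c ≤ 1) :
    ∃ D : ℝ≥0, ∀ (g : X → ℝ≥0∞) (x z : X) (t : ℝ), 0 < t → z ∈ Ω → dist x z ≤ t →
      c * t ≤ bdist Ω z → scaledAvg μ Ω (1 / 8) g z ≤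
        D * dyadicMaximal μ
          (Ω.indicator fun w => (scaledAvg μ Ω (1 / 4) g w) ^ (1 / 2 : ℝ)) x ^ 2 := by
  obtain ⟨D, hD⟩ := hμ.exists_scaledAvg_le hΩ hne
  -- With `s = c * t / 32` one has `160 / c * s = 5 * t`. This accommodates `dist x z ≤ t` together
  -- with the dyadic radius around `x`, which lies between `2 * t` and `4 * t`.
  obtain ⟨E, hE⟩ := hμ.exists_lintegral_div_le (160 / c)
  refine ⟨D * E ^ 2, fun g x z t ht hz hxz hct => ?_⟩
  set f : X → ℝ≥0∞ := Ω.indicator fun w => (scaledAvg μ Ω (1 / 4) g w) ^ (1 / 2 : ℝ) with hf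
  set s := c * t / 32 with hs
  have hs0 : 0 < s := by positivity
  have hst : s ≤ t / 32 := by
    rw [hs]
    gcongr
    nlinarith
  set H := scaledAvg μ Ω (1 / 8) g z with hH
  -- By Harnack the value at `z` is dominated on a whole ball, so its square root is dominated by an
  -- average of `f`, and that average by the maximal function at `x`.
  have hpt : ∀ w ∈ Metric.ball z s, H ^ (1 / 2 : ℝ) ≤ (D : ℝ≥0∞) ^ (1 / 2 : ℝ) * f w := by
    intro w hw
    rw [Metric.mem_ball, dist_comm] at hw
    have hwΩ : w ∈ Ω := mem_of_dist_lt_bdist (z := z) (by linarith)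
    rw [hf, indicator_of_mem hwΩ, ← ENNReal.mul_rpow_of_nonneg _ _ (by norm_num)]
    exact ENNReal.rpow_le_rpow (hD g z hz w hwΩ (by linarith)) (by norm_num)
  have p1 := (hμ.measure_ball_pos z hs0).ne'
  have p2 := (hμ.measure_ball_lt_top z s).ne
  obtain ⟨n, hn1, hn2⟩ := exists_mem_Ico_zpow (x := 2 * t) (y := 2) (by positivity) one_lt_two
  have hn3 : (2 : ℝ) ^ (n + 1) ≤ 4 * t := by
    rw [zpow_add₀ two_ne_zero, zpow_one]
    linarith
  have hroot : H ^ (1 / 2 : ℝ) ≤ (D : ℝ≥0∞) ^ (1 / 2 : ℝ) * (E * dyadicMaximal μ f x) := by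
    calc H ^ (1 / 2 : ℝ)
        = (∫⁻ _ in Metric.ball z s, H ^ (1 / 2 : ℝ) ∂μ) / μ (Metric.ball z s) := by
          rw [setLIntegral_const, ENNReal.mul_div_cancel_right p1 p2]
      _ ≤ (∫⁻ w in Metric.ball z s, (D : ℝ≥0∞) ^ (1 / 2 : ℝ) * f w ∂μ) /
          μ (Metric.ball z s) := by
          gcongr ?_ / _
          exact setLIntegral_mono' measurableSet_ball hpt
      _ = (D : ℝ≥0∞) ^ (1 / 2 : ℝ) * ((∫⁻ w in Metric.ball z s, f w ∂μ) /
          μ (Metric.ball z s)) := by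
          rw [lintegral_const_mul' _ _
            (ENNReal.rpow_ne_top_of_nonneg (by norm_num) ENNReal.coe_ne_top), mul_div_assoc]
      _ ≤ (D : ℝ≥0∞) ^ (1 / 2 : ℝ) * (E * ((∫⁻ w in Metric.ball x ((2 : ℝ) ^ (n + 1)), f w ∂μ) /
          μ (Metric.ball x ((2 : ℝ) ^ (n + 1))))) := by
          gcongr
          refine hE f z x s _ hs0 (by positivity) ?_ ?_
          · rw [dist_comm]
            linarith
          · rw [dist_comm]
            have : 160 / c * s = 5 * t := by
              rw [hs]
              field_simp
              norm_num
            linarith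
      _ ≤ _ := by
          gcongr
          exact le_iSup (fun k : ℤ => (∫⁻ w in Metric.ball x ((2 : ℝ) ^ k), f w ∂μ) /
            μ (Metric.ball x ((2 : ℝ) ^ k))) (n + 1)
  have hsq : ∀ a : ℝ≥0∞, (a ^ (1 / 2 : ℝ)) ^ 2 = a := by
    intro a
    rw [← ENNReal.rpow_natCast, ← ENNReal.rpow_mul]
    norm_num
  calc H = (H ^ (1 / 2 : ℝ)) ^ 2 := (hsq H).symm
    _ ≤ ((D : ℝ≥0∞) ^ (1 / 2 : ℝ) * (E * dyadicMaximal μ f x)) ^ 2 := by gcongr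
    _ = _ := by
      rw [mul_pow, hsq]
      push_cast
      ring

/-- In a uniform domain, functions varying like `g` have an integrable Hajłasz gradient. -/
theorem IsDoubling.exists_hajlasz_gradient [BorelSpace X] (hμ : IsDoubling μ)
    (hΩ : IsUniformDomain Ω) (hne : Ωᶜ.Nonempty) {b : ℝ} (hb : 0 < b) (D : ℝ≥0) :
    ∃ E : ℝ≥0, ∀ (v : X → ℝ) (g : X → ℝ≥0∞), VariesLike μ Ω b D v g → Measurable g →
      ∫⁻ x in Ω, g x ∂μ < ⊤ → ∃ h : X → ℝ≥0∞, Measurable h ∧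
        (∀ x ∈ Ω, ∀ y ∈ Ω, ENNReal.ofReal |v x - v y| ≤ edist x y * (h x + h y)) ∧
        ∫⁻ x in Ω, h x ∂μ ≤ E * ∫⁻ x in Ω, g x ∂μ := by
  have := hμ.sigmaFinite
  have := hμ.secondCountableTopology
  obtain ⟨hΩo, -, c, hc0, hc1, hcurve⟩ := hΩ
  obtain ⟨E1, hE1⟩ := hμ.exists_scaledAvg_le_dyadicMaximal hΩo hne hc0 hc1
  obtain ⟨E2, hE2⟩ := hμ.exists_lintegral_dyadicMaximal_sq_le
  obtain ⟨E3, hE3⟩ := hμ.exists_lintegral_scaledAvg_le hΩo hne (a := 1 / 4) (by norm_num)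
    (by norm_num)
  set cn : ℝ≥0 := (c⁻¹).toNNReal with hcn
  refine ⟨D * E1 * cn * E2 * E3, fun v g hv hg hgt => ?_⟩
  set f : X → ℝ≥0∞ := Ω.indicator fun w => (scaledAvg μ Ω (1 / 4) g w) ^ (1 / 2 : ℝ) with hf
  have hfm : Measurable f :=
    ((measurable_scaledAvg _ hg).pow_const _).indicator hΩo.measurableSet
  set M := dyadicMaximal μ f with hM
  have hMm : Measurable M := measurable_dyadicMaximal hfm
  refine ⟨fun x => (D * E1 * cn : ℝ≥0) * M x ^ 2, (hMm.pow_const 2).const_mul _, ?_, ?_⟩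
  · intro x hx y hy
    rcases eq_or_ne x y with rfl | hxy
    · simp
    obtain ⟨γ, hγ, h0, h1, hlen, hdist⟩ := hcurve x hx y hy hxy
    have hd := hμ.ofReal_abs_sub_le_integral_of_variesLike hΩo hne hb hv hgt hγ
    rw [h0, h1, abs_sub_comm] at hd
    have hbd : ∀ t ∈ Icc 0 γ.len, c * min t (γ.len - t) ≤ bdist Ω (γ.toFun t) := by
      intro t ht
      exact (ENNReal.ofReal_le_iff_le_toReal (Metric.infEDist_ne_top hne)).1 (hdist t ht)
    -- On the first half of the curve `γ(t)` is within `t` of `x` and at least `c * t` from the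
    -- complement; on the second half the same holds for `y` with `γ.len - t`. The integrand is thus
    -- bounded by a constant, and the length by `c⁻¹ * dist x y`.
    have hpt : ∀ t ∈ Ioo 0 γ.len, D * scaledAvg μ Ω (1 / 8) g (γ.toFun t) ≤
        D * (E1 * (M x ^ 2 + M y ^ 2)) := by
      intro t ht
      have htI := Ioo_subset_Icc_self ht
      have hbt := hbd t htI
      gcongr
      rcases le_total t (γ.len - t) with h | h
      · rw [min_eq_left h] at hbt
        refine (hE1 g x (γ.toFun t) t ht.1 (hγ t htI) ?_ hbt).trans ?_
        · have := γ.lipschitzOnWith.dist_le_mul 0 (left_mem_Icc.2 γ.len_pos.le) t htI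
          rw [h0, NNReal.coe_one, one_mul, dist_zero_left, Real.norm_of_nonneg ht.1.le] at this
          exact this
        · gcongr
          exact le_self_add
      · rw [min_eq_right h] at hbt
        refine (hE1 g y (γ.toFun t) (γ.len - t) (by linarith [ht.2]) (hγ t htI) ?_ hbt).trans ?_
        · have := γ.lipschitzOnWith.dist_le_mul γ.len (right_mem_Icc.2 γ.len_pos.le) t htI
          rw [h1, NNReal.coe_one, one_mul, Real.dist_eq, abs_of_pos (by linarith [ht.2])] at this
          exact this
        · gcongr
          exact le_add_self
    calc _ ≤ _ := hd
      _ = ∫⁻ t in Ioo 0 γ.len, D * scaledAvg μ Ω (1 / 8) g (γ.toFun t) :=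
        (setLIntegral_congr Ioo_ae_eq_Icc).symm
      _ ≤ ∫⁻ _ in Ioo 0 γ.len, D * (E1 * (M x ^ 2 + M y ^ 2)) :=
        setLIntegral_mono' measurableSet_Ioo hpt
      _ = D * (E1 * (M x ^ 2 + M y ^ 2)) * ENNReal.ofReal γ.len := by
        rw [setLIntegral_const, Real.volume_Ioo, sub_zero]
      _ ≤ D * (E1 * (M x ^ 2 + M y ^ 2)) * (cn * edist x y) := by
        gcongr
        rw [edist_dist, hcn, ← ENNReal.ofReal, ← ENNReal.ofReal_mul (by positivity)]
        exact ENNReal.ofReal_le_ofReal hlen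
      _ = _ := by
        push_cast
        ring
  · have hfsq : ∀ x, f x ^ 2 = Ω.indicator (scaledAvg μ Ω (1 / 4) g) x := by
      intro x
      by_cases hx : x ∈ Ω
      · rw [hf, indicator_of_mem hx, indicator_of_mem hx, ← ENNReal.rpow_natCast,
          ← ENNReal.rpow_mul]
        norm_num
      · rw [hf, indicator_of_notMem hx, indicator_of_notMem hx]
        norm_num
    calc _ = (D * E1 * cn : ℝ≥0) * ∫⁻ x in Ω, M x ^ 2 ∂μ :=
        lintegral_const_mul' _ _ ENNReal.coe_ne_top
      _ ≤ (D * E1 * cn : ℝ≥0) * (E2 * ∫⁻ x, f x ^ 2 ∂μ) := by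
        gcongr
        exact (setLIntegral_le_lintegral _ _).trans (hE2 f hfm)
      _ ≤ (D * E1 * cn : ℝ≥0) * (E2 * (E3 * ∫⁻ x in Ω, g x ∂μ)) := by
        gcongr
        simp_rw [hfsq]
        rw [lintegral_indicator hΩo.measurableSet]
        refine hE3 g hg Ω subset_rfl Ω hΩo.measurableSet hΩo.measurableSet fun z hz w hw => ?_
        have hzp := bdist_pos hΩo hne hz
        refine mem_of_dist_lt_bdist (z := z) ?_
        rw [Metric.mem_ball, dist_comm] at hw
        linarith
      _ = _ := by
        push_cast
        ring

end Regularization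

/-! ### Closeness of a function and its regularization near the boundary. -/

section Approximation

variable {X : Type*} [MetricSpace X] {Ω : Set X}

theorem scaledBall_subset_self (hΩ : IsOpen Ω) (hne : Ωᶜ.Nonempty) {a : ℝ} (ha : a ≤ 1) :
    ∀ z ∈ Ω, Metric.ball z (a * bdist Ω z) ⊆ Ω := by
  intro z hz w hw
  have hzp := bdist_pos hΩ hne hz
  refine mem_of_dist_lt_bdist (z := z) ?_
  rw [Metric.mem_ball, dist_comm] at hw
  nlinarith

theorem scaledBall_subset_double (hΩ : IsOpen Ω) (hne : Ωᶜ.Nonempty) {a : ℝ} (ha : a ≤ 1)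
    {x : X} (hx : x ∉ Ω) (r : ℝ) :
    ∀ z ∈ Metric.ball x r ∩ Ω, Metric.ball z (a * bdist Ω z) ⊆ Metric.ball x (2 * r) ∩ Ω := by
  rintro z ⟨hzx, hz⟩ w hw
  refine ⟨?_, scaledBall_subset_self hΩ hne ha z hz hw⟩
  have hzp := bdist_pos hΩ hne hz
  have h1 := bdist_le_dist hx z
  rw [Metric.mem_ball] at hzx hw ⊢
  have h2 := dist_triangle w z x
  nlinarith

variable [MeasurableSpace X] {μ : Measure X}

/-- Near a boundary point, `u` and its mollification differ little in the mean. -/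
theorem IsDoubling.exists_lintegral_abs_sub_mollify_le [OpensMeasurableSpace X]
    [SecondCountableTopology X] (hμ : IsDoubling μ) (hΩ : IsOpen Ω) (hne : Ωᶜ.Nonempty)
    {a : ℝ} (ha0 : 0 < a) (ha : a ≤ 1 / 16) (D : ℝ≥0) :
    ∃ E : ℝ≥0, ∀ (u v : X → ℝ) (g : X → ℝ≥0∞), Measurable u → ContinuousOn v Ω → Measurable g →
      VariesLike μ Ω a D v g →
      (∀ z ∈ Ω, (∫⁻ w in Metric.ball z (2 * a * bdist Ω z), ENNReal.ofReal |u w - v z| ∂μ) /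
          μ (Metric.ball z (2 * a * bdist Ω z)) ≤
        D * ENNReal.ofReal (bdist Ω z) * scaledAvg μ Ω (1 / 8) g z) →
      ∀ x ∉ Ω, ∀ r : ℝ, 0 < r →
        ∫⁻ z in Metric.ball x r ∩ Ω, ENNReal.ofReal |u z - v z| ∂μ ≤
          E * ENNReal.ofReal r * ∫⁻ z in Metric.ball x (4 * r) ∩ Ω, g z ∂μ := by
  have := hμ.sigmaFinite
  obtain ⟨E1, hE1⟩ := hμ.exists_lintegral_swap_le hΩ hne ha0 (by linarith)
  obtain ⟨E2, hE2⟩ := hμ.exists_lintegral_scaledAvg_le hΩ hne (a := 1 / 8) (by norm_num)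
    (by norm_num)
  refine ⟨2 * E1 * D * E2 + D * E2, fun u v g hu hv hg hvar hosc x hx r hr => ?_⟩
  have hball : ∀ s : ℝ, MeasurableSet (Metric.ball x s ∩ Ω) :=
    fun s => measurableSet_ball.inter hΩ.measurableSet
  set v' : X → ℝ := Ω.indicator v with hv'
  have hv'm : Measurable v' := by
    have := hv.domRestrict.measurable
    refine measurable_of_restrict_of_restrict_compl hΩ.measurableSet ?_ ?_
    · convert this using 1
      ext z
      simp [hv', z.2]
    · convert measurable_const (a := (0 : ℝ)) using 1
      ext z
      simp [hv', show (z : X) ∉ Ω from z.2]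
  set f : X → X → ℝ≥0∞ := fun z p => ENNReal.ofReal |u z - v' p| with hf
  have hfm : Measurable (Function.uncurry f) := by
    have h1 : Measurable fun q : X × X => u q.1 - v' q.2 :=
      (hu.comp measurable_fst).sub (hv'm.comp measurable_snd)
    exact h1.abs.ennreal_ofReal
  -- The hypothesis controls averages of `|u - v p|` around `p`, not `|u z - v z|`. So `v z` is
  -- first replaced by the nearby values `v p`, averaged over `p`; exchanging the order of
  -- integration then produces averages in `z` around `p`.
  have hpt : ∀ z ∈ Metric.ball x r ∩ Ω, ENNReal.ofReal |u z - v z| ≤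
      (∫⁻ p in Metric.ball z (a * bdist Ω z), f z p ∂μ) / μ (Metric.ball z (a * bdist Ω z)) +
        D * ENNReal.ofReal r * scaledAvg μ Ω (1 / 8) g z := by
    rintro z ⟨hzx, hz⟩
    have hzp := bdist_pos hΩ hne hz
    have hzr : bdist Ω z ≤ r := (bdist_le_dist hx z).trans (Metric.mem_ball.1 hzx).le
    have p1 := (hμ.measure_ball_pos z (r := a * bdist Ω z) (by positivity)).ne'
    have p2 := (hμ.measure_ball_lt_top z (a * bdist Ω z)).ne
    set R := D * ENNReal.ofReal r * scaledAvg μ Ω (1 / 8) g z with hR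
    have h1 : ∀ p ∈ Metric.ball z (a * bdist Ω z), ENNReal.ofReal |u z - v z| ≤ f z p + R := by
      intro p hp
      have hpΩ := scaledBall_subset_self hΩ hne (by linarith) z hz hp
      rw [Metric.mem_ball, dist_comm] at hp
      have h2 := hvar z hz p hp
      calc _ ≤ ENNReal.ofReal (|u z - v p| + |v z - v p|) := by
            refine ENNReal.ofReal_le_ofReal ?_
            rw [abs_sub_comm (v z)]
            exact abs_sub_le _ _ _
        _ = f z p + ENNReal.ofReal |v z - v p| := by
            rw [ENNReal.ofReal_add (abs_nonneg _) (abs_nonneg _)]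
            simp [hf, hv', hpΩ]
        _ ≤ f z p + D * edist z p * scaledAvg μ Ω (1 / 8) g z := by gcongr
        _ ≤ _ := by
            rw [hR]
            gcongr
            rw [edist_dist]
            refine ENNReal.ofReal_le_ofReal ?_
            nlinarith
    calc ENNReal.ofReal |u z - v z| = (∫⁻ _ in Metric.ball z (a * bdist Ω z),
          ENNReal.ofReal |u z - v z| ∂μ) / μ (Metric.ball z (a * bdist Ω z)) := by
          rw [setLIntegral_const, ENNReal.mul_div_cancel_right p1 p2]
      _ ≤ (∫⁻ p in Metric.ball z (a * bdist Ω z), (f z p + R) ∂μ) /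
          μ (Metric.ball z (a * bdist Ω z)) := by
          gcongr ?_ / _
          exact setLIntegral_mono' measurableSet_ball h1
      _ = _ := by
          rw [lintegral_add_right _ measurable_const, setLIntegral_const, ENNReal.add_div,
            ENNReal.mul_div_cancel_right p1 p2]
  have hmono : ∫⁻ z in Metric.ball x r ∩ Ω, scaledAvg μ Ω (1 / 8) g z ∂μ ≤
      E2 * ∫⁻ z in Metric.ball x (4 * r) ∩ Ω, g z ∂μ := by
    refine hE2 g hg _ inter_subset_right _ (hball _) (hball _) fun z hz => ?_
    refine (scaledBall_subset_double hΩ hne (by norm_num) hx r z hz).trans ?_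
    exact inter_subset_inter_left _ (Metric.ball_subset_ball (by linarith))
  have hfirst : ∫⁻ z in Metric.ball x r ∩ Ω, (∫⁻ p in Metric.ball z (a * bdist Ω z), f z p ∂μ) /
      μ (Metric.ball z (a * bdist Ω z)) ∂μ ≤
      E1 * (D * ENNReal.ofReal (2 * r) * (E2 * ∫⁻ z in Metric.ball x (4 * r) ∩ Ω, g z ∂μ)) := by
    refine (hE1 f hfm _ inter_subset_right _ (hball r) (hball (2 * r))
      (scaledBall_subset_double hΩ hne (by linarith) hx r)).trans ?_
    gcongr
    -- The exchange has enlarged the ball at `x` to radius `2 * r`; removing the average of `g`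
    -- enlarges it again, to `4 * r`.
    calc _ ≤ ∫⁻ p in Metric.ball x (2 * r) ∩ Ω,
          D * ENNReal.ofReal (2 * r) * scaledAvg μ Ω (1 / 8) g p ∂μ := by
          refine setLIntegral_mono' (hball _) fun p hp => ?_
          have h1 := hosc p hp.2
          have h2 : v' p = v p := indicator_of_mem hp.2 _
          simp only [hf, h2]
          refine h1.trans ?_
          gcongr
          exact (bdist_le_dist hx p).trans (Metric.mem_ball.1 hp.1).le
      _ = D * ENNReal.ofReal (2 * r) *
          ∫⁻ p in Metric.ball x (2 * r) ∩ Ω, scaledAvg μ Ω (1 / 8) g p ∂μ :=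
          lintegral_const_mul' _ _ (by finiteness)
      _ ≤ _ := by
          gcongr
          refine hE2 g hg _ inter_subset_right _ (hball _) (hball _) fun z hz => ?_
          have := scaledBall_subset_double hΩ hne (a := 1 / 8) (by norm_num) hx _ z hz
          rwa [← mul_assoc, show (2 : ℝ) * 2 = 4 by norm_num] at this
  calc _ ≤ ∫⁻ z in Metric.ball x r ∩ Ω, ((∫⁻ p in Metric.ball z (a * bdist Ω z), f z p ∂μ) /
        μ (Metric.ball z (a * bdist Ω z)) + D * ENNReal.ofReal r * scaledAvg μ Ω (1 / 8) g z) ∂μ :=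
        setLIntegral_mono' (hball r) hpt
    _ = ∫⁻ z in Metric.ball x r ∩ Ω, (∫⁻ p in Metric.ball z (a * bdist Ω z), f z p ∂μ) /
        μ (Metric.ball z (a * bdist Ω z)) ∂μ +
        D * ENNReal.ofReal r * ∫⁻ z in Metric.ball x r ∩ Ω, scaledAvg μ Ω (1 / 8) g z ∂μ := by
        rw [lintegral_add_right _ ((measurable_scaledAvg _ hg).const_mul _),
          lintegral_const_mul' _ _ (by finiteness)]
    _ ≤ E1 * (D * ENNReal.ofReal (2 * r) * (E2 * ∫⁻ z in Metric.ball x (4 * r) ∩ Ω, g z ∂μ)) +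
        D * ENNReal.ofReal r * (E2 * ∫⁻ z in Metric.ball x (4 * r) ∩ Ω, g z ∂μ) := by gcongr
    _ = _ := by
        rw [ENNReal.ofReal_mul zero_le_two, ENNReal.ofReal_ofNat]
        push_cast
        ring

/-- A function satisfying a Poincaré inequality inside a uniform domain can be replaced, without
changing its boundary behaviour much, by a function that lies both in the Newton-Sobolev and in
the Hajłasz-Sobolev space. -/
theorem IsDoubling.exists_regularization [BorelSpace X] (hμ : IsDoubling μ)
    (hΩ : IsUniformDomain Ω) (hne : Ωᶜ.Nonempty) {lam : ℝ} (hlam : 1 ≤ lam) (C : ℝ≥0) :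
    ∃ D : ℝ≥0, ∀ u : X → ℝ, Measurable u → Integrable u μ → ∃ v : X → ℝ,
      ∀ g : X → ℝ≥0∞, Measurable g → ∫⁻ x in Ω, g x ∂μ < ⊤ → PoincareInside μ Ω lam C u g →
      AEMeasurable v (μ.restrict Ω) ∧
      newtonNorm μ Ω (fun x => (v x : EReal)) ≤
        D * (∫⁻ x in Ω, ENNReal.ofReal |u x| ∂μ + ∫⁻ x in Ω, g x ∂μ) ∧
      hajlaszNorm μ Ω (fun x => (v x : EReal)) ≤
        D * (∫⁻ x in Ω, ENNReal.ofReal |u x| ∂μ + ∫⁻ x in Ω, g x ∂μ) ∧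
      ∀ x ∉ Ω, ∀ r : ℝ, 0 < r →
        ∫⁻ z in Metric.ball x r ∩ Ω, ENNReal.ofReal |u z - v z| ∂μ ≤
          D * ENNReal.ofReal r * ∫⁻ z in Metric.ball x (4 * r) ∩ Ω, g z ∂μ := by
  have := hμ.sigmaFinite
  have := hμ.secondCountableTopology
  have hΩo := hΩ.1
  have hΩm := hΩo.measurableSet
  have hl8 : 1 / (8 * lam) ≤ 1 / 8 := by
    gcongr
    linarith
  have hl32 : 1 / (32 * lam) ≤ 1 / 32 := by
    gcongr
    linarith
  have hb : 0 < 1 / (32 * lam) := by positivity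
  obtain ⟨D, hD⟩ := hμ.exists_mollify_estimates hΩo hne hlam C
  obtain ⟨E1, hE1⟩ := hμ.exists_lintegral_scaledAvg_le hΩo hne (a := 1 / (8 * lam))
    (by positivity) (by linarith)
  obtain ⟨E2, hE2⟩ := hμ.exists_lintegral_scaledAvg_le hΩo hne (a := 1 / 8) (by norm_num)
    (by norm_num)
  obtain ⟨E3, hE3⟩ := hμ.exists_hajlasz_gradient hΩ hne hb D
  obtain ⟨E4, hE4⟩ := hμ.exists_lintegral_abs_sub_mollify_le hΩo hne hb (by linarith) D
  refine ⟨D * E1 + D * E2 + E3 + E4, fun u hum hu =>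
    ⟨mollify μ (mollifyScale Ω lam) u, fun g hg hgt hug => ?_⟩⟩
  set v := mollify μ (mollifyScale Ω lam) u with hv
  have hest := hD u hu g hug
  have hvar : VariesLike μ Ω (1 / (32 * lam)) D v g := fun z hz => (hest z hz).1
  have hcont : ContinuousOn v Ω :=
    (hμ.locallyLipschitzOn_of_variesLike hΩo hne hb hvar hgt).continuousOn
  have hL1 : ∫⁻ x in Ω, ENNReal.ofReal |v x| ∂μ ≤
      D * E1 * ∫⁻ x in Ω, ENNReal.ofReal |u x| ∂μ := by
    calc _ ≤ ∫⁻ x in Ω, D * scaledAvg μ Ω (1 / (8 * lam)) (fun w => ENNReal.ofReal |u w|) x ∂μ :=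
          setLIntegral_mono' hΩm fun z hz => (hest z hz).2.2
      _ = D * ∫⁻ x in Ω, scaledAvg μ Ω (1 / (8 * lam)) (fun w => ENNReal.ofReal |u w|) x ∂μ :=
          lintegral_const_mul' _ _ ENNReal.coe_ne_top
      _ ≤ D * (E1 * ∫⁻ x in Ω, ENNReal.ofReal |u x| ∂μ) := by
          gcongr
          exact hE1 _ hum.abs.ennreal_ofReal Ω subset_rfl Ω hΩm hΩm
            (scaledBall_subset_self hΩo hne (by linarith))
      _ = _ := by ring
  refine ⟨hcont.aemeasurable hΩm, ?_, ?_, ?_⟩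
  · refine (newtonNorm_coe_le ((measurable_scaledAvg (1 / 8) hg).const_mul D).aemeasurable
      fun γ hγ => hμ.ofReal_abs_sub_le_integral_of_variesLike hΩo hne hb hvar hgt hγ).trans ?_
    rw [lintegral_const_mul' _ _ ENNReal.coe_ne_top, mul_add]
    refine add_le_add (hL1.trans ?_) ((mul_le_mul_right (hE2 g hg Ω subset_rfl Ω hΩm hΩm
      (scaledBall_subset_self hΩo hne (by norm_num))) _).trans ?_)
    · gcongr
      rw [← ENNReal.coe_mul, ENNReal.coe_le_coe, add_assoc, add_assoc]
      exact le_self_add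
    · rw [← mul_assoc, ← ENNReal.coe_mul]
      gcongr
      exact (le_add_self.trans le_self_add).trans le_self_add
  · obtain ⟨h, hhm, hh, hhi⟩ := hE3 v g hvar hg hgt
    refine (hajlaszNorm_coe_le hhm.aemeasurable hh).trans ?_
    rw [mul_add]
    refine add_le_add (hL1.trans ?_) (hhi.trans ?_)
    · gcongr
      rw [← ENNReal.coe_mul, ENNReal.coe_le_coe, add_assoc, add_assoc]
      exact le_self_add
    · gcongr
      exact le_add_self.trans le_self_add
  · intro x hx r hr
    refine (hE4 u v g hum hcont hg hvar (fun z hz => ?_) x hx r hr).trans ?_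
    · have h := (hest z hz).2.1
      rwa [show 1 / (16 * lam) = 2 * (1 / (32 * lam)) by field_simp; norm_num] at h
    · gcongr
      exact le_add_self

end Approximation

/-! ### From gradients to Poincaré inequalities inside the domain. -/

section Representatives

/-- An arbitrary measurable representative is not enough: curve integrals and pointwise Hajłasz
inequalities see null sets. Setting the function to `∞` on a measurable null set keeps it a majorant
everywhere. -/
theorem exists_measurable_majorant {X : Type*} [MeasurableSpace X] {μ : Measure X}
    {g : X → ℝ≥0∞} (hg : AEMeasurable g μ) :
    ∃ g' : X → ℝ≥0∞, Measurable g' ∧ (∀ x, g x ≤ g' x) ∧ g' =ᵐ[μ] g := by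
  obtain ⟨N, hsub, hN, hN0⟩ := exists_measurable_superset_of_null (ae_iff.1 hg.ae_eq_mk)
  refine ⟨fun x => hg.mk g x + N.indicator (fun _ => ⊤) x,
    hg.measurable_mk.add (measurable_const.indicator hN), fun x => ?_, ?_⟩
  · by_cases hx : x ∈ N
    · simp [hx]
    · have : g x = hg.mk g x := by_contra fun h => hx (hsub h)
      simp [hx, this]
  · have h0 : ∀ᵐ x ∂μ, x ∉ N := by simpa [ae_iff] using hN0
    filter_upwards [h0] with x hx
    have : g x = hg.mk g x := by_contra fun h => hx (hsub h)
    simp [hx, this]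

theorem coe_toReal_of_abs_ne_top {a : EReal} (h : a.abs ≠ ⊤) : (a.toReal : EReal) = a := by
  induction a <;> simp_all

theorem measurable_ereal_abs : Measurable EReal.abs :=
  EReal.measurable_of_measurable_real (by simp_rw [EReal.abs_def]; fun_prop)

/-- Extension by zero outside `Ω` makes the representative integrable on all of `X`, as the
mollifier requires. -/
theorem exists_real_representative {X : Type*} [MeasurableSpace X] {μ : Measure X} {Ω : Set X}
    (hΩ : MeasurableSet Ω) {u : X → EReal} (hu : AEMeasurable u (μ.restrict Ω))
    (hfin : ∫⁻ x in Ω, (u x).abs ∂μ < ⊤) :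
    ∃ u' : X → ℝ, Measurable u' ∧ Integrable u' μ ∧ ∀ᵐ x ∂(μ.restrict Ω), u x = (u' x : EReal) := by
  have hm : Measurable fun x => (hu.mk u x).toReal := hu.measurable_mk.ereal_toReal
  have habs : AEMeasurable (fun x => (u x).abs) (μ.restrict Ω) :=
    measurable_ereal_abs.comp_aemeasurable hu
  have hlt := ae_lt_top' habs hfin.ne
  have heq : ∀ᵐ x ∂(μ.restrict Ω), u x = ((hu.mk u x).toReal : EReal) := by
    filter_upwards [hu.ae_eq_mk, hlt] with x h1 h2
    rw [← h1, coe_toReal_of_abs_ne_top h2.ne]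
  refine ⟨Ω.indicator fun x => (hu.mk u x).toReal, hm.indicator hΩ, ?_, ?_⟩
  · rw [integrable_indicator_iff hΩ]
    refine ⟨hm.aestronglyMeasurable, ?_⟩
    rw [hasFiniteIntegral_iff_norm]
    refine lt_of_le_of_lt (lintegral_mono_ae ?_) hfin
    filter_upwards [heq] with x hx
    rw [hx, EReal.abs_def, Real.norm_eq_abs]
  · filter_upwards [heq, ae_restrict_mem hΩ] with x hx hxΩ
    rw [hx, indicator_of_mem hxΩ]

variable {X : Type*} [MetricSpace X]

/-- By continuity a curve leaving a closed set stays outside it for a set of parameters of positive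
length. A gradient that is infinite off `K` therefore has to be tested only on curves in `K`. -/
theorem Curve.integral_eq_top_of_not_liesIn (γ : Curve X) {K : Set X} (hK : IsClosed K)
    (hγ : ¬ γ.LiesIn K) {G : X → ℝ≥0∞} (hG : ∀ x ∉ K, G x = ⊤) : γ.integral G = ⊤ := by
  simp only [Curve.LiesIn, not_forall] at hγ
  obtain ⟨t, ht, htK⟩ := hγ
  have h1 : γ.toFun ⁻¹' Kᶜ ∈ 𝓝[Icc 0 γ.len] t :=
    γ.lipschitzOnWith.continuousOn t ht (hK.isOpen_compl.mem_nhds htK)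
  obtain ⟨W, hWo, htW, hW⟩ := mem_nhdsWithin.1 h1
  have h2 : (W ∩ Ioo 0 γ.len).Nonempty := by
    rw [← closure_Ioo γ.len_pos.ne] at ht
    exact mem_closure_iff.1 ht W hWo htW
  have h3 : 0 < volume (W ∩ Ioo 0 γ.len) := (hWo.inter isOpen_Ioo).measure_pos _ h2
  refine top_le_iff.1 ?_
  calc (⊤ : ℝ≥0∞) = ∫⁻ _ in W ∩ Ioo 0 γ.len, ⊤ := by
        rw [setLIntegral_const, ENNReal.top_mul h3.ne']
    _ ≤ ∫⁻ s in W ∩ Ioo 0 γ.len, G (γ.toFun s) :=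
        setLIntegral_mono' (hWo.measurableSet.inter measurableSet_Ioo) fun s hs =>
          (hG _ (hW ⟨hs.1, Ioo_subset_Icc_self hs.2⟩)).ge
    _ ≤ _ := lintegral_mono_set fun s hs => Ioo_subset_Icc_self hs.2

variable [MeasurableSpace X] {μ : Measure X} {Ω : Set X}

/-- A Hajłasz gradient gives a Poincaré inequality inside `Ω`. -/
theorem IsHajlaszGradientIn.exists_poincareInside (hμ : IsDoubling μ)
    [OpensMeasurableSpace X] {u : X → EReal} {u' : X → ℝ}
    (huu : ∀ᵐ x ∂(μ.restrict Ω), u x = (u' x : EReal)) {g : X → ℝ≥0∞}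
    (hg : IsHajlaszGradientIn μ Ω u g) :
    ∃ g' : X → ℝ≥0∞, Measurable g' ∧ ∫⁻ x in Ω, g' x ∂μ = ∫⁻ x in Ω, g x ∂μ ∧
      PoincareInside μ Ω 1 4 u' g' := by
  obtain ⟨hgm, N, hNΩ, hN0, hN⟩ := hg
  obtain ⟨g', hg'm, hgg', hae⟩ := exists_measurable_majorant hgm
  refine ⟨g', hg'm, lintegral_congr_ae hae, fun z hz r hr hball => ?_⟩
  rw [one_mul] at hball ⊢
  set B := Metric.ball z r with hB
  have hBΩ : B ⊆ Ω := Metric.ball_subset_closedBall.trans hball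
  have hB0 : μ B ≠ 0 := (hμ.measure_ball_pos z hr).ne'
  have hBt : μ B ≠ ⊤ := (hμ.measure_ball_lt_top z r).ne
  have hgood : ∀ᵐ x ∂(μ.restrict B), x ∈ B ∧ x ∉ N ∧ u x = (u' x : EReal) := by
    have h1 : ∀ᵐ x ∂(μ.restrict B), u x = (u' x : EReal) :=
      ae_mono (Measure.restrict_mono hBΩ le_rfl) huu
    have h2 : ∀ᵐ x ∂(μ.restrict B), x ∉ N := by
      refine ae_restrict_of_ae ?_
      simpa [ae_iff] using hN0
    filter_upwards [h1, h2, ae_restrict_mem measurableSet_ball] with x a b c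
    exact ⟨c, b, a⟩
  -- A good point where `g'` is at most its average exists because such values are taken on a set of
  -- positive measure. With `c = u' y`, the constant `4` is `2` from the diameter of the ball times
  -- `2` from the two gradient terms.
  obtain ⟨y, ⟨hyB, hyN, hyu⟩, hy⟩ : ∃ y, (y ∈ B ∧ y ∉ N ∧ u y = (u' y : EReal)) ∧
      g' y ≤ ⨍⁻ x in B, g' x ∂μ := by
    have hpos := measure_le_setLAverage_pos hB0 hBt hg'm.aemeasurable
    by_contra! hcon
    refine hpos.ne' ?_
    rw [ae_restrict_iff' measurableSet_ball] at hgood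
    refine measure_mono_null (fun x hx => ?_) (ae_iff.1 hgood)
    exact fun hgx => absurd hx.2 (not_le.2 (hcon x (hgx hx.1)))
  refine ⟨u' y, ?_⟩
  calc ∫⁻ x in B, ENNReal.ofReal |u' x - u' y| ∂μ
      ≤ ∫⁻ x in B, ENNReal.ofReal (2 * r) * (g' x + g' y) ∂μ := by
        refine lintegral_mono_ae ?_
        filter_upwards [hgood] with x hx
        have h1 := hN x ⟨hBΩ hx.1, hx.2.1⟩ y ⟨hBΩ hyB, hyN⟩
        rw [hx.2.2, hyu, abs_coe_sub_coe] at h1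
        refine h1.trans ?_
        gcongr
        · rw [edist_dist]
          refine ENNReal.ofReal_le_ofReal ?_
          have h2 := dist_triangle_right x y z
          have h3 := Metric.mem_ball.1 hx.1
          have h4 := Metric.mem_ball.1 hyB
          linarith
        · exact hgg' x
        · exact hgg' y
    _ = ENNReal.ofReal (2 * r) * (∫⁻ x in B, g' x ∂μ + g' y * μ B) := by
        rw [lintegral_const_mul' _ _ ENNReal.ofReal_ne_top,
          lintegral_add_right _ measurable_const, setLIntegral_const]
    _ ≤ ENNReal.ofReal (2 * r) * (∫⁻ x in B, g' x ∂μ + (⨍⁻ x in B, g' x ∂μ) * μ B) := by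
        gcongr
    _ = _ := by
        rw [setLAverage_eq, ENNReal.div_mul_cancel hB0 hBt, ENNReal.ofReal_mul zero_le_two,
          ENNReal.ofReal_ofNat]
        push_cast
        ring

/-- An integrable weak upper gradient in `Ω` gives, up to a small error, a Poincaré inequality
inside `Ω`. -/
theorem IsWeakUpperGradientIn.exists_poincareInside {C lam : ℝ} (hC : 0 < C) (hμ : IsDoubling μ)
    (hlam : 1 ≤ lam)
    (hP : ∀ (x : X) (r : ℝ), 0 < r → ∀ u : X → ℝ, LocallyIntegrable u μ →
      ∀ g : X → ℝ≥0∞, IsUpperGradient (fun y => (u y : EReal)) g →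
        ⨍⁻ y in Metric.ball x r, ENNReal.ofReal |u y - ⨍ z in Metric.ball x r, u z ∂μ| ∂μ
          ≤ ENNReal.ofReal (C * r) * ⨍⁻ y in Metric.ball x (lam * r), g y ∂μ)
    [OpensMeasurableSpace X] {u : X → EReal} {u' : X → ℝ} (hu' : Integrable u' μ)
    (huu : ∀ᵐ x ∂(μ.restrict Ω), u x = (u' x : EReal)) {g : X → ℝ≥0∞}
    (hg : IsWeakUpperGradientIn μ Ω u g) {ε : ℝ≥0∞} (hε : ε ≠ 0) :
    ∃ g' : X → ℝ≥0∞, Measurable g' ∧ ∫⁻ x in Ω, g' x ∂μ ≤ ∫⁻ x in Ω, g x ∂μ + ε ∧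
      PoincareInside μ Ω lam C.toNNReal u' g' := by
  obtain ⟨hgm, ρ, hρm, hρt, hρ⟩ := hg
  obtain ⟨g₁, hg₁m, hgg₁, hae⟩ := exists_measurable_majorant hgm
  obtain ⟨δ, hδ0, hδ⟩ : ∃ δ : ℝ≥0, 0 < δ ∧ δ * ∫⁻ x, ρ x ∂μ < ε :=
    ENNReal.exists_nnreal_pos_mul_lt hρt.ne hε
  -- The term `δ * ρ` has infinite integral along every exceptional curve, so the upper gradient
  -- inequality holds along all curves in `Ω` at an extra cost of at most `ε`.
  set g' : X → ℝ≥0∞ := fun x => g₁ x + δ * ρ x with hg'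
  have hg'm : Measurable g' := hg₁m.add (hρm.const_mul _)
  refine ⟨g', hg'm, ?_, fun z hz r hr hball => ?_⟩
  · rw [hg', lintegral_add_left hg₁m, lintegral_congr_ae hae, lintegral_const_mul _ hρm]
    gcongr
    refine le_trans ?_ hδ.le
    gcongr
    exact Measure.restrict_le_self
  have hcurve : ∀ γ : Curve X, γ.LiesIn Ω →
      ENNReal.ofReal |(u (γ.toFun 0)).toReal - (u (γ.toFun γ.len)).toReal| ≤ γ.integral g' := by
    intro γ hγ
    by_cases h : γ.UpperGradientIneq u g
    · have h1 : γ.integral g ≤ γ.integral g' :=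
        lintegral_mono fun t => (hgg₁ _).trans le_self_add
      refine le_trans ?_ (h.trans h1)
      by_cases h2 : u (γ.toFun 0) = ⊤ ∨ u (γ.toFun 0) = ⊥ ∨ u (γ.toFun γ.len) = ⊤ ∨
          u (γ.toFun γ.len) = ⊥
      · rw [abs_sub_eq_top h2]
        exact le_top
      · push Not at h2
        rw [← abs_coe_sub_coe, EReal.coe_toReal h2.1 h2.2.1, EReal.coe_toReal h2.2.2.1 h2.2.2.2]
    · have h1 : γ.integral g' = ⊤ := by
        refine top_le_iff.1 ?_
        calc (⊤ : ℝ≥0∞) = δ * γ.integral ρ := by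
              rw [hρ γ hγ h, ENNReal.mul_top (by exact_mod_cast hδ0.ne')]
          _ = ∫⁻ t in Icc 0 γ.len, δ * ρ (γ.toFun t) :=
              (lintegral_const_mul' _ _ ENNReal.coe_ne_top).symm
          _ ≤ _ := lintegral_mono fun t => le_add_self
      rw [h1]
      exact le_top
  classical
  set K := Metric.closedBall z (lam * r) with hK
  have hKm : MeasurableSet K := measurableSet_closedBall
  -- The Poincaré hypothesis concerns functions on all of `X`, so `u` is cut off outside a closed
  -- ball and the gradient made infinite there, which does not affect the averages in question. The
  -- values of `u` itself are kept, because `u'` agrees with it only almost everywhere and the curve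
  -- inequality is pointwise.
  set U : X → ℝ := K.indicator fun x => (u x).toReal with hU
  set G : X → ℝ≥0∞ := fun x => if x ∈ K then g' x else ⊤ with hG
  have hUae : U =ᵐ[μ] K.indicator u' := by
    have h1 : ∀ᵐ x ∂(μ.restrict K), u x = (u' x : EReal) :=
      ae_mono (Measure.restrict_mono hball le_rfl) huu
    rw [ae_restrict_iff' hKm] at h1
    filter_upwards [h1] with x hx
    by_cases hxK : x ∈ K
    · simp [hU, hxK, hx hxK]
    · simp [hU, hxK]
  have hUint : LocallyIntegrable U μ :=
    ((hu'.indicator hKm).congr hUae.symm).locallyIntegrable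
  have hUG : IsUpperGradient (fun y => (U y : EReal)) G := by
    refine ⟨Measurable.ite hKm hg'm measurable_const, fun γ => ?_⟩
    rw [Curve.UpperGradientIneq, abs_coe_sub_coe]
    by_cases hγ : γ.LiesIn K
    · have e : γ.integral G = γ.integral g' := by
        refine setLIntegral_congr_fun measurableSet_Icc fun t ht => ?_
        simp [hG, hγ t ht]
      rw [e, hU, indicator_of_mem (hγ 0 (left_mem_Icc.2 γ.len_pos.le)),
        indicator_of_mem (hγ _ (right_mem_Icc.2 γ.len_pos.le))]
      exact hcurve γ fun t ht => hball (hγ t ht)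
    · rw [γ.integral_eq_top_of_not_liesIn Metric.isClosed_closedBall hγ
        (fun x hx => if_neg hx)]
      exact le_top
  have hmain := hP z r hr U hUint G hUG
  set c := ⨍ x in Metric.ball z r, U x ∂μ with hc
  refine ⟨c, ?_⟩
  have hrl : r ≤ lam * r := le_mul_of_one_le_left hr.le hlam
  have hrl0 : 0 < lam * r := hr.trans_le hrl
  have hB0 : μ (Metric.ball z r) ≠ 0 := (hμ.measure_ball_pos z hr).ne'
  have hBt : μ (Metric.ball z r) ≠ ⊤ := (hμ.measure_ball_lt_top z r).ne
  have hL0 : μ (Metric.ball z (lam * r)) ≠ 0 := (hμ.measure_ball_pos z hrl0).ne'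
  have hLt : μ (Metric.ball z (lam * r)) ≠ ⊤ := (hμ.measure_ball_lt_top z _).ne
  have e1 : ∫⁻ y in Metric.ball z r, ENNReal.ofReal |U y - c| ∂μ =
      ∫⁻ y in Metric.ball z r, ENNReal.ofReal |u' y - c| ∂μ := by
    refine lintegral_congr_ae ?_
    filter_upwards [ae_restrict_of_ae hUae, ae_restrict_mem measurableSet_ball] with y hy hyB
    have : y ∈ K := Metric.ball_subset_closedBall (Metric.ball_subset_ball hrl hyB)
    rw [hy, indicator_of_mem this]
  have e2 : ∫⁻ y in Metric.ball z (lam * r), G y ∂μ =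
      ∫⁻ y in Metric.ball z (lam * r), g' y ∂μ := by
    refine setLIntegral_congr_fun measurableSet_ball fun y hy => ?_
    have : y ∈ K := Metric.ball_subset_closedBall hy
    simp [hG, this]
  rw [setLAverage_eq, setLAverage_eq, e1, e2, ENNReal.div_le_iff hB0 hBt] at hmain
  refine hmain.trans ?_
  rw [mul_assoc, ENNReal.ofReal_mul hC.le]
  have e3 : ENNReal.ofReal C = (C.toNNReal : ℝ≥0∞) := rfl
  rw [e3]
  gcongr
  calc _ ≤ (∫⁻ y in Metric.ball z (lam * r), g' y ∂μ) / μ (Metric.ball z (lam * r)) *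
        μ (Metric.ball z (lam * r)) := by
        gcongr
    _ = _ := ENNReal.div_mul_cancel hL0 hLt

/-- Two functions on `Ω` whose difference is small in the mean near the boundary. -/
def BoundaryClose (μ : Measure X) (Ω : Set X) (u v : X → EReal) : Prop :=
  ∃ g : X → ℝ≥0∞, Measurable g ∧ ∫⁻ x in Ω, g x ∂μ < ⊤ ∧ ∀ x ∉ Ω, ∀ r : ℝ, 0 < r →
    ∫⁻ z in Metric.ball x r ∩ Ω, (u z - v z).abs ∂μ ≤
      ENNReal.ofReal r * ∫⁻ z in Metric.ball x (4 * r) ∩ Ω, g z ∂μ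

/-- If all gradients of a certain kind give Poincaré inequalities inside a uniform domain, then
the regularization is bounded with respect to the norm defined by these gradients. -/
theorem IsDoubling.exists_boundaryClose [BorelSpace X] (hμ : IsDoubling μ)
    (hΩ : IsUniformDomain Ω) (hne : Ωᶜ.Nonempty) {lam : ℝ} (hlam : 1 ≤ lam) (C : ℝ≥0) :
    ∃ D : ℝ≥0, ∀ (P : (X → ℝ≥0∞) → Prop) (u : X → EReal), AEMeasurable u (μ.restrict Ω) →
      (∀ u' : X → ℝ, Integrable u' μ → (∀ᵐ x ∂(μ.restrict Ω), u x = (u' x : EReal)) →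
        ∀ g, P g → ∀ ε : ℝ≥0∞, ε ≠ 0 → ∃ g' : X → ℝ≥0∞, Measurable g' ∧
          ∫⁻ x in Ω, g' x ∂μ ≤ ∫⁻ x in Ω, g x ∂μ + ε ∧ PoincareInside μ Ω lam C u' g') →
      ∀ n : ℝ≥0∞, n = ∫⁻ x in Ω, (u x).abs ∂μ + ⨅ (g) (_ : P g), ∫⁻ x in Ω, g x ∂μ → n < ⊤ →
      ∃ v ∈ newtonSpace μ Ω ∩ hajlaszSpace μ Ω, newtonNorm μ Ω v ≤ D * n ∧
        hajlaszNorm μ Ω v ≤ D * n ∧ BoundaryClose μ Ω u v := by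
  obtain ⟨D, hD⟩ := hμ.exists_regularization hΩ hne hlam C
  refine ⟨D + 1, fun P u hu hP n hn hnt => ?_⟩
  have hΩm := hΩ.1.measurableSet
  have hut : ∫⁻ x in Ω, (u x).abs ∂μ < ⊤ := by
    refine lt_of_le_of_lt ?_ hnt
    rw [hn]
    exact le_self_add
  obtain ⟨u', hu'm, hu'i, huu⟩ := exists_real_representative hΩm hu hut
  have habs : ∫⁻ x in Ω, ENNReal.ofReal |u' x| ∂μ = ∫⁻ x in Ω, (u x).abs ∂μ := by
    refine lintegral_congr_ae ?_
    filter_upwards [huu] with x hx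
    rw [hx, EReal.abs_def]
  -- The regularization is fixed before any gradient, so its norm estimates can be passed to the
  -- infimum over gradients.
  obtain ⟨v, hv⟩ := hD u' hu'm hu'i
  have happrox : ∀ ε : ℝ≥0, 0 < ε → ∃ g : X → ℝ≥0∞, Measurable g ∧
      ∫⁻ x in Ω, ENNReal.ofReal |u' x| ∂μ + ∫⁻ x in Ω, g x ∂μ ≤ n + ε ∧
      ∫⁻ x in Ω, g x ∂μ < ⊤ ∧ PoincareInside μ Ω lam C u' g := by
    intro ε hε
    have hI : (⨅ (g) (_ : P g), ∫⁻ x in Ω, g x ∂μ) < ⊤ := by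
      refine lt_of_le_of_lt ?_ hnt
      rw [hn]
      exact le_add_self
    -- Half of `ε` pays for a nearly optimal gradient, half for the loss allowed in `hP`.
    have hε2 : ((ε / 2 : ℝ≥0) : ℝ≥0∞) ≠ 0 := by
      have := half_pos hε
      exact_mod_cast this.ne'
    have hlt := ENNReal.lt_add_right hI.ne hε2
    simp only [iInf_lt_iff] at hlt
    obtain ⟨g, hPg, hg⟩ := hlt
    obtain ⟨g', hg'm, hg', hpi⟩ := hP u' hu'i huu g hPg _ hε2
    have hle : ∫⁻ x in Ω, ENNReal.ofReal |u' x| ∂μ + ∫⁻ x in Ω, g' x ∂μ ≤ n + ε := by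
      rw [habs, hn]
      calc _ ≤ ∫⁻ x in Ω, (u x).abs ∂μ + (((⨅ (g) (_ : P g), ∫⁻ x in Ω, g x ∂μ) +
            (ε / 2 : ℝ≥0)) + (ε / 2 : ℝ≥0)) := by
            gcongr
            exact hg'.trans (add_le_add_left hg.le _)
        _ = _ := by
            rw [add_assoc, ← ENNReal.coe_add, add_halves, ← add_assoc]
    refine ⟨g', hg'm, hle, ?_, hpi⟩
    exact lt_of_le_of_lt (le_add_self.trans hle) (ENNReal.add_lt_top.2 ⟨hnt, ENNReal.coe_lt_top⟩)
  have hbound : ∀ N : ℝ≥0∞, (∀ g : X → ℝ≥0∞, Measurable g → ∫⁻ x in Ω, g x ∂μ < ⊤ →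
      PoincareInside μ Ω lam C u' g →
      N ≤ D * (∫⁻ x in Ω, ENNReal.ofReal |u' x| ∂μ + ∫⁻ x in Ω, g x ∂μ)) →
      N ≤ ((D + 1 : ℝ≥0) : ℝ≥0∞) * n := by
    intro N hN
    have hD0 : ((D + 1 : ℝ≥0) : ℝ≥0∞) ≠ 0 := by positivity
    rw [mul_comm, ← ENNReal.div_le_iff hD0 ENNReal.coe_ne_top]
    refine ENNReal.le_of_forall_pos_le_add fun ε hε _ => ?_
    obtain ⟨g, hgm, hle, hgt, hpi⟩ := happrox ε hε
    rw [ENNReal.div_le_iff hD0 ENNReal.coe_ne_top, mul_comm]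
    refine (hN g hgm hgt hpi).trans ?_
    gcongr
    exact le_self_add
  obtain ⟨g, hgm, hle, hgt, hpi⟩ := happrox 1 one_pos
  obtain ⟨hvm, -, -, hclose⟩ := hv g hgm hgt hpi
  have hn1 := hbound _ fun g hgm hgt hpi => (hv g hgm hgt hpi).2.1
  have hn2 := hbound _ fun g hgm hgt hpi => (hv g hgm hgt hpi).2.2.1
  have hvm' : AEMeasurable (fun x => (v x : EReal)) (μ.restrict Ω) :=
    measurable_coe_real_ereal.comp_aemeasurable hvm
  have hfin : ((D + 1 : ℝ≥0) : ℝ≥0∞) * n < ⊤ := ENNReal.mul_lt_top ENNReal.coe_lt_top hnt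
  refine ⟨fun x => (v x : EReal), ⟨⟨hvm', hn1.trans_lt hfin⟩, ⟨hvm', hn2.trans_lt hfin⟩⟩, hn1, hn2,
    fun x => D * g x, hgm.const_mul _, ?_, fun x hx r hr => ?_⟩
  · rw [lintegral_const_mul' _ _ ENNReal.coe_ne_top]
    exact ENNReal.mul_lt_top ENNReal.coe_lt_top hgt
  · rw [lintegral_const_mul' _ _ ENNReal.coe_ne_top]
    calc _ = ∫⁻ z in Metric.ball x r ∩ Ω, ENNReal.ofReal |u' z - v z| ∂μ := by
          refine lintegral_congr_ae ?_
          filter_upwards [ae_mono (Measure.restrict_mono inter_subset_right le_rfl) huu] with z hz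
          rw [hz, abs_coe_sub_coe]
      _ ≤ D * ENNReal.ofReal r * ∫⁻ z in Metric.ball x (4 * r) ∩ Ω, g z ∂μ := hclose x hx r hr
      _ = _ := by ring

theorem IsDoubling.exists_boundaryClose_of_newtonSpace [BorelSpace X] (hμ : IsDoubling μ)
    (hP : SupportsPoincare μ) (hΩ : IsUniformDomain Ω) (hne : Ωᶜ.Nonempty) :
    ∃ D : ℝ≥0, ∀ u ∈ newtonSpace μ Ω, ∃ v ∈ newtonSpace μ Ω ∩ hajlaszSpace μ Ω,
      hajlaszNorm μ Ω v ≤ D * newtonNorm μ Ω u ∧ BoundaryClose μ Ω u v := by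
  obtain ⟨C, hC, lam, hlam, hP⟩ := hP
  obtain ⟨D, hD⟩ := hμ.exists_boundaryClose hΩ hne hlam C.toNNReal
  refine ⟨D, fun u hu => ?_⟩
  obtain ⟨v, hv, -, h1, h2⟩ := hD (IsWeakUpperGradientIn μ Ω u) u hu.1
    (fun u' hu' huu g hg ε hε => hg.exists_poincareInside hC hμ hlam hP hu' huu hε) _ rfl hu.2
  exact ⟨v, hv, h1, h2⟩

theorem IsDoubling.exists_boundaryClose_of_hajlaszSpace [BorelSpace X] (hμ : IsDoubling μ)
    (hΩ : IsUniformDomain Ω) (hne : Ωᶜ.Nonempty) :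
    ∃ D : ℝ≥0, ∀ u ∈ hajlaszSpace μ Ω, ∃ v ∈ newtonSpace μ Ω ∩ hajlaszSpace μ Ω,
      newtonNorm μ Ω v ≤ D * hajlaszNorm μ Ω u ∧ BoundaryClose μ Ω u v := by
  obtain ⟨D, hD⟩ := hμ.exists_boundaryClose hΩ hne le_rfl 4
  refine ⟨D, fun u hu => ?_⟩
  obtain ⟨v, hv, h1, -, h2⟩ := hD (IsHajlaszGradientIn μ Ω u) u hu.1
    (fun u' hu' huu g hg ε hε => by
      obtain ⟨g', a, b, c⟩ := hg.exists_poincareInside hμ huu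
      exact ⟨g', a, b.le.trans le_self_add, c⟩) _ rfl hu.2
  exact ⟨v, hv, h1, h2⟩

end Representatives

/-! ### A function without traces on a set of positive codimension one density. -/

section Exceptional

/-- The cutoff function that is `1` on `B(b, 5r)` and vanishes outside `B(b, 10r)`. -/
noncomputable def cutoff {X : Type*} [MetricSpace X] (b : X) (r : ℝ) (x : X) : ℝ :=
  max 0 (min 1 (2 - dist x b / (5 * r)))

/-- A Lipschitz gradient of `cutoff`. -/
noncomputable def cutoffGrad {X : Type*} [MetricSpace X] (b : X) (r : ℝ) (x : X) : ℝ≥0∞ :=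
  (Metric.ball b (20 * r)).indicator (fun _ => (ENNReal.ofReal r)⁻¹) x

section Cutoff

variable {X : Type*} [MetricSpace X] {b : X} {r : ℝ}

theorem cutoff_nonneg (x : X) : 0 ≤ cutoff b r x := le_max_left _ _

theorem cutoff_le_one (x : X) : cutoff b r x ≤ 1 := max_le zero_le_one (min_le_left _ _)

theorem cutoff_eq_one (hr : 0 < r) {x : X} (hx : x ∈ Metric.ball b (5 * r)) :
    cutoff b r x = 1 := by
  have h : dist x b / (5 * r) ≤ 1 := (div_le_one (by positivity)).2 (Metric.mem_ball.1 hx).le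
  rw [cutoff, min_eq_left (by linarith), max_eq_right zero_le_one]

theorem cutoff_eq_zero (hr : 0 < r) {x : X} (hx : 10 * r ≤ dist x b) : cutoff b r x = 0 := by
  have h : 2 ≤ dist x b / (5 * r) := (le_div_iff₀ (by positivity)).2 (by linarith)
  exact max_eq_left ((min_le_right _ _).trans (by linarith))

theorem abs_cutoff_sub_le (hr : 0 < r) (x y : X) :
    |cutoff b r x - cutoff b r y| ≤ r⁻¹ * dist x y := by
  have h1 : |cutoff b r x - cutoff b r y| ≤
      |(2 - dist x b / (5 * r)) - (2 - dist y b / (5 * r))| := by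
    refine (abs_max_sub_max_le_max _ _ _ _).trans ?_
    refine max_le (by simp) ((abs_min_sub_min_le_max _ _ _ _).trans (max_le (by simp) le_rfl))
  refine h1.trans ?_
  rw [show (2 - dist x b / (5 * r)) - (2 - dist y b / (5 * r)) =
    (dist y b - dist x b) / (5 * r) by ring, abs_div, abs_of_pos (by positivity : 0 < 5 * r),
    inv_mul_eq_div, dist_comm x y]
  exact div_le_div₀ dist_nonneg (abs_dist_sub_le _ _ _) hr (by linarith)

theorem locallyLipschitzOn_cutoff (hr : 0 < r) : LocallyLipschitzOn univ (cutoff b r) := by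
  have : LipschitzWith r⁻¹.toNNReal (cutoff b r) := LipschitzWith.of_dist_le_mul fun x y => by
    rw [Real.dist_eq, Real.coe_toNNReal _ (by positivity)]
    exact abs_cutoff_sub_le hr x y
  exact this.locallyLipschitz.locallyLipschitzOn

theorem ofReal_abs_cutoff_sub_le (hr : 0 < r) (x y : X) :
    ENNReal.ofReal |cutoff b r x - cutoff b r y| ≤ (ENNReal.ofReal r)⁻¹ * edist x y := by
  refine (ENNReal.ofReal_le_ofReal (abs_cutoff_sub_le hr x y)).trans (le_of_eq ?_)
  rw [ENNReal.ofReal_mul (by positivity), ENNReal.ofReal_inv_of_pos hr, edist_dist]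

theorem ofReal_cutoff_le_add (hr : 0 < r) (x y : X) :
    ENNReal.ofReal (cutoff b r x) ≤ ENNReal.ofReal (cutoff b r y) +
      edist x y * (cutoffGrad b r x + cutoffGrad b r y) := by
  by_cases hx : x ∈ Metric.ball b (20 * r)
  · calc _ ≤ ENNReal.ofReal (cutoff b r y + |cutoff b r x - cutoff b r y|) :=
          ENNReal.ofReal_le_ofReal (by linarith [le_abs_self (cutoff b r x - cutoff b r y)])
      _ ≤ ENNReal.ofReal (cutoff b r y) + (ENNReal.ofReal r)⁻¹ * edist x y := by
          rw [ENNReal.ofReal_add (cutoff_nonneg y) (abs_nonneg _)]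
          gcongr
          exact ofReal_abs_cutoff_sub_le hr x y
      _ ≤ _ := by
          rw [mul_comm _ (edist x y), cutoffGrad, indicator_of_mem hx]
          gcongr
          exact le_self_add
  · rw [Metric.mem_ball, not_lt] at hx
    rw [cutoff_eq_zero hr (by linarith), ENNReal.ofReal_zero]
    exact zero_le

/-- For radii at most `1` one summability condition on gradients thus also gives integrability of
the sum of cutoffs. -/
theorem ofReal_cutoff_le_cutoffGrad (hr : 0 < r) (hr1 : r ≤ 1) (x : X) :
    ENNReal.ofReal (cutoff b r x) ≤ cutoffGrad b r x := by
  by_cases hx : x ∈ Metric.ball b (20 * r)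
  · rw [cutoffGrad, indicator_of_mem hx]
    refine (ENNReal.ofReal_le_one.2 (cutoff_le_one x)).trans ?_
    exact ENNReal.one_le_inv.2 (ENNReal.ofReal_le_one.2 hr1)
  · rw [Metric.mem_ball, not_lt] at hx
    rw [cutoff_eq_zero hr (by linarith), ENNReal.ofReal_zero]
    exact zero_le

theorem Curve.ofReal_abs_cutoff_sub_le (γ : Curve X) (hr : 0 < r) :
    ENNReal.ofReal |cutoff b r (γ.toFun γ.len) - cutoff b r (γ.toFun 0)| ≤
      γ.integral (cutoffGrad b r) := by
  refine γ.ofReal_abs_sub_le_integral (fun _ _ => mem_univ _) (locallyLipschitzOn_cutoff hr)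
    fun z _ => ?_
  by_cases hz : z ∈ Metric.ball b (20 * r)
  · refine Eventually.of_forall fun w => ?_
    rw [cutoffGrad, indicator_of_mem hz]
    exact BoundaryTrace.ofReal_abs_cutoff_sub_le hr w z
  · rw [Metric.mem_ball, not_lt] at hz
    filter_upwards [Metric.ball_mem_nhds z hr] with w hw
    rw [Metric.mem_ball, dist_comm] at hw
    have := dist_triangle z w b
    rw [cutoff_eq_zero hr (by linarith), cutoff_eq_zero hr (by linarith)]
    simp

variable [MeasurableSpace X]

theorem Curve.lintegral_tsum [BorelSpace X] {ι : Type*} [Countable ι] (γ : Curve X) {g : ι → X → ℝ≥0∞}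
    (hg : ∀ i, Measurable (g i)) :
    γ.integral (fun x => ∑' i, g i x) = ∑' i, γ.integral (g i) := by
  have hγ : AEMeasurable γ.toFun (volume.restrict (Icc 0 γ.len)) :=
    γ.lipschitzOnWith.continuousOn.aemeasurable measurableSet_Icc
  exact MeasureTheory.lintegral_tsum fun i => (hg i).comp_aemeasurable hγ

variable [OpensMeasurableSpace X]

theorem measurable_cutoffGrad : Measurable (cutoffGrad b r) :=
  measurable_const.indicator measurableSet_ball

theorem measurable_cutoff : Measurable (cutoff b r) := by
  have : Continuous (cutoff b r) := by unfold cutoff; fun_prop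
  exact this.measurable

end Cutoff

variable {X : Type*} [MetricSpace X] [MeasurableSpace X] {μ : Measure X} {Ω : Set X}

/-- The boundary points at which the upper codimension one density of `g` exceeds `η`. -/
def densitySet (μ : Measure X) (Ω : Set X) (g : X → ℝ≥0∞) (η : ℝ≥0∞) : Set X :=
  {x ∈ frontier Ω | ∀ r₀ : ℝ, 0 < r₀ → ∃ r : ℝ, 0 < r ∧ r < r₀ ∧
    η * μ (Metric.ball x r ∩ Ω) < ENNReal.ofReal r * ∫⁻ z in Metric.ball x r ∩ Ω, g z ∂μ}

/-- The strips decrease to the empty set, since `bdist` is positive on `Ω`; continuity from above of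
the finite measure `g dμ` on `Ω` does the rest. -/
theorem exists_lintegral_near_boundary_le (hΩ : IsOpen Ω) (hne : Ωᶜ.Nonempty)
    [OpensMeasurableSpace X] {g : X → ℝ≥0∞} (hg : ∫⁻ x in Ω, g x ∂μ < ⊤) {ε : ℝ≥0∞}
    (hε : ε ≠ 0) : ∃ s : ℝ, 0 < s ∧ ∫⁻ x in Ω ∩ {z | bdist Ω z < s}, g x ∂μ ≤ ε := by
  set m := (μ.restrict Ω).withDensity g with hm
  have hAm : ∀ n : ℕ, MeasurableSet {z : X | bdist Ω z < 1 / ((n : ℝ) + 1)} :=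
    fun n => (isOpen_lt continuous_bdist continuous_const).measurableSet
  have hval : ∀ n : ℕ, m (Ω ∩ {z | bdist Ω z < 1 / ((n : ℝ) + 1)}) =
      ∫⁻ x in Ω ∩ {z | bdist Ω z < 1 / ((n : ℝ) + 1)}, g x ∂μ := by
    intro n
    rw [hm, withDensity_apply _ (hΩ.measurableSet.inter (hAm n)),
      Measure.restrict_restrict (hΩ.measurableSet.inter (hAm n)), inter_right_comm, inter_self]
  have hlim := tendsto_measure_iInter_atTop (μ := m)
    (s := fun n : ℕ => Ω ∩ {z | bdist Ω z < 1 / ((n : ℝ) + 1)})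
    (fun n => (hΩ.measurableSet.inter (hAm n)).nullMeasurableSet)
    (fun i j hij z hz => ⟨hz.1, lt_of_lt_of_le (b := 1 / ((j : ℝ) + 1)) hz.2
      (Nat.one_div_le_one_div hij)⟩)
    ⟨0, by
      rw [hval 0]
      exact ne_top_of_le_ne_top hg.ne (lintegral_mono_set inter_subset_left)⟩
  have hempty : ⋂ n : ℕ, (Ω ∩ {z | bdist Ω z < 1 / ((n : ℝ) + 1)}) = ∅ := by
    rw [eq_empty_iff_forall_notMem]
    intro z hz
    rw [mem_iInter] at hz
    obtain ⟨n, hn⟩ := exists_nat_one_div_lt (bdist_pos hΩ hne (hz 0).1)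
    exact lt_asymm hn (hz n).2
  rw [hempty, measure_empty] at hlim
  obtain ⟨n, hn⟩ := (hlim.eventually (ge_mem_nhds (pos_iff_ne_zero.2 hε))).exists
  exact ⟨1 / ((n : ℝ) + 1), by positivity, (hval n).symm.trans_le hn⟩

/-- The set `densitySet` has zero codimension one Hausdorff measure. -/
theorem IsDoublingOn.exists_cover_densitySet [OpensMeasurableSpace X] (hμ : IsDoubling μ)
    (hΩμ : IsDoublingOn μ Ω) (hΩ : IsOpen Ω) (hne : Ωᶜ.Nonempty) {g : X → ℝ≥0∞}
    (hg : ∫⁻ x in Ω, g x ∂μ < ⊤) {η : ℝ≥0∞} (hη : η ≠ 0) (hηt : η ≠ ⊤) {ε : ℝ≥0∞} (hε : ε ≠ 0)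
    {s : ℝ} (hs : 0 < s) :
    ∃ (T : Set X) (r : X → ℝ), T.Countable ∧ T ⊆ frontier Ω ∧ (∀ b ∈ T, 0 < r b ∧ r b ≤ s) ∧
      (∀ x ∈ densitySet μ Ω g η, ∃ b ∈ T, x ∈ Metric.ball b (5 * r b)) ∧
      ∑' b : T, ∫⁻ x in Ω, cutoffGrad (b : X) (r b) x ∂μ ≤ ε := by
  obtain ⟨D, hD1, hD⟩ := hΩμ.exists_measure_ball_inter_le 20
  have hD0 : (D : ℝ≥0∞) ≠ 0 := by
    have := zero_lt_one.trans_le hD1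
    exact_mod_cast this.ne'
  -- Each gradient integral is at most `D / η` times the integral of `g` over the corresponding
  -- disjoint ball, and these balls lie in a strip carrying at most `ε * η / D` of `g`.
  have hε' : ε * η / D ≠ 0 :=
    ENNReal.div_ne_zero.2 ⟨mul_ne_zero hε hη, ENNReal.coe_ne_top⟩
  obtain ⟨s', hs', hsmall⟩ := exists_lintegral_near_boundary_le hΩ hne hg hε'
  have hch : ∀ x : X, ∃ r : ℝ, x ∈ densitySet μ Ω g η → 0 < r ∧ r < min s s' ∧
      η * μ (Metric.ball x r ∩ Ω) < ENNReal.ofReal r * ∫⁻ z in Metric.ball x r ∩ Ω, g z ∂μ := by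
    intro x
    by_cases hx : x ∈ densitySet μ Ω g η
    · obtain ⟨r, hr⟩ := hx.2 _ (lt_min hs hs')
      exact ⟨r, fun _ => hr⟩
    · exact ⟨0, fun h => absurd h hx⟩
  choose r hr using hch
  obtain ⟨T, hTE, hTc, hTd, hT⟩ := hμ.exists_countable_disjoint_balls (densitySet μ Ω g η) r
    (min s s') (fun x hx => (hr x hx).1) (fun x hx => (hr x hx).2.1.le)
  refine ⟨T, r, hTc, fun b hb => (hTE hb).1,
    fun b hb => ⟨(hr b (hTE hb)).1, (hr b (hTE hb)).2.1.le.trans (min_le_left _ _)⟩,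
    fun x hx => ?_, ?_⟩
  · obtain ⟨b, hb, hsub⟩ := hT x hx
    exact ⟨b, hb, hsub (Metric.mem_ball_self (hr x hx).1)⟩
  have := hTc.to_subtype
  have hsum : ∑' b : T, ∫⁻ z in Metric.ball (b : X) (r b) ∩ Ω, g z ∂μ ≤ ε * η / D := by
    rw [← lintegral_biUnion hTc (fun _ _ => measurableSet_ball.inter hΩ.measurableSet)
      (hTd.mono fun b => inter_subset_left)]
    refine le_trans (lintegral_mono_set ?_) hsmall
    refine iUnion₂_subset fun b hb z hz => ⟨hz.2, ?_⟩
    have hbΩ : b ∉ Ω := fun h => (hTE hb).1.2 (hΩ.interior_eq.symm ▸ h)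
    exact (bdist_le_dist hbΩ z).trans_lt ((Metric.mem_ball.1 hz.1).trans
      ((hr b (hTE hb)).2.1.trans_le (min_le_right _ _)))
  have hterm : ∀ b : T, ∫⁻ x in Ω, cutoffGrad (b : X) (r b) x ∂μ ≤
      D * η⁻¹ * ∫⁻ z in Metric.ball (b : X) (r b) ∩ Ω, g z ∂μ := by
    intro b
    obtain ⟨h1, h2, h3⟩ := hr b (hTE b.2)
    have hbc : (b : X) ∈ closure Ω := frontier_subset_closure (hTE b.2).1
    have hr0 : ENNReal.ofReal (r b) ≠ 0 := (ENNReal.ofReal_pos.2 h1).ne'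
    unfold cutoffGrad
    rw [lintegral_indicator measurableSet_ball, Measure.restrict_restrict measurableSet_ball,
      setLIntegral_const]
    calc _ ≤ (ENNReal.ofReal (r b))⁻¹ * (D * μ (Metric.ball (b : X) (r b) ∩ Ω)) := by
          gcongr
          exact hD b hbc _ h1
      _ = (ENNReal.ofReal (r b))⁻¹ * (D * (η⁻¹ * (η * μ (Metric.ball (b : X) (r b) ∩ Ω)))) := by
          rw [← mul_assoc η⁻¹, ENNReal.inv_mul_cancel hη hηt, one_mul]
      _ ≤ (ENNReal.ofReal (r b))⁻¹ * (D * (η⁻¹ * (ENNReal.ofReal (r b) *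
          ∫⁻ z in Metric.ball (b : X) (r b) ∩ Ω, g z ∂μ))) := by gcongr
      _ = ((ENNReal.ofReal (r b))⁻¹ * ENNReal.ofReal (r b)) * (D * η⁻¹ *
          ∫⁻ z in Metric.ball (b : X) (r b) ∩ Ω, g z ∂μ) := by ring
      _ = _ := by rw [ENNReal.inv_mul_cancel hr0 ENNReal.ofReal_ne_top, one_mul]
  calc _ ≤ ∑' b : T, D * η⁻¹ * ∫⁻ z in Metric.ball (b : X) (r b) ∩ Ω, g z ∂μ :=
        ENNReal.tsum_le_tsum hterm
    _ = D * η⁻¹ * ∑' b : T, ∫⁻ z in Metric.ball (b : X) (r b) ∩ Ω, g z ∂μ :=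
        ENNReal.tsum_mul_left
    _ ≤ D * η⁻¹ * (ε * η / D) := by gcongr
    _ = ε * (η⁻¹ * η) * (D * (D : ℝ≥0∞)⁻¹) := by
        rw [div_eq_mul_inv]
        ring
    _ = ε := by
        rw [ENNReal.inv_mul_cancel hη hηt, ENNReal.mul_inv_cancel hD0 ENNReal.coe_ne_top]
        simp

theorem not_hasTraceAt_of_eventually_large (hΩμ : IsDoublingOn μ Ω) {x : X}
    (hx : x ∈ closure Ω) {W : X → ℝ} [OpensMeasurableSpace X] (hΩ : MeasurableSet Ω)
    (hW : ∀ n : ℕ, ∀ᶠ y in 𝓝 x, y ∈ Ω → (n : ℝ) ≤ W y) (a : ℝ) :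
    ¬ HasTraceAt μ Ω (fun y => (W y : EReal)) x a := by
  intro h
  obtain ⟨n, hn⟩ := exists_nat_ge (a + 1)
  obtain ⟨ρ, hρ, hball⟩ := Metric.eventually_nhds_iff_ball.1 (hW n)
  have h1 : ∀ᶠ r in 𝓝[>] (0 : ℝ), (1 : ℝ≥0∞) ≤
      ⨍⁻ y in Metric.ball x r ∩ Ω, ((W y : EReal) - (a : EReal)).abs ∂μ := by
    filter_upwards [Ioo_mem_nhdsGT hρ] with r hr
    have p1 := (hΩμ.measure_ball_inter_pos hx hr.1).ne'
    have p2 := (hΩμ.measure_ball_inter_lt_top hx hr.1).ne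
    rw [setLAverage_eq, ENNReal.le_div_iff_mul_le (.inl p1) (.inl p2), ← setLIntegral_const]
    refine setLIntegral_mono' (measurableSet_ball.inter hΩ) fun y hy => ?_
    rw [abs_coe_sub_coe]
    have h2 := hball y (Metric.ball_subset_ball hr.2.le hy.1) hy.2
    refine ENNReal.one_le_ofReal.2 (le_trans ?_ (le_abs_self _))
    linarith
  exact absurd (ge_of_tendsto h h1) (by simp)

/-- There is a function in both Sobolev spaces that has no trace at any point of a
`densitySet`. -/
theorem IsDoublingOn.exists_forall_not_hasTraceAt [BorelSpace X] (hμ : IsDoubling μ)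
    (hΩμ : IsDoublingOn μ Ω) (hΩ : IsOpen Ω) (hne : Ωᶜ.Nonempty) {g : X → ℝ≥0∞}
    (hg : ∫⁻ x in Ω, g x ∂μ < ⊤) {η : ℝ≥0∞} (hη : η ≠ 0) (hηt : η ≠ ⊤) :
    ∃ W ∈ newtonSpace μ Ω ∩ hajlaszSpace μ Ω, ∀ x ∈ densitySet μ Ω g η, ∀ a : ℝ,
      ¬ HasTraceAt μ Ω W x a := by
  obtain ⟨ε, hε0, hεsum⟩ := ENNReal.exists_pos_sum_of_countable' (ε := 1) one_ne_zero ℕ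
  -- This radius bound puts the support of layer `j` within `1 / (j + 1)` of the boundary, so only
  -- finitely many layers are nonzero at a given point of `Ω`.
  have hcov := fun j : ℕ => hΩμ.exists_cover_densitySet hμ hΩ hne hg hη hηt (hε0 j).ne'
    (s := 1 / 10 * (1 / ((j : ℝ) + 1))) (by positivity)
  choose T r hTc hTf hr hcover hTsum using hcov
  have : ∀ j, Countable (T j) := fun j => (hTc j).to_subtype
  have hr0 : ∀ j (b : T j), 0 < r j b := fun j b => (hr j b b.2).1
  have hr1 : ∀ j (b : T j), 10 * r j b ≤ 1 / ((j : ℝ) + 1) := fun j b => by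
    linarith [(hr j b b.2).2]
  -- Within a layer the supremum keeps the value at most `1`, so `w` is finite in `Ω`; summing the
  -- gradients still dominates its variation. Near a point of the density set every layer equals
  -- `1`, so the sum blows up.
  set w : X → ℝ≥0∞ := fun x => ∑' j, ⨆ b : T j, ENNReal.ofReal (cutoff (b : X) (r j b) x) with hw
  set Gj : ℕ → X → ℝ≥0∞ := fun j x => ∑' b : T j, cutoffGrad (b : X) (r j b) x with hGj
  set G : X → ℝ≥0∞ := fun x => ∑' j, Gj j x with hG
  have hGjm : ∀ j, Measurable (Gj j) :=
    fun j => Measurable.tsum fun b => measurable_cutoffGrad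
  have hGm : Measurable G := Measurable.tsum hGjm
  have hwm : Measurable w := Measurable.tsum fun j => Measurable.iSup fun b =>
    measurable_cutoff.ennreal_ofReal
  have hGint : ∫⁻ x in Ω, G x ∂μ < ⊤ := by
    rw [hG, lintegral_tsum fun j => (hGjm j).aemeasurable]
    refine lt_of_le_of_lt (ENNReal.tsum_le_tsum fun j => ?_) (hεsum.trans ENNReal.one_lt_top)
    rw [hGj, lintegral_tsum fun b => measurable_cutoffGrad.aemeasurable]
    exact hTsum j
  have hwG : ∀ x, w x ≤ G x := fun x => ENNReal.tsum_le_tsum fun j => iSup_le fun b => by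
    have h1 : 1 / ((j : ℝ) + 1) ≤ 1 := by
      rw [div_le_one (by positivity)]
      linarith [(Nat.cast_nonneg j : (0 : ℝ) ≤ j)]
    refine (ofReal_cutoff_le_cutoffGrad (hr0 j b) (by linarith [hr1 j b, hr0 j b]) x).trans ?_
    exact ENNReal.le_tsum (f := fun b : T j => cutoffGrad (b : X) (r j b) x) b
  have hwt : ∀ x ∈ Ω, w x ≠ ⊤ := by
    intro x hx
    obtain ⟨J, hJ⟩ := exists_nat_one_div_lt (bdist_pos hΩ hne hx)
    have hz : ∀ j ∉ Finset.range J, ⨆ b : T j, ENNReal.ofReal (cutoff (b : X) (r j b) x) = 0 := by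
      intro j hj
      rw [Finset.mem_range, not_lt] at hj
      refine ENNReal.iSup_eq_zero.2 fun b => ?_
      have h1 : bdist Ω x ≤ dist x b := bdist_le_dist
        (fun hb => (hTf j b.2).2 (hΩ.interior_eq.symm ▸ hb)) x
      have h2 : 1 / ((j : ℝ) + 1) ≤ 1 / ((J : ℝ) + 1) := Nat.one_div_le_one_div hj
      rw [cutoff_eq_zero (hr0 j b) (by linarith [hr1 j b]), ENNReal.ofReal_zero]
    rw [hw]
    simp only
    rw [tsum_eq_sum hz]
    refine ENNReal.sum_ne_top.2 fun j _ => ne_top_of_le_ne_top ENNReal.one_ne_top ?_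
    exact iSup_le fun b => ENNReal.ofReal_le_one.2 (cutoff_le_one x)
  have hhaj : ∀ x y, w x ≤ w y + edist x y * (G x + G y) := by
    intro x y
    have : w y + edist x y * (G x + G y) = ∑' j,
        ((⨆ b : T j, ENNReal.ofReal (cutoff (b : X) (r j b) y)) +
          edist x y * (Gj j x + Gj j y)) := by
      rw [ENNReal.tsum_add, ENNReal.tsum_mul_left, ENNReal.tsum_add]
    rw [this]
    refine ENNReal.tsum_le_tsum fun j => iSup_le fun b => ?_
    refine (ofReal_cutoff_le_add (hr0 j b) x y).trans ?_
    gcongr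
    · exact le_iSup (fun b : T j => ENNReal.ofReal (cutoff (b : X) (r j b) y)) b
    · exact ENNReal.le_tsum (f := fun b : T j => cutoffGrad (b : X) (r j b) x) b
    · exact ENNReal.le_tsum (f := fun b : T j => cutoffGrad (b : X) (r j b) y) b
  have hug : ∀ (γ : Curve X) (p q : X), (∀ j (b : T j),
      ENNReal.ofReal |cutoff (b : X) (r j b) p - cutoff (b : X) (r j b) q| ≤
        γ.integral (cutoffGrad (b : X) (r j b))) → w p ≤ w q + γ.integral G := by
    intro γ p q h
    have : w q + γ.integral G = ∑' j,
        ((⨆ b : T j, ENNReal.ofReal (cutoff (b : X) (r j b) q)) + γ.integral (Gj j)) := by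
      rw [ENNReal.tsum_add, hG, γ.lintegral_tsum hGjm]
    rw [this]
    refine ENNReal.tsum_le_tsum fun j => iSup_le fun b => ?_
    calc _ ≤ ENNReal.ofReal (cutoff (b : X) (r j b) q +
          |cutoff (b : X) (r j b) p - cutoff (b : X) (r j b) q|) :=
          ENNReal.ofReal_le_ofReal (by
            linarith [le_abs_self (cutoff (b : X) (r j b) p - cutoff (b : X) (r j b) q)])
      _ = ENNReal.ofReal (cutoff (b : X) (r j b) q) +
          ENNReal.ofReal |cutoff (b : X) (r j b) p - cutoff (b : X) (r j b) q| :=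
          ENNReal.ofReal_add (cutoff_nonneg _) (abs_nonneg _)
      _ ≤ _ := by
          gcongr
          · exact le_iSup (fun b : T j => ENNReal.ofReal (cutoff (b : X) (r j b) q)) b
          · refine (h j b).trans ?_
            rw [hGj, γ.lintegral_tsum fun b => measurable_cutoffGrad]
            exact ENNReal.le_tsum (f := fun b : T j => γ.integral (cutoffGrad (b : X) (r j b))) b
  set W : X → ℝ := fun x => (w x).toReal with hW
  have hdiff : ∀ x ∈ Ω, ∀ y ∈ Ω, ∀ c : ℝ≥0∞, w x ≤ w y + c → w y ≤ w x + c →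
      ENNReal.ofReal |W x - W y| ≤ c := by
    intro x hx y hy c h1 h2
    rcases eq_or_ne c ⊤ with rfl | hc
    · exact le_top
    refine ENNReal.ofReal_le_of_le_toReal (abs_sub_le_iff.2 ⟨?_, ?_⟩)
    · have := ENNReal.toReal_mono (ENNReal.add_ne_top.2 ⟨hwt y hy, hc⟩) h1
      rw [ENNReal.toReal_add (hwt y hy) hc] at this
      simp only [hW]
      linarith
    · have := ENNReal.toReal_mono (ENNReal.add_ne_top.2 ⟨hwt x hx, hc⟩) h2
      rw [ENNReal.toReal_add (hwt x hx) hc] at this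
      simp only [hW]
      linarith
  have hWint : ∫⁻ x in Ω, ENNReal.ofReal |W x| ∂μ < ⊤ := by
    refine lt_of_le_of_lt (lintegral_mono fun x => ?_) hGint
    simp only [hW]
    rw [abs_of_nonneg ENNReal.toReal_nonneg]
    exact ENNReal.ofReal_toReal_le.trans (hwG x)
  have hWm : AEMeasurable (fun x => (W x : EReal)) (μ.restrict Ω) :=
    (measurable_coe_real_ereal.comp hwm.ennreal_toReal).aemeasurable
  refine ⟨fun x => (W x : EReal), ⟨⟨hWm, ?_⟩, ⟨hWm, ?_⟩⟩, fun x hx a => ?_⟩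
  · refine lt_of_le_of_lt (newtonNorm_coe_le (h := G) hGm.aemeasurable fun γ hγ => ?_)
      (ENNReal.add_lt_top.2 ⟨hWint, hGint⟩)
    refine hdiff _ (hγ _ (right_mem_Icc.2 γ.len_pos.le)) _ (hγ _ (left_mem_Icc.2 γ.len_pos.le)) _
      (hug γ _ _ fun j b => γ.ofReal_abs_cutoff_sub_le (hr0 j b))
      (hug γ _ _ fun j b => ?_)
    rw [abs_sub_comm]
    exact γ.ofReal_abs_cutoff_sub_le (hr0 j b)
  · refine lt_of_le_of_lt (hajlaszNorm_coe_le (h := G) hGm.aemeasurable fun x hx y hy => ?_)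
      (ENNReal.add_lt_top.2 ⟨hWint, hGint⟩)
    refine hdiff x hx y hy _ (hhaj x y) ?_
    rw [edist_comm, add_comm (G x)]
    exact hhaj y x
  · refine not_hasTraceAt_of_eventually_large hΩμ (frontier_subset_closure hx.1)
      hΩ.measurableSet (fun n => ?_) a
    have hn : ∀ j ∈ Finset.range n, ∀ᶠ y in 𝓝 x,
        1 ≤ ⨆ b : T j, ENNReal.ofReal (cutoff (b : X) (r j b) y) := by
      intro j _
      obtain ⟨b, hb, hxb⟩ := hcover j x hx
      filter_upwards [Metric.isOpen_ball.mem_nhds hxb] with y hy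
      refine le_trans ?_ (le_iSup (fun b : T j => ENNReal.ofReal (cutoff (b : X) (r j b) y))
        ⟨b, hb⟩)
      rw [cutoff_eq_one (hr0 j ⟨b, hb⟩) hy, ENNReal.ofReal_one]
    filter_upwards [(Finset.eventually_all _).2 hn] with y hy hyΩ
    have h1 : (n : ℝ≥0∞) ≤ w y := by
      calc (n : ℝ≥0∞) = ∑ _j ∈ Finset.range n, 1 := by simp
        _ ≤ ∑ j ∈ Finset.range n, ⨆ b : T j, ENNReal.ofReal (cutoff (b : X) (r j b) y) :=
          Finset.sum_le_sum hy
        _ ≤ w y := ENNReal.sum_le_tsum _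
    simpa using ENNReal.toReal_mono (hwt y hyΩ) h1

end Exceptional

/-! ### Calculus of traces and transfer of trace spaces. -/

section Traces

theorem aemeasurable_abs_sub_coe {α : Type*} [MeasurableSpace α] {m : Measure α} {u : α → EReal}
    (hu : AEMeasurable u m) (c : ℝ) :
    AEMeasurable (fun y => (u y - (c : EReal)).abs) m := by
  have : Measurable fun a : EReal => (a - (c : EReal)).abs :=
    EReal.measurable_of_measurable_real (by simp_rw [abs_coe_sub_coe]; fun_prop)
  exact this.comp_aemeasurable hu

variable {X : Type*} [MetricSpace X] [MeasurableSpace X] {μ : Measure X} {Ω : Set X}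

theorem tendsto_setLAverage_of_le {x : X} {f g h : X → ℝ≥0∞} {c d : ℝ≥0∞} (hc : c ≠ ⊤)
    (hd : d ≠ ⊤) (hg : AEMeasurable g (μ.restrict Ω))
    (hle : ∀ᵐ y ∂(μ.restrict Ω), f y ≤ c * g y + d * h y)
    (hg0 : Tendsto (fun r : ℝ => ⨍⁻ y in Metric.ball x r ∩ Ω, g y ∂μ) (𝓝[>] 0) (𝓝 0))
    (hh0 : Tendsto (fun r : ℝ => ⨍⁻ y in Metric.ball x r ∩ Ω, h y ∂μ) (𝓝[>] 0) (𝓝 0)) :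
    Tendsto (fun r : ℝ => ⨍⁻ y in Metric.ball x r ∩ Ω, f y ∂μ) (𝓝[>] 0) (𝓝 0) := by
  have hlim : Tendsto (fun r : ℝ => c * (⨍⁻ y in Metric.ball x r ∩ Ω, g y ∂μ) +
      d * ⨍⁻ y in Metric.ball x r ∩ Ω, h y ∂μ) (𝓝[>] 0) (𝓝 0) := by
    simpa using (ENNReal.Tendsto.const_mul hg0 (.inr hc)).add
      (ENNReal.Tendsto.const_mul hh0 (.inr hd))
  refine tendsto_of_tendsto_of_tendsto_of_le_of_le tendsto_const_nhds hlim (fun _ => zero_le)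
    fun r => ?_
  have hmono : μ.restrict (Metric.ball x r ∩ Ω) ≤ μ.restrict Ω :=
    Measure.restrict_mono inter_subset_right le_rfl
  simp only [setLAverage_eq]
  rw [← mul_div_assoc, ← mul_div_assoc, ← ENNReal.add_div, ← lintegral_const_mul' _ _ hc,
    ← lintegral_const_mul' _ _ hd, ← lintegral_add_left' ((hg.mono_measure hmono).const_mul c)]
  gcongr ?_ / _
  exact lintegral_mono_ae (ae_mono hmono hle)

/-- The convention that differences involving an infinite value have absolute value `∞` is what
saves the triangle inequality: if `a` or `b` is infinite, the first term on the right is `∞`. -/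
theorem abs_sub_le_abs_sub_add_abs_sub (a b : EReal) (c : ℝ) :
    (a - c).abs ≤ (a - b).abs + (b - c).abs := by
  by_cases h : a = ⊤ ∨ a = ⊥ ∨ b = ⊤ ∨ b = ⊥
  · rw [abs_sub_eq_top h, top_add]
    exact le_top
  · push Not at h
    lift a to ℝ using ⟨h.1, h.2.1⟩
    lift b to ℝ using ⟨h.2.2.1, h.2.2.2⟩
    rw [abs_coe_sub_coe, abs_coe_sub_coe, abs_coe_sub_coe,
      ← ENNReal.ofReal_add (abs_nonneg _) (abs_nonneg _)]
    exact ENNReal.ofReal_le_ofReal (abs_sub_le _ _ _)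

theorem abs_sub_comm_ereal (a b : EReal) : (a - b).abs = (b - a).abs := by
  by_cases h : a = ⊤ ∨ a = ⊥ ∨ b = ⊤ ∨ b = ⊥
  · rw [abs_sub_eq_top h, abs_sub_eq_top (by tauto)]
  · push Not at h
    lift a to ℝ using ⟨h.1, h.2.1⟩
    lift b to ℝ using ⟨h.2.2.1, h.2.2.2⟩
    rw [abs_coe_sub_coe, abs_coe_sub_coe, abs_sub_comm]

theorem HasTraceAt.of_close {u v : X → EReal} {x : X} {a : ℝ}
    (hv : AEMeasurable v (μ.restrict Ω)) (h : HasTraceAt μ Ω v x a)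
    (huv : Tendsto (fun r : ℝ => ⨍⁻ y in Metric.ball x r ∩ Ω, (u y - v y).abs ∂μ)
      (𝓝[>] 0) (𝓝 0)) : HasTraceAt μ Ω u x a := by
  refine tendsto_setLAverage_of_le ENNReal.one_ne_top ENNReal.one_ne_top
    (aemeasurable_abs_sub_coe hv a) (Eventually.of_forall fun y => ?_) h huv
  rw [one_mul, one_mul, add_comm]
  exact abs_sub_le_abs_sub_add_abs_sub _ _ _

/-- The constant `|a - b|` is its own average, since balls meet `Ω` in positive finite measure, and
the triangle inequality forces that average to tend to zero. -/
theorem HasTraceAt.unique (hΩμ : IsDoublingOn μ Ω) {u : X → EReal} {x : X}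
    (hx : x ∈ closure Ω) (hu : AEMeasurable u (μ.restrict Ω)) {a b : ℝ}
    (ha : HasTraceAt μ Ω u x a) (hb : HasTraceAt μ Ω u x b) : a = b := by
  have h := tendsto_setLAverage_of_le (f := fun _ => ENNReal.ofReal |a - b|) ENNReal.one_ne_top
    ENNReal.one_ne_top (aemeasurable_abs_sub_coe hu a) (Eventually.of_forall fun y => by
      rw [one_mul, one_mul, ← abs_coe_sub_coe, abs_sub_comm_ereal (u y) a]
      exact abs_sub_le_abs_sub_add_abs_sub _ _ _) ha hb
  have h2 : Tendsto (fun r : ℝ => ⨍⁻ _ in Metric.ball x r ∩ Ω, ENNReal.ofReal |a - b| ∂μ)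
      (𝓝[>] 0) (𝓝 (ENNReal.ofReal |a - b|)) := by
    refine tendsto_const_nhds.congr' ?_
    filter_upwards [self_mem_nhdsWithin] with r hr
    rw [setLAverage_const (hΩμ.measure_ball_inter_pos hx hr).ne'
      (hΩμ.measure_ball_inter_lt_top hx hr).ne]
  have h3 := tendsto_nhds_unique h h2
  have h4 : |a - b| ≤ 0 := ENNReal.ofReal_eq_zero.1 h3.symm
  exact sub_eq_zero.1 (abs_nonpos_iff.1 h4)

theorem HasTraceAt.linear_combination {u v w : X → EReal} {x : X} {a b α β : ℝ}
    (hum : AEMeasurable u (μ.restrict Ω))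
    (hu : ∀ᵐ y ∂(μ.restrict Ω), (u y).abs < ⊤) (hv : ∀ᵐ y ∂(μ.restrict Ω), (v y).abs < ⊤)
    (hw : ∀ᵐ y ∂(μ.restrict Ω), w y = (α : EReal) * u y + (β : EReal) * v y)
    (ha : HasTraceAt μ Ω u x a) (hb : HasTraceAt μ Ω v x b) :
    HasTraceAt μ Ω w x (α * a + β * b) := by
  refine tendsto_setLAverage_of_le (c := ENNReal.ofReal |α|) (d := ENNReal.ofReal |β|)
    ENNReal.ofReal_ne_top ENNReal.ofReal_ne_top (aemeasurable_abs_sub_coe hum a) ?_ ha hb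
  filter_upwards [hu, hv, hw] with y h1 h2 h3
  rw [h3, ← coe_toReal_of_abs_ne_top h1.ne, ← coe_toReal_of_abs_ne_top h2.ne, ← EReal.coe_mul,
    ← EReal.coe_mul, ← EReal.coe_add, abs_coe_sub_coe, abs_coe_sub_coe, abs_coe_sub_coe,
    ← ENNReal.ofReal_mul (abs_nonneg _), ← ENNReal.ofReal_mul (abs_nonneg _),
    ← ENNReal.ofReal_add (by positivity) (by positivity), ← abs_mul, ← abs_mul]
  refine ENNReal.ofReal_le_ofReal (le_trans (le_of_eq ?_) (abs_add_le _ _))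
  congr 1
  ring

/-- At points outside all sets of positive density, boundary close functions have the same
traces. -/
theorem tendsto_setLAverage_of_notMem_densitySet (hΩμ : IsDoublingOn μ Ω) (hΩ : IsOpen Ω)
    {u v : X → EReal} {g : X → ℝ≥0∞} {x : X} (hx : x ∈ frontier Ω)
    (hclose : ∀ x ∉ Ω, ∀ r : ℝ, 0 < r → ∫⁻ z in Metric.ball x r ∩ Ω, (u z - v z).abs ∂μ ≤
      ENNReal.ofReal r * ∫⁻ z in Metric.ball x (4 * r) ∩ Ω, g z ∂μ)
    (hdens : ∀ k : ℕ, x ∉ densitySet μ Ω g ((k : ℝ≥0∞) + 1)⁻¹) :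
    Tendsto (fun r : ℝ => ⨍⁻ y in Metric.ball x r ∩ Ω, (u y - v y).abs ∂μ) (𝓝[>] 0) (𝓝 0) := by
  have hxc := frontier_subset_closure hx
  have hxΩ : x ∉ Ω := fun h => hx.2 (hΩ.interior_eq.symm ▸ h)
  obtain ⟨D, hD1, hD⟩ := hΩμ.exists_measure_ball_inter_le 4
  rw [ENNReal.tendsto_nhds_zero]
  intro ε hε
  obtain ⟨k, hk⟩ := ENNReal.exists_inv_nat_lt
    (ENNReal.div_ne_zero.2 ⟨hε.ne', ENNReal.coe_ne_top (r := D)⟩)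
  have hη : D * ((k : ℝ≥0∞) + 1)⁻¹ ≤ ε := by
    have h1 : ((k : ℝ≥0∞) + 1)⁻¹ ≤ ε / D := by
      refine le_trans ?_ hk.le
      rw [ENNReal.inv_le_inv]
      exact le_self_add
    rw [mul_comm]
    exact ENNReal.mul_le_of_le_div h1
  have hnot := hdens k
  simp only [densitySet, mem_ofPred_eq, not_and, not_forall, not_exists, not_lt] at hnot
  obtain ⟨r₀, hr₀, hr⟩ := hnot hx
  filter_upwards [Ioo_mem_nhdsGT (by positivity : 0 < r₀ / 4)] with r hrr
  have hr0 : 0 < r := hrr.1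
  -- Closeness at radius `r` involves `g` on the ball of radius `4 * r`, so the density is tested
  -- there and doubling returns to radius `r`.
  have h4 := hr (4 * r) (by positivity) (by linarith [hrr.2])
  rw [setLAverage_eq, ENNReal.div_le_iff (hΩμ.measure_ball_inter_pos hxc hr0).ne'
    (hΩμ.measure_ball_inter_lt_top hxc hr0).ne]
  calc _ ≤ ENNReal.ofReal r * ∫⁻ z in Metric.ball x (4 * r) ∩ Ω, g z ∂μ := hclose x hxΩ r hr0
    _ ≤ ENNReal.ofReal (4 * r) * ∫⁻ z in Metric.ball x (4 * r) ∩ Ω, g z ∂μ := by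
      gcongr
      linarith
    _ ≤ ((k : ℝ≥0∞) + 1)⁻¹ * μ (Metric.ball x (4 * r) ∩ Ω) := h4
    _ ≤ ((k : ℝ≥0∞) + 1)⁻¹ * (D * μ (Metric.ball x r ∩ Ω)) := by
      gcongr
      exact hD x hxc r hr0
    _ = D * ((k : ℝ≥0∞) + 1)⁻¹ * μ (Metric.ball x r ∩ Ω) := by ring
    _ ≤ _ := by gcongr

/-- Transfer of trace spaces between two function spaces with the same boundary behaviour. -/
theorem IsTraceSpace.transfer (hΩμ : IsDoublingOn μ Ω) (hΩ : IsOpen Ω) {ν : Measure (frontier Ω)}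
    {S₁ S₂ : Set (X → EReal)} {N₁ N₂ : (X → EReal) → ℝ≥0∞}
    {Y : Type*} [NormedAddCommGroup Y] [NormedSpace ℝ Y]
    {ι : Y →ₗ[ℝ] (frontier Ω →ₘ[ν] ℝ)} (hι : Function.Injective ι)
    (hS₁ : ∀ u ∈ S₁, AEMeasurable u (μ.restrict Ω) ∧ ∫⁻ x in Ω, (u x).abs ∂μ < ⊤)
    (hS₂ : ∀ u ∈ S₂, AEMeasurable u (μ.restrict Ω))
    (h₁₂ : ∃ D : ℝ≥0, ∀ u ∈ S₁, ∃ v ∈ S₂, N₂ v ≤ D * N₁ u ∧ BoundaryClose μ Ω u v)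
    (h₂₁ : ∀ v ∈ S₂, ∃ u ∈ S₁, BoundaryClose μ Ω v u)
    (hexc : ∀ g : X → ℝ≥0∞, ∫⁻ x in Ω, g x ∂μ < ⊤ → ∀ η : ℝ≥0∞, η ≠ 0 → η ≠ ⊤ →
      ∃ W ∈ S₂, ∀ x ∈ densitySet μ Ω g η, ∀ a : ℝ, ¬ HasTraceAt μ Ω W x a)
    (h : IsTraceSpace μ Ω ν S₂ N₂ ι) : IsTraceSpace μ Ω ν S₁ N₁ ι := by
  obtain ⟨T, htr, -, ⟨C, hC⟩, hsurj⟩ := h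
  obtain ⟨D, hD⟩ := h₁₂
  have hdiff : ∀ u v : X → EReal, BoundaryClose μ Ω u v → ∀ᵐ x : frontier Ω ∂ν,
      Tendsto (fun r : ℝ => ⨍⁻ y in Metric.ball (x : X) r ∩ Ω, (u y - v y).abs ∂μ)
        (𝓝[>] 0) (𝓝 0) := by
    rintro u v ⟨g, -, hgt, hclose⟩
    -- The only information on `ν` is that members of `S₂` have traces almost everywhere. Applied to
    -- `W`, which has none on the density set, it makes that set negligible.
    have hk : ∀ k : ℕ, ∀ᵐ x : frontier Ω ∂ν, (x : X) ∉ densitySet μ Ω g ((k : ℝ≥0∞) + 1)⁻¹ := by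
      intro k
      obtain ⟨W, hW, hWx⟩ := hexc g hgt ((k : ℝ≥0∞) + 1)⁻¹
        (ENNReal.inv_ne_zero.2 (by finiteness)) (ENNReal.inv_ne_top.2 (by positivity))
      filter_upwards [htr ⟨W, hW⟩] with x hx hmem
      exact hWx x hmem _ hx
    filter_upwards [ae_all_iff.2 hk] with x hx
    exact tendsto_setLAverage_of_notMem_densitySet hΩμ hΩ x.2 hclose hx
  have hfin : ∀ u ∈ S₁, ∀ᵐ y ∂(μ.restrict Ω), (u y).abs < ⊤ := fun u hu =>
    ae_lt_top' (measurable_ereal_abs.comp_aemeasurable (hS₁ u hu).1) (hS₁ u hu).2.ne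
  choose! V hVS hVN hVc using hD
  -- The choice `V` need not be linear; `T₁` is, because it computes the trace of `u` itself, and
  -- traces are unique and linear.
  set T₁ : S₁ → Y := fun u => T ⟨V u.1, hVS u.1 u.2⟩ with hT₁
  have htr₁ : ∀ u : S₁, ∀ᵐ x : frontier Ω ∂ν, HasTraceAt μ Ω u.1 (x : X) (ι (T₁ u) x) := by
    intro u
    filter_upwards [htr ⟨V u.1, hVS u.1 u.2⟩, hdiff _ _ (hVc u.1 u.2)] with x h1 h2
    exact h1.of_close (hS₂ _ (hVS u.1 u.2)) h2
  refine ⟨T₁, htr₁, fun a b u v w hw => hι ?_, ⟨C * D, fun u => ?_⟩, fun y => ?_⟩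
  · rw [map_add, map_smul, map_smul]
    refine AEEqFun.ext ?_
    filter_upwards [htr₁ u, htr₁ v, htr₁ w, AEEqFun.coeFn_add (a • ι (T₁ u)) (b • ι (T₁ v)),
      AEEqFun.coeFn_smul a (ι (T₁ u)), AEEqFun.coeFn_smul b (ι (T₁ v))] with x h1 h2 h3 h4 h5 h6
    rw [h4, Pi.add_apply, h5, h6, Pi.smul_apply, Pi.smul_apply, smul_eq_mul, smul_eq_mul]
    exact h3.unique hΩμ (frontier_subset_closure x.2) (hS₁ w w.2).1
      (h1.linear_combination (hS₁ u u.2).1 (hfin u u.2) (hfin v v.2) hw h2)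
  · refine (hC _).trans ?_
    rw [ENNReal.coe_mul, mul_assoc]
    gcongr
    exact hVN u.1 u.2
  · obtain ⟨v, rfl⟩ := hsurj y
    obtain ⟨u, hu, hclose⟩ := h₂₁ v.1 v.2
    refine ⟨⟨u, hu⟩, hι (AEEqFun.ext ?_)⟩
    filter_upwards [htr₁ ⟨u, hu⟩, htr v, hdiff _ _ hclose] with x h1 h2 h3
    refine h1.unique hΩμ (frontier_subset_closure x.2) (hS₁ u hu).1
      (h2.of_close (hS₂ _ v.2) ?_)
    simpa only [abs_sub_comm_ereal] using h3

/-- There is only one class of functions on the empty set, so injectivity of `ι` makes `Y` trivial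
and the zero operator works. -/
theorem isTraceSpace_of_isEmpty_frontier [IsEmpty (frontier Ω)] {ν : Measure (frontier Ω)}
    {S : Set (X → EReal)} {N : (X → EReal) → ℝ≥0∞} (hS : S.Nonempty)
    {Y : Type*} [NormedAddCommGroup Y] [NormedSpace ℝ Y]
    {ι : Y →ₗ[ℝ] (frontier Ω →ₘ[ν] ℝ)} (hι : Function.Injective ι) :
    IsTraceSpace μ Ω ν S N ι := by
  have hY : ∀ y : Y, y = 0 := fun y =>
    hι (AEEqFun.ext (Eventually.of_forall fun x => isEmptyElim x))
  obtain ⟨u, hu⟩ := hS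
  exact ⟨fun _ => 0, fun _ => Eventually.of_forall fun x => isEmptyElim x,
    fun _ _ _ _ _ _ => (hY _).symm, ⟨0, fun _ => by simp⟩, fun y => ⟨⟨u, hu⟩, (hY y).symm⟩⟩

theorem zero_mem_newtonSpace : (fun _ => ((0 : ℝ) : EReal)) ∈ newtonSpace μ Ω := by
  refine ⟨aemeasurable_const, lt_of_le_of_lt
    (newtonNorm_coe_le (v := fun _ => 0) (h := 0) aemeasurable_const fun γ _ => ?_) ?_⟩ <;> simp

theorem zero_mem_hajlaszSpace : (fun _ => ((0 : ℝ) : EReal)) ∈ hajlaszSpace μ Ω := by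
  refine ⟨aemeasurable_const, lt_of_le_of_lt
    (hajlaszNorm_coe_le (v := fun _ => 0) (h := 0) aemeasurable_const fun _ _ _ _ => ?_) ?_⟩ <;>
  simp

end Traces

end BoundaryTrace

theorem corollary1p7 {X : Type*} [MetricSpace X] [CompleteSpace X] [MeasurableSpace X]
    [BorelSpace X] (μ : Measure X) (hμ : BoundaryTrace.IsDoubling μ)
    (hP : BoundaryTrace.SupportsPoincare μ)
    (Ω : Set X) (hΩ : BoundaryTrace.IsUniformDomain Ω) (hΩμ : BoundaryTrace.IsDoublingOn μ Ω)
    (ν : Measure (frontier Ω))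
    {Y : Type*} [NormedAddCommGroup Y] [NormedSpace ℝ Y] [CompleteSpace Y]
    (ι : Y →ₗ[ℝ] (frontier Ω →ₘ[ν] ℝ)) (hι : Function.Injective ι) :
    BoundaryTrace.IsTraceSpace μ Ω ν
        (BoundaryTrace.newtonSpace μ Ω) (BoundaryTrace.newtonNorm μ Ω) ι ↔
      BoundaryTrace.IsTraceSpace μ Ω ν
        (BoundaryTrace.hajlaszSpace μ Ω) (BoundaryTrace.hajlaszNorm μ Ω) ι := by
  -- For `Ω = X` the real-valued distance to the complement degenerates to `0`, so the
  -- regularization is unavailable; but then there is no boundary.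
  rcases Ωᶜ.eq_empty_or_nonempty with hempty | hne
  · have hfr : frontier Ω = ∅ := by rw [compl_empty_iff.1 hempty, frontier_univ]
    have : IsEmpty (frontier Ω) := isEmpty_coe_sort.2 hfr
    exact iff_of_true
      (BoundaryTrace.isTraceSpace_of_isEmpty_frontier ⟨_, BoundaryTrace.zero_mem_newtonSpace⟩ hι)
      (BoundaryTrace.isTraceSpace_of_isEmpty_frontier ⟨_, BoundaryTrace.zero_mem_hajlaszSpace⟩ hι)
  obtain ⟨D₁, hD₁⟩ := hμ.exists_boundaryClose_of_newtonSpace hP hΩ hne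
  obtain ⟨D₂, hD₂⟩ := hμ.exists_boundaryClose_of_hajlaszSpace hΩ hne
  have hN : ∀ u ∈ BoundaryTrace.newtonSpace μ Ω, AEMeasurable u (μ.restrict Ω) ∧
      ∫⁻ x in Ω, (u x).abs ∂μ < ⊤ := fun u hu => ⟨hu.1, lt_of_le_of_lt le_self_add hu.2⟩
  have hM : ∀ u ∈ BoundaryTrace.hajlaszSpace μ Ω, AEMeasurable u (μ.restrict Ω) ∧
      ∫⁻ x in Ω, (u x).abs ∂μ < ⊤ := fun u hu => ⟨hu.1, lt_of_le_of_lt le_self_add hu.2⟩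
  constructor
  · refine BoundaryTrace.IsTraceSpace.transfer hΩμ hΩ.1 hι hM (fun u hu => hu.1)
      ⟨D₂, fun u hu => ?_⟩ (fun v hv => ?_) (fun g hg η hη hηt => ?_)
    · obtain ⟨v, hv, h1, h2⟩ := hD₂ u hu
      exact ⟨v, hv.1, h1, h2⟩
    · obtain ⟨u, hu, -, h2⟩ := hD₁ v hv
      exact ⟨u, hu.2, h2⟩
    · obtain ⟨W, hW, h⟩ := hΩμ.exists_forall_not_hasTraceAt hμ hΩ.1 hne hg hη hηt
      exact ⟨W, hW.1, h⟩
  · refine BoundaryTrace.IsTraceSpace.transfer hΩμ hΩ.1 hι hN (fun u hu => hu.1)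
      ⟨D₁, fun u hu => ?_⟩ (fun v hv => ?_) (fun g hg η hη hηt => ?_)
    · obtain ⟨v, hv, h1, h2⟩ := hD₁ u hu
      exact ⟨v, hv.2, h1, h2⟩
    · obtain ⟨u, hu, -, h2⟩ := hD₂ v hv
      exact ⟨u, hu.1, h2⟩
    · obtain ⟨W, hW, h⟩ := hΩμ.exists_forall_not_hasTraceAt hμ hΩ.1 hne hg hη hηt
      exact ⟨W, hW.2, h⟩
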